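/- **Theorem (local well-posedness in subcritical Fourier–Herz spaces).** Fix $\varphi\in C_c^\infty(\mathbb R^3;[0,1])$ supported in $\{3/4\le|\xi|\le 8/3\}$ with $\sum_{j\in\mathbb Z}\varphi(2^{-j}\xi)=1$ for $\xi\ne0$, let $\dot\Delta_j$ be the Fourier multiplier with symbol $\varphi(2^{-j}\xi)$, and put $\|f\|_{FL^p}=\|\hat f\|_{L^p}$, $$\|f\|_{F\dot B^{s}_{p,q}}=\big\|2^{js}\|\dot\Delta_jf\|_{FL^p}\big\|_{\ell^q(\mathbb Z)},\qquad \|u\|_{\widetilde L^r(I;F\dot B^{s}_{p,q})}=\big\|2^{js}\|\dot\Delta_ju\|_{L^r(I;FL^p)}\big\|_{\ell^q(\mathbb Z)} .$$ $F\dot B^s_{p,q}(\mathbb R^3)$ consists of the tempered distributions $f$ of finite norm with $f=\sum_j\dot\Delta_jf$ in $\mathcal S'$. Let $s_p=2-\frac3p$. Let $\nu>0$, $p,q\in[1,\infty]$ and $s\in(s_p,0]$ with $(s,p)\ne(0,1)$ (so that $p<\frac32$). There are constants $c,C>0$, depending only on $\nu,s,p,q$ and $\varphi$, such that the following holds for every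 real vector field $u_0\in F\dot B^s_{p,q}(\mathbb R^3)$ with $\operatorname{div}u_0=0$. There is a time $T^*\in(0,\infty]$, which depends on $u_0$ only through $\|u_0\|_{F\dot B^s_{p,q}}$, with $$T^*\ \ge\ c\,\|u_0\|_{F\dot B^s_{p,q}}^{-2/(s-s_p)}$$ (for $u_0=0$ this means $T^*=\infty$), such that the Navier–Stokes equations have a mild solution $u$ on $[0,T^*)$, that is, a real divergence-free field with $$u(t)=e^{\nu t\Delta}u_0-\int_0^te^{\nu(t-\tau)\Delta}\,\mathbb P\,\operatorname{div}(u\otimes u)(\tau)\,d\tau ,\qquad 0\le t<T^*,$$ $\mathbb P$ being the Leray projector (the equation is read in Fourier variables, $\widehat{u_ku_l}=\hat u_k*\hat u_l$, with absolutely convergent integrals), which belongs to the class $X_{T^*}$, where $$X_T=C\big([0,T);F\dot B^s_{p,q}(\mathbb R^3)\big)\cap\bigcap_{r\in[1,\infty]}\widetilde L^r_{\rm loc}\big([0,T);F\dot B^{s+2/r}_{p,q}(\mathbb R^3)\big),$$ and which satisfies $$\sup_{0\le t<T^*}\|u(t)\|_{F\dot B^s_{p,q}}\le C\|u_0\|_{F\dot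 B^s_{p,q}},\qquad \|u\|_{\widetilde L^r([0,T^*);F\dot B^{s+2/r}_{p,q})}\le C\|u_0\|_{F\dot B^s_{p,q}}\quad\text{for all } r\in[1,\infty].$$ The solution is unique: for every $0<T\le T^*$, any mild solution on $[0,T)$ in $X_T$ with initial value $u_0$ coincides with $u$ on $[0,T)$. When $q=\infty$, $u\in C([0,T);F\dot B^s_{p,\infty})$ means that $u(t)\in F\dot B^s_{p,\infty}$ for all $t\in[0,T)$, that $u$ is norm-continuous on $(0,T)$, and that $u(t)\to u(0)$ weakly-* (in $\mathcal S'$) as $t\to0^+$. -/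

import Mathlib

open MeasureTheory Filter Topology
open scoped SchwartzMap FourierTransform ENNReal NNReal LineDeriv

noncomputable section

namespace FourierHerz

/-- Physical space, and frequency space, `ℝ³`. -/
abbrev E3 : Type := EuclideanSpace ℝ (Fin 3)

/-- The (complexified) space of values of a velocity field. -/
abbrev V3 : Type := EuclideanSpace ℂ (Fin 3)

/-- Vector-valued tempered distributions on `ℝ³`. -/
abbrev VDist : Type := 𝓢'(E3, V3)

/-! ### Littlewood-Paley theory and Fourier-Herz spaces -/

/-- `φ` is the symbol of a homogeneous Littlewood-Paley decomposition: smooth, with values in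
`[0, 1]`, supported in the annulus `3/4 ≤ |ξ| ≤ 8/3`, and such that the dilates `φ (2⁻ʲ ξ)` form a
partition of unity away from the origin. -/
structure IsLittlewoodPaley (φ : E3 → ℝ) : Prop where
  contDiff : ContDiff ℝ ((⊤ : ℕ∞) : WithTop ℕ∞) φ
  nonneg : ∀ ξ, 0 ≤ φ ξ
  le_one : ∀ ξ, φ ξ ≤ 1
  tsupport_subset : tsupport φ ⊆ {ξ | 3 / 4 ≤ ‖ξ‖ ∧ ‖ξ‖ ≤ 8 / 3}
  partition : ∀ ξ, ξ ≠ 0 → HasSum (fun j : ℤ => φ ((2 : ℝ) ^ (-j) • ξ)) 1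

/-- The dyadic block `Δ_j f`, i.e. the Fourier multiplier with symbol `φ (2⁻ʲ ξ)`. -/
def block (φ : E3 → ℝ) (j : ℤ) (f : VDist) : VDist :=
  TemperedDistribution.fourierMultiplierCLM V3
    (fun ξ => ((φ ((2 : ℝ) ^ (-j) • ξ) : ℝ) : ℂ)) f

/-- The tempered distribution `f` is (integration against) the locally integrable function `g`. -/
def IsGivenBy (f : VDist) (g : E3 → V3) : Prop :=
  LocallyIntegrable g ∧
    ∀ ψ : 𝓢(E3, ℂ), Integrable (fun ξ => ψ ξ • g ξ) ∧ f ψ = ∫ ξ, ψ ξ • g ξ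

/-- `‖f‖_{FL^p} = ‖f̂‖_{L^p}`; it is `∞` if `f̂` is not a function. (The function that gives `f̂` is
unique up to null sets, so the infimum is over at most one value.) -/
def flNorm (p : ℝ≥0∞) (f : VDist) : ℝ≥0∞ :=
  ⨅ (g : E3 → V3) (_ : IsGivenBy (𝓕 f) g), eLpNorm g p volume

/-- The `ℓ^q(ℤ)` norm of a sequence in `[0, ∞]`. -/
def seqNorm (q : ℝ≥0∞) (a : ℤ → ℝ≥0∞) : ℝ≥0∞ :=
  if q = ∞ then ⨆ j, a j else (∑' j, a j ^ q.toReal) ^ (1 / q.toReal)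

/-- The homogeneous Fourier-Herz norm `‖f‖_{FḂ^s_{p,q}}`. -/
def fhNorm (φ : E3 → ℝ) (s : ℝ) (p q : ℝ≥0∞) (f : VDist) : ℝ≥0∞ :=
  seqNorm q fun j => (2 : ℝ≥0∞) ^ ((j : ℝ) * s) * flNorm p (block φ j f)

/-- `f ∈ FḂ^s_{p,q}(ℝ³)`. For `s < 3 (1 - 1/p)` the dyadic series of a distribution of finite norm
converges, so a class modulo polynomials of finite norm has exactly one representative that equals
the sum of its dyadic blocks; it is this representative that is used. -/
def MemFH (φ : E3 → ℝ) (s : ℝ) (p q : ℝ≥0∞) (f : VDist) : Prop :=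
  (∀ ψ : 𝓢(E3, ℂ), HasSum (fun j : ℤ => block φ j f ψ) (f ψ)) ∧ fhNorm φ s p q f < ∞

/-- The critical regularity index `s_p = 2 - 3/p` (equal to `2` for `p = ∞`). -/
def criticalIndex (p : ℝ≥0∞) : ℝ := 2 - (3 / p).toReal

/-! ### Spaces of time-dependent distributions -/

/-- The time interval `[0, T)`, where `T` may be infinite. -/
def timeIco (T : ℝ≥0∞) : Set ℝ := {t | 0 ≤ t ∧ ENNReal.ofReal t < T}

/-- The time interval `(0, T)`, where `T` may be infinite. -/
def timeIoo (T : ℝ≥0∞) : Set ℝ := {t | 0 < t ∧ ENNReal.ofReal t < T}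

/-- The Chemin-Lerner norm of `u` in `L̃^r(0, T; FḂ^σ_{p,q})`. -/
def clNorm (φ : E3 → ℝ) (σ : ℝ) (p q r T : ℝ≥0∞) (u : ℝ → VDist) : ℝ≥0∞ :=
  seqNorm q fun j => (2 : ℝ≥0∞) ^ ((j : ℝ) * σ) *
    eLpNorm (fun t => flNorm p (block φ j (u t))) r (volume.restrict (timeIoo T))

/-- `u ∈ C([0, T); FḂ^s_{p,q})`. For `q < ∞` this is continuity in norm on `[0, T)`. For `q = ∞` it
is, as usual, continuity in norm on `(0, T)` and weak-* continuity (in the sense of tempered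
distributions) at `t = 0`. -/
structure IsContFH (φ : E3 → ℝ) (s : ℝ) (p q T : ℝ≥0∞) (u : ℝ → VDist) : Prop where
  mem : ∀ t ∈ timeIco T, MemFH φ s p q (u t)
  cont : ∀ t₀ ∈ timeIco T, (q ≠ ∞ ∨ 0 < t₀) →
    Tendsto (fun t => fhNorm φ s p q (u t - u t₀)) (𝓝[timeIco T] t₀) (𝓝 0)
  cont_zero : q = ∞ → ∀ ψ : 𝓢(E3, ℂ), Tendsto (fun t => u t ψ) (𝓝[timeIco T] 0) (𝓝 (u 0 ψ))

/-- `u ∈ C([0, T); FḂ^s_{p,q}) ∩ L̃^r_loc([0, T); FḂ^{s+2/r}_{p,q})` for all `r ∈ [1, ∞]`. -/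
structure MemX (φ : E3 → ℝ) (s : ℝ) (p q T : ℝ≥0∞) (u : ℝ → VDist) : Prop where
  cont : IsContFH φ s p q T u
  cl_lt_top : ∀ r : ℝ≥0∞, 1 ≤ r → ∀ T' < T, clNorm φ (s + (2 / r).toReal) p q r T' u < ∞

/-! ### Mild solutions of the Navier-Stokes equations -/

/-- `div f = 0` in the sense of distributions. -/
def IsDivFree (f : VDist) : Prop :=
  ∀ ψ : 𝓢(E3, ℂ), ∑ i : Fin 3, (∂_{(EuclideanSpace.single i (1 : ℝ) : E3)} f) ψ i = 0

/-- `f` is a real vector field: it takes real values on real test functions. -/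
def IsReal (f : VDist) : Prop :=
  ∀ ψ : 𝓢(E3, ℂ), (∀ x, (ψ x).im = 0) → ∀ i : Fin 3, (f ψ i).im = 0

/-- The symbol of the heat semigroup `e^{νtΔ}`, for the Fourier transform
`f̂(ξ) = ∫ e^{-2πi x·ξ} f(x) dx`. -/
def heatSymbol (ν t : ℝ) (ξ : E3) : ℝ := Real.exp (-(4 * Real.pi ^ 2 * ν * t * ‖ξ‖ ^ 2))

/-- The symbol `v ↦ v - ξ (ξ · v) / |ξ|²` of the Leray projector. -/
def leraySymbol (ξ : E3) (v : V3) : V3 :=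
  WithLp.toLp 2 fun i => v i - (ξ i : ℂ) * (∑ k, (ξ k : ℂ) * v k) / ((‖ξ‖ : ℂ) ^ 2)

/-- The Fourier transform at `ξ` of `div (u ⊗ u) = ∑ k, ∂_k (u_k u)`, for a field `u` with Fourier
transform `g`: the Fourier transform of the product `u_k u` is the convolution of those of `u_k`
and `u`. For divergence-free `u` this is `u · ∇u`. -/
def convectionSymbol (g : E3 → V3) (ξ : E3) : V3 :=
  ∑ k : Fin 3, (2 * Real.pi * Complex.I * (ξ k : ℂ)) • ∫ η, g (ξ - η) k • g η

/-- `u` is a mild solution on `[0, T)` of the Navier-Stokes equations with viscosity `ν` and initial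
value `u₀`: a real divergence-free field with
`u(t) = e^{νtΔ} u₀ - ∫₀ᵗ e^{ν(t-τ)Δ} ℙ div (u ⊗ u)(τ) dτ`. The integral equation is read in Fourier
variables, where `U t` is the Fourier transform of `u t`; all integrals converge absolutely. -/
structure IsMildSolution (ν : ℝ) (T : ℝ≥0∞) (u₀ : VDist) (u : ℝ → VDist) : Prop where
  real : ∀ t ∈ timeIco T, IsReal (u t)
  divFree : ∀ t ∈ timeIco T, IsDivFree (u t)
  initial : u 0 = u₀
  duhamel : ∃ U : ℝ → E3 → V3,
    AEStronglyMeasurable (Function.uncurry U) ((volume.restrict (timeIoo T)).prod volume) ∧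
    (∀ t ∈ timeIco T, IsGivenBy (𝓕 (u t)) (U t)) ∧
    ∀ t ∈ timeIco T, ∀ᵐ ξ : E3,
      (∀ k : Fin 3, Integrable (fun z : ℝ × E3 => U z.1 (ξ - z.2) k • U z.1 z.2)
        ((volume.restrict (Set.Ioo 0 t)).prod volume)) ∧
      U t ξ = heatSymbol ν t ξ • U 0 ξ -
        ∫ τ in Set.Ioo 0 t, heatSymbol ν (t - τ) ξ • leraySymbol ξ (convectionSymbol (U τ) ξ)

end FourierHerz

end

/-!
The proof takes place on the Fourier side, and it only ever estimates moduli of Fourier transforms.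
Write `δ = s - s_p` and `α = 3 (1 - 1/p) - s = 1 - δ`; the hypotheses on `s` and `p` say that
`0 < α < 1` and `s > -1` (`index_conditions`). Since `0 < α`, an element of `FḂ^s_{p,q}` has a
Fourier transform whose mass at frequencies `≲ 2ˡ` is `O(2^{lα})` (`exists_lowMass_le`); since
`α < 1`, that Fourier transform is a function integrable against `(1 + |ξ|)⁻¹`. Thus elements of the
space correspond to functions of the frequency (`MemFH.exists_isGivenBy`, `exists_isGivenBy`), and a
real divergence-free element to a function that is Hermitian and orthogonal to `ξ`
(`exists_hermitian`).

**Bilinear estimate.** The working norm is that of `L̃^∞(FḂ^s_{p,q}) ∩ L̃¹(FḂ^{s+2}_{p,q})`, applied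
to non-negative functions of time and frequency (`slabNorm`); it controls all `L̃^r(FḂ^{s+2/r}_{p,q})`
(`clNorm_le_slabNorm`). In a convolution, one of the two frequencies is at least comparable to the
output frequency and is the larger of the two (`blockNorm_conv_le`). The factor of lower frequency is
put in `L¹` at the cost `2^{lα}`, and the other one in `L¹` in time, where interpolation between the
two parts of the norm gains `h^{δ/2}` on an interval of length `h` (`lintegral_block_le`). The sum
over the larger frequency is a geometric series because `s + 1 > 0`. With the smoothing of the heat
flow this gives `exists_bilinear_le`.

**Existence.** The Picard iterates are dominated, pointwise in time and frequency, by those of a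
scalar equation with positive terms, in which every Fourier transform is replaced by its modulus and
the symbol of `ℙ div` by a multiple of `|ξ|`. The scalar iterates increase to a function `maj`; when
`T^{δ/2} ‖u₀‖` is small they stay in a ball of the working norm (`slabNorm_maj_le`), which leads to
`T^* = c ‖u₀‖^{-2/δ}`. Increments of the iterates are dominated by increments of the majorants
(`enorm_duhamel_sub_add_le`), so the iterates converge, and the equation holds, at every point where
`maj` is finite (`sol_eq`). By the bound for the flux, `maj t` is finite almost everywhere for
*every* `t`, so no exceptional set of times occurs. The same flux bound on short intervals gives
continuity at positive times for all `q`. At `t = 0` dominated convergence applies to the heat flow: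
in `ℓ^q` if `q < ∞`, and in the weighted `L¹` space, hence weakly, in general.

**Uniqueness.** The difference of two solutions on `(0, b)` satisfies a linear inequality. If it
vanishes up to time `a`, the bilinear estimate on `(a, a + h)`, with `h` depending only on the norms
of the solutions, shows that it vanishes up to time `a + h` (`ae_eq_of_duhamel`).
-/

noncomputable section

namespace FourierHerz


/-! ### Integral inequalities for functions with values in `[0, ∞]` -/

/-- **Minkowski's integral inequality**: the norm of an integral is at most the integral of the
norms. -/
theorem eLpNorm_lintegral_le {α β : Type*} [MeasurableSpace α] [MeasurableSpace β]
    {μ : Measure α} {ν : Measure β} [SigmaFinite μ] [SFinite ν] {p : ℝ≥0∞} (hp1 : 1 ≤ p)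
    (hp : p ≠ ∞) {f : α → β → ℝ≥0∞} (hf : Measurable (Function.uncurry f)) :
    eLpNorm (fun x => ∫⁻ y, f x y ∂ν) p μ ≤ ∫⁻ y, eLpNorm (fun x => f x y) p μ ∂ν := by
  have hp0 : p ≠ 0 := (zero_lt_one.trans_le hp1).ne'
  simp only [eLpNorm_eq_lintegral_rpow_enorm_toReal hp0 hp, enorm_eq_self]
  set P := p.toReal
  have hP1 : 1 ≤ P := (ENNReal.toReal_mono hp hp1 : _)
  rcases hP1.eq_or_lt with h | hP
  · simp only [← h, ENNReal.rpow_one, div_one]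
    exact (lintegral_lintegral_swap hf.aemeasurable).le
  have hP0 : 0 < P := by linarith
  set A := ∫⁻ y, (∫⁻ x, f x y ^ P ∂μ) ^ (1 / P) ∂ν with hA
  rw [one_div, ENNReal.rpow_inv_le_iff hP0]
  refine le_of_forall_lt fun L hL => ?_
  obtain ⟨g, hgF, hgt, hLg⟩ : ∃ g : SimpleFunc α ℝ≥0,
      (∀ x, (g x : ℝ≥0∞) ≤ (∫⁻ y, f x y ∂ν) ^ P) ∧ ∫⁻ x, g x ∂μ < ∞ ∧ L < ∫⁻ x, g x ∂μ := by
    rw [lintegral_eq_nnreal] at hL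
    simp_rw [lt_iSup_iff] at hL
    obtain ⟨g₀, hg₀, g₀L⟩ := hL
    have h'L : L < ∫⁻ x, g₀ x ∂μ := by
      rw [← SimpleFunc.lintegral_eq_lintegral, SimpleFunc.coe_map] at g₀L
      exact g₀L
    obtain ⟨g, hg, gL, gtop⟩ := SimpleFunc.exists_lt_lintegral_simpleFunc_of_lt_lintegral h'L
    exact ⟨g, fun x => (ENNReal.coe_le_coe.2 (hg x)).trans (hg₀ x), gL, gtop⟩
  refine hLg.trans_le ?_
  set S := ∫⁻ x, (g x : ℝ≥0∞) ∂μ with hS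
  set Q := P / (P - 1) with hQ
  have hPQ : Q.HolderConjugate P := by
    rw [hQ]; exact (Real.HolderConjugate.conjExponent hP).symm
  have hgm : Measurable fun x => (g x : ℝ≥0∞) := g.measurable.coe_nnreal_ennreal
  have h1 : 1 / Q + 1 / P = 1 := by
    have := hPQ.inv_add_inv_eq_one; simpa [one_div] using this
  have hQ0 : 0 < Q := hPQ.pos
  have key : S ≤ S ^ (1 / Q) * A := by
    calc S = ∫⁻ x, (g x : ℝ≥0∞) ^ (1 / Q) * (g x : ℝ≥0∞) ^ (1 / P) ∂μ := by
          refine lintegral_congr fun x => ?_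
          rw [← ENNReal.rpow_add_of_nonneg _ _ (by positivity) (by positivity), h1,
            ENNReal.rpow_one]
      _ ≤ ∫⁻ x, (g x : ℝ≥0∞) ^ (1 / Q) * ∫⁻ y, f x y ∂ν ∂μ := by
          gcongr with x
          rw [one_div, ENNReal.rpow_inv_le_iff hP0]
          exact hgF x
      _ = ∫⁻ x, ∫⁻ y, (g x : ℝ≥0∞) ^ (1 / Q) * f x y ∂ν ∂μ := by
          refine lintegral_congr fun x => ?_
          rw [lintegral_const_mul _ (hf.of_uncurry_left)]
      _ = ∫⁻ y, ∫⁻ x, (g x : ℝ≥0∞) ^ (1 / Q) * f x y ∂μ ∂ν := by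
          refine lintegral_lintegral_swap ?_
          refine Measurable.aemeasurable ?_
          exact ((hgm.comp measurable_fst).pow_const _).mul hf
      _ ≤ ∫⁻ y, S ^ (1 / Q) * (∫⁻ x, f x y ^ P ∂μ) ^ (1 / P) ∂ν := by
          refine lintegral_mono fun y => ?_
          refine (ENNReal.lintegral_mul_le_Lp_mul_Lq μ hPQ (hgm.pow_const _).aemeasurable
            hf.of_uncurry_right.aemeasurable).trans_eq ?_
          congr 3
          funext x
          rw [← ENNReal.rpow_mul, one_div_mul_cancel hQ0.ne', ENNReal.rpow_one]
      _ = S ^ (1 / Q) * A := by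
          rw [lintegral_const_mul]
          exact ((hf.comp measurable_swap).pow_const _).lintegral_prod_right'.pow_const _
  rcases eq_or_ne S 0 with h0 | h0
  · simp [h0]
  have hSt : S ≠ ∞ := hgt.ne
  rw [← ENNReal.rpow_inv_le_iff hP0]
  have h2 : S = S ^ (1 / Q) * S ^ P⁻¹ := by
    rw [← ENNReal.rpow_add _ _ h0 hSt, ← one_div, h1, ENNReal.rpow_one]
  replace key : S ^ (1 / Q) * S ^ P⁻¹ ≤ S ^ (1 / Q) * A := h2.symm.trans_le key
  refine (ENNReal.mul_le_mul_iff_right ?_ ?_).1 key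
  · exact (ENNReal.rpow_pos (pos_iff_ne_zero.2 h0) hSt).ne'
  · exact ENNReal.rpow_ne_top_of_nonneg (by positivity) hSt

/-- **Young's inequality** `L¹ * L^p ⊆ L^p`. -/
theorem eLpNorm_convolution_le {G : Type*} [MeasurableSpace G] [AddCommGroup G] [MeasurableAdd₂ G]
    [MeasurableNeg G] {μ : Measure G} [SigmaFinite μ] [μ.IsAddLeftInvariant] [μ.IsNegInvariant]
    {p : ℝ≥0∞} (hp1 : 1 ≤ p) (hp : p ≠ ∞) {f g : G → ℝ≥0∞} (hf : Measurable f)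
    (hg : Measurable g) :
    eLpNorm (fun x => ∫⁻ y, f (x - y) * g y ∂μ) p μ ≤ (∫⁻ y, f y ∂μ) * eLpNorm g p μ := by
  have h1 : (fun x => ∫⁻ y, f (x - y) * g y ∂μ) = fun x => ∫⁻ y, f y * g (x - y) ∂μ := by
    funext x
    rw [← lintegral_sub_left_eq_self _ x]
    simp
  rw [h1]
  refine (eLpNorm_lintegral_le hp1 hp ?_).trans ?_
  · exact (hf.comp measurable_snd).mul (hg.comp (measurable_fst.sub measurable_snd))
  rw [← lintegral_mul_const _ hf]
  refine lintegral_mono fun y => ?_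
  have hp0 : p ≠ 0 := (zero_lt_one.trans_le hp1).ne'
  simp only [eLpNorm_eq_lintegral_rpow_enorm_toReal hp0 hp, enorm_eq_self]
  have hP0 : 0 < p.toReal := ENNReal.toReal_pos hp0 hp
  simp_rw [ENNReal.mul_rpow_of_nonneg _ _ hP0.le]
  rw [lintegral_const_mul (f := fun x => g (x - y) ^ p.toReal) _
      ((hg.comp (measurable_id.sub_const y)).pow_const _),
    ENNReal.mul_rpow_of_nonneg _ _ (by positivity), ← ENNReal.rpow_mul,
    mul_one_div_cancel hP0.ne', ENNReal.rpow_one,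
    lintegral_sub_right_eq_self (fun x => g x ^ p.toReal) y]

theorem eLpNorm_mono_ennreal {α : Type*} [MeasurableSpace α] {μ : Measure α} {p : ℝ≥0∞}
    {f g : α → ℝ≥0∞} (h : ∀ᵐ x ∂μ, f x ≤ g x) : eLpNorm f p μ ≤ eLpNorm g p μ :=
  eLpNorm_mono_enorm_ae (by simpa using h)

theorem eLpNorm_const_mul_ennreal {α : Type*} [MeasurableSpace α] {μ : Measure α} {p : ℝ≥0∞}
    (c : ℝ≥0∞) (hc : c ≠ ∞) (f : α → ℝ≥0∞) :
    eLpNorm (fun x => c * f x) p μ = c * eLpNorm f p μ := by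
  rcases eq_or_ne p 0 with rfl | hp0
  · simp
  rcases eq_or_ne p ∞ with rfl | hp
  · simp [eLpNorm_exponent_top, eLpNormEssSup, ENNReal.essSup_const_mul]
  simp only [eLpNorm_eq_lintegral_rpow_enorm_toReal hp0 hp, enorm_eq_self]
  have hP0 : 0 < p.toReal := ENNReal.toReal_pos hp0 hp
  simp_rw [ENNReal.mul_rpow_of_nonneg _ _ hP0.le]
  rw [lintegral_const_mul' _ _ (ENNReal.rpow_ne_top_of_nonneg hP0.le hc),
    ENNReal.mul_rpow_of_nonneg _ _ (by positivity), ← ENNReal.rpow_mul,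
    mul_one_div_cancel hP0.ne', ENNReal.rpow_one]

/-- Monotone convergence in `L^p`, for all `p`. -/
theorem eLpNorm_iSup_le {α : Type*} [MeasurableSpace α] {μ : Measure α} {p : ℝ≥0∞}
    {f : ℕ → α → ℝ≥0∞} (hf : ∀ n, Measurable (f n)) (hm : Monotone f) :
    eLpNorm (fun x => ⨆ n, f n x) p μ ≤ ⨆ n, eLpNorm (f n) p μ := by
  rcases eq_or_ne p 0 with rfl | hp0
  · simp
  rcases eq_or_ne p ∞ with rfl | hp
  · simp only [eLpNorm_exponent_top, eLpNormEssSup, enorm_eq_self]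
    refine essSup_le_of_ae_le _ ?_
    have : ∀ᵐ x ∂μ, ∀ n, f n x ≤ essSup (f n) μ := ae_all_iff.2 fun n => ENNReal.ae_le_essSup _
    filter_upwards [this] with x hx
    exact iSup_mono hx
  simp only [eLpNorm_eq_lintegral_rpow_enorm_toReal hp0 hp, enorm_eq_self]
  have hP0 : 0 < p.toReal := ENNReal.toReal_pos hp0 hp
  have h1 : ∀ x, (⨆ n, f n x) ^ p.toReal = ⨆ n, f n x ^ p.toReal := fun x =>
    (ENNReal.orderIsoRpow _ hP0).map_iSup _
  simp_rw [h1]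
  rw [lintegral_iSup (fun n => (hf n).pow_const _)
    (fun m n h x => ENNReal.rpow_le_rpow (hm h x) hP0.le)]
  exact ((ENNReal.orderIsoRpow (1 / p.toReal) (by positivity)).map_iSup _).le

/-- Interpolation between `L¹` and `L^∞`, in a weak form with both end-point norms on the right. -/
theorem eLpNorm_le_max_one_top {α : Type*} [MeasurableSpace α] {μ : Measure α} {r : ℝ≥0∞}
    (hr : 1 ≤ r) {f : α → ℝ≥0∞} (hf : AEMeasurable f μ) (w : ℝ≥0∞) :
    w ^ (1 / r).toReal * eLpNorm f r μ ≤ eLpNorm f ∞ μ + w * eLpNorm f 1 μ := by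
  rcases eq_or_ne r ∞ with rfl | hr'
  · simp
  have hr0 : r ≠ 0 := (zero_lt_one.trans_le hr).ne'
  set R := r.toReal with hR
  have hR1 : 1 ≤ R := (ENNReal.toReal_mono hr' hr : _)
  have hR0 : 0 < R := by linarith
  have e1 : (1 / r).toReal = 1 / R := by rw [ENNReal.toReal_div]; simp [hR]
  set A := eLpNorm f ∞ μ
  set B := eLpNorm f 1 μ
  have h1 : eLpNorm f r μ ≤ (A ^ (R - 1) * B) ^ (1 / R) := by
    rw [eLpNorm_eq_lintegral_rpow_enorm_toReal hr0 hr']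
    gcongr
    change ∫⁻ x, f x ^ R ∂μ ≤ A ^ (R - 1) * eLpNorm f 1 μ
    rw [eLpNorm_one_eq_lintegral_enorm]
    rw [← lintegral_const_mul'' _ hf.enorm]
    refine lintegral_mono_ae ?_
    have : ∀ᵐ x ∂μ, f x ≤ A := by
      have := ENNReal.ae_le_essSup (μ := μ) f
      simpa [A, eLpNorm_exponent_top, eLpNormEssSup] using this
    filter_upwards [this] with x hx
    calc f x ^ R = f x ^ (R - 1) * f x ^ (1 : ℝ) := by
          rw [← ENNReal.rpow_add_of_nonneg _ _ (by linarith) zero_le_one]; simp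
      _ ≤ A ^ (R - 1) * f x := by
          rw [ENNReal.rpow_one]
          gcongr
  rw [e1]
  calc w ^ (1 / R) * eLpNorm f r μ ≤ w ^ (1 / R) * (A ^ (R - 1) * B) ^ (1 / R) := by gcongr
    _ = (A ^ (R - 1) * (w * B)) ^ (1 / R) := by
      rw [← ENNReal.mul_rpow_of_nonneg _ _ (by positivity)]; ring_nf
    _ ≤ ((A + w * B) ^ (R - 1) * (A + w * B) ^ (1 : ℝ)) ^ (1 / R) := by
      gcongr
      · exact le_self_add
      · simp
    _ = A + w * B := by
      rw [← ENNReal.rpow_add_of_nonneg _ _ (by linarith) zero_le_one, ← ENNReal.rpow_mul]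
      have : (R - 1 + 1) * (1 / R) = 1 := by field_simp; ring
      rw [this, ENNReal.rpow_one]


/-! ### The `ℓ^q(ℤ)` norm -/

theorem seqNorm_eq_eLpNorm {q : ℝ≥0∞} (hq : 1 ≤ q) (a : ℤ → ℝ≥0∞) :
    seqNorm q a = eLpNorm a q Measure.count := by
  have hq0 : q ≠ 0 := (zero_lt_one.trans_le hq).ne'
  unfold seqNorm
  split_ifs with h
  · subst h
    rw [eLpNorm_exponent_top, eLpNormEssSup]
    simp only [enorm_eq_self]
    refine le_antisymm (iSup_le fun j => ?_) (essSup_le_of_ae_le _ (ae_of_all _ fun j => le_iSup a j))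
    have h := ENNReal.ae_le_essSup (μ := (Measure.count : Measure ℤ)) a
    rw [Measure.ae_count_iff] at h
    exact h j
  · rw [eLpNorm_eq_lintegral_rpow_enorm_toReal hq0 h, lintegral_count]
    simp

theorem seqNorm_mono {q : ℝ≥0∞} (hq : 1 ≤ q) {a b : ℤ → ℝ≥0∞} (h : ∀ j, a j ≤ b j) :
    seqNorm q a ≤ seqNorm q b := by
  rw [seqNorm_eq_eLpNorm hq, seqNorm_eq_eLpNorm hq]
  exact eLpNorm_mono_ennreal (ae_of_all _ h)

theorem seqNorm_add_le {q : ℝ≥0∞} (hq : 1 ≤ q) (a b : ℤ → ℝ≥0∞) :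
    seqNorm q (fun j => a j + b j) ≤ seqNorm q a + seqNorm q b := by
  simp_rw [seqNorm_eq_eLpNorm hq]
  exact eLpNorm_add_le (Measurable.of_discrete.aestronglyMeasurable)
    (Measurable.of_discrete.aestronglyMeasurable) hq

theorem seqNorm_const_mul {q : ℝ≥0∞} (hq : 1 ≤ q) (c : ℝ≥0∞) (a : ℤ → ℝ≥0∞) :
    seqNorm q (fun j => c * a j) = c * seqNorm q a := by
  have hq0 : q ≠ 0 := (zero_lt_one.trans_le hq).ne'
  unfold seqNorm
  split_ifs with h
  · rw [ENNReal.mul_iSup]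
  · have hP0 : 0 < q.toReal := ENNReal.toReal_pos hq0 h
    simp_rw [ENNReal.mul_rpow_of_nonneg _ _ hP0.le]
    rw [ENNReal.tsum_mul_left, ENNReal.mul_rpow_of_nonneg _ _ (by positivity), ← ENNReal.rpow_mul,
      mul_one_div_cancel hP0.ne', ENNReal.rpow_one]

theorem le_seqNorm {q : ℝ≥0∞} (hq : 1 ≤ q) (a : ℤ → ℝ≥0∞) (j : ℤ) : a j ≤ seqNorm q a := by
  have hq0 : q ≠ 0 := (zero_lt_one.trans_le hq).ne'
  unfold seqNorm
  split_ifs with h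
  · exact le_iSup a j
  · have hP0 : 0 < q.toReal := ENNReal.toReal_pos hq0 h
    rw [one_div, ENNReal.le_rpow_inv_iff hP0]
    exact ENNReal.le_tsum j

theorem seqNorm_zero {q : ℝ≥0∞} (hq : 1 ≤ q) : seqNorm q (fun _ => 0) = 0 := by
  simpa using seqNorm_const_mul hq 0 (fun _ => 0)

theorem seqNorm_add_right {q : ℝ≥0∞} (a : ℤ → ℝ≥0∞) (k : ℤ) :
    seqNorm q (fun j => a (j + k)) = seqNorm q a := by
  unfold seqNorm
  split_ifs with h
  · exact (Equiv.addRight k).iSup_congr fun _ => rfl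
  · congr 1
    exact (Equiv.addRight k).tsum_eq (fun j => a j ^ q.toReal)

theorem seqNorm_tsum_le {q : ℝ≥0∞} (hq : 1 ≤ q) (f : ℕ → ℤ → ℝ≥0∞) :
    seqNorm q (fun j => ∑' m, f m j) ≤ ∑' m, seqNorm q (f m) := by
  rcases eq_or_ne q ∞ with rfl | h
  · simp only [seqNorm, if_true]
    exact iSup_le fun j => ENNReal.tsum_le_tsum fun m => le_iSup (f m) j
  · simp_rw [seqNorm_eq_eLpNorm hq, ← lintegral_count]
    exact eLpNorm_lintegral_le hq h Measurable.of_discrete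

theorem seqNorm_iSup_le {q : ℝ≥0∞} (hq : 1 ≤ q) {f : ℕ → ℤ → ℝ≥0∞} (hm : Monotone f) :
    seqNorm q (fun j => ⨆ n, f n j) ≤ ⨆ n, seqNorm q (f n) := by
  simp_rw [seqNorm_eq_eLpNorm hq]
  exact eLpNorm_iSup_le (fun _ => Measurable.of_discrete) hm

/-- Young's inequality `ℓ¹ * ℓ^q ⊆ ℓ^q` for a geometric kernel on a half line. -/
theorem seqNorm_geometric_le {q : ℝ≥0∞} (hq : 1 ≤ q) (r : ℝ≥0∞) (k : ℤ) (a : ℤ → ℝ≥0∞) :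
    seqNorm q (fun j => ∑' m : ℕ, r ^ m * a (j + (k + m))) ≤ (1 - r)⁻¹ * seqNorm q a := by
  refine (seqNorm_tsum_le hq _).trans_eq ?_
  rw [← ENNReal.tsum_geometric, ← ENNReal.tsum_mul_right]
  refine tsum_congr fun m => ?_
  rw [seqNorm_const_mul hq, seqNorm_add_right]

/-- Dominated convergence in `ℓ^q`, `q < ∞`. -/
theorem tendsto_seqNorm_of_dominated {q : ℝ≥0∞} (hq : 1 ≤ q) (hq' : q ≠ ∞) {ι : Type*}
    {l : Filter ι} [l.IsCountablyGenerated] {F : ι → ℤ → ℝ≥0∞} {a : ℤ → ℝ≥0∞}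
    (ha : seqNorm q a ≠ ∞) (hF : ∀ᶠ i in l, ∀ j, F i j ≤ a j)
    (hlim : ∀ j, Tendsto (fun i => F i j) l (𝓝 0)) :
    Tendsto (fun i => seqNorm q (F i)) l (𝓝 0) := by
  have hq0 : q ≠ 0 := (zero_lt_one.trans_le hq).ne'
  have hP0 : 0 < q.toReal := ENNReal.toReal_pos hq0 hq'
  simp only [seqNorm, if_neg hq'] at ha ⊢
  have ha' : ∑' j, a j ^ q.toReal ≠ ∞ := by
    intro h; rw [h] at ha; exact ha (ENNReal.top_rpow_of_pos (by positivity))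
  have h1 : Tendsto (fun i => ∑' j, F i j ^ q.toReal) l (𝓝 0) := by
    simp_rw [← lintegral_count] at ha' ⊢
    have h0 : ∫⁻ _ : ℤ, (0 : ℝ≥0∞) ∂Measure.count = 0 := by simp
    rw [← h0]
    refine tendsto_lintegral_filter_of_dominated_convergence (fun j => a j ^ q.toReal)
      (Eventually.of_forall fun _ => Measurable.of_discrete) ?_ ha' ?_
    · filter_upwards [hF] with i hi
      exact ae_of_all _ fun j => ENNReal.rpow_le_rpow (hi j) hP0.le
    · refine ae_of_all _ fun j => ?_
      have := (ENNReal.continuous_rpow_const (y := q.toReal)).tendsto 0 |>.comp (hlim j)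
      simpa [ENNReal.zero_rpow_of_pos hP0, Function.comp_def] using this
  have := (ENNReal.continuous_rpow_const (y := 1 / q.toReal)).tendsto 0 |>.comp h1
  simpa [ENNReal.zero_rpow_of_pos (inv_pos.2 hP0), Function.comp_def] using this


/-! ### Littlewood-Paley blocks of non-negative functions -/

/-- The symbol `φ (2⁻ʲ ξ)` of the dyadic block `Δ_j`, with values in `[0, ∞]`. -/
def lp (φ : E3 → ℝ) (j : ℤ) (ξ : E3) : ℝ≥0∞ := ENNReal.ofReal (φ ((2 : ℝ) ^ (-j) • ξ))

/-- The `L^p` norm of the `j`-th dyadic block of a non-negative function `f` of the frequency. -/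
def blockNorm (φ : E3 → ℝ) (p : ℝ≥0∞) (j : ℤ) (f : E3 → ℝ≥0∞) : ℝ≥0∞ :=
  eLpNorm (fun ξ => lp φ j ξ * f ξ) p volume

/-- The convolution of non-negative functions. -/
def conv (f g : E3 → ℝ≥0∞) (ξ : E3) : ℝ≥0∞ := ∫⁻ η, f (ξ - η) * g η

variable {φ : E3 → ℝ}

theorem IsLittlewoodPaley.measurable_lp (hφ : IsLittlewoodPaley φ) (j : ℤ) :
    Measurable (lp φ j) := by
  have := hφ.contDiff.continuous.measurable
  exact (this.comp (measurable_const_smul _)).ennreal_ofReal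

theorem IsLittlewoodPaley.lp_le_one (hφ : IsLittlewoodPaley φ) (j : ℤ) (ξ : E3) :
    lp φ j ξ ≤ 1 := by
  simpa [lp] using hφ.le_one _

theorem IsLittlewoodPaley.norm_bounds (hφ : IsLittlewoodPaley φ) {j : ℤ} {ξ : E3}
    (h : φ ((2 : ℝ) ^ (-j) • ξ) ≠ 0) :
    3 / 4 * (2 : ℝ) ^ j ≤ ‖ξ‖ ∧ ‖ξ‖ ≤ 8 / 3 * (2 : ℝ) ^ j := by
  have h1 := hφ.tsupport_subset (subset_tsupport φ h)
  have h2 : (0 : ℝ) < 2 ^ j := by positivity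
  simp only [Set.mem_ofPred_eq, norm_smul, zpow_neg, norm_inv, norm_zpow, Real.norm_ofNat] at h1
  rw [inv_mul_eq_div, le_div_iff₀ h2, div_le_iff₀ h2] at h1
  exact h1

theorem IsLittlewoodPaley.norm_bounds_of_lp (hφ : IsLittlewoodPaley φ) {j : ℤ} {ξ : E3}
    (h : lp φ j ξ ≠ 0) :
    3 / 4 * (2 : ℝ) ^ j ≤ ‖ξ‖ ∧ ‖ξ‖ ≤ 8 / 3 * (2 : ℝ) ^ j := by
  refine hφ.norm_bounds fun h0 => h ?_
  rw [lp, h0, ENNReal.ofReal_zero]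

theorem IsLittlewoodPaley.tsum_lp (hφ : IsLittlewoodPaley φ) {ξ : E3} (hξ : ξ ≠ 0) :
    ∑' j, lp φ j ξ = 1 := by
  have h := hφ.partition ξ hξ
  simp only [lp]
  rw [← ENNReal.ofReal_tsum_of_nonneg (fun _ => hφ.nonneg _) h.summable, h.tsum_eq]
  simp

/-- A function is the sum of those of its dyadic blocks that do not vanish at the point. -/
theorem IsLittlewoodPaley.eq_tsum (hφ : IsLittlewoodPaley φ) {ξ : E3} (hξ : ξ ≠ 0)
    {e : ℕ → ℤ} (he : Function.Injective e) (h : ∀ j, lp φ j ξ ≠ 0 → j ∈ Set.range e) (x : ℝ≥0∞) :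
    x = ∑' m, lp φ (e m) ξ * x := by
  rw [ENNReal.tsum_mul_right, he.tsum_eq (f := fun j => lp φ j ξ), hφ.tsum_lp hξ, one_mul]
  exact fun j hj => h j hj

theorem two_rpow_ne_zero (x : ℝ) : (2 : ℝ≥0∞) ^ x ≠ 0 :=
  (ENNReal.rpow_pos (by norm_num) (by norm_num)).ne'

theorem two_rpow_ne_top (x : ℝ) : (2 : ℝ≥0∞) ^ x ≠ ∞ := by
  rw [Ne, ENNReal.rpow_eq_top_iff]; norm_num

theorem two_rpow_add (x y : ℝ) : (2 : ℝ≥0∞) ^ (x + y) = 2 ^ x * 2 ^ y :=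
  ENNReal.rpow_add _ _ (by norm_num) (by norm_num)

theorem two_rpow_neg_lt_one {x : ℝ} (hx : 0 < x) : (2 : ℝ≥0∞) ^ (-x) < 1 :=
  ENNReal.rpow_lt_one_of_one_lt_of_neg (by norm_num) (by linarith)

theorem two_rpow_neg_mul (x : ℝ) (m : ℕ) : (2 : ℝ≥0∞) ^ (-(m * x)) = (2 ^ (-x)) ^ m := by
  rw [← ENNReal.rpow_natCast, ← ENNReal.rpow_mul]; ring_nf

theorem geometric_ne_top {x : ℝ} (hx : 0 < x) : (1 - (2 : ℝ≥0∞) ^ (-x))⁻¹ ≠ ∞ := by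
  rw [Ne, ENNReal.inv_eq_top, tsub_eq_zero_iff_le, not_le]
  exact two_rpow_neg_lt_one hx

theorem ofReal_two_zpow (j : ℤ) : ENNReal.ofReal ((2 : ℝ) ^ j) = 2 ^ (j : ℝ) := by
  rw [← Real.rpow_intCast, ← ENNReal.ofReal_rpow_of_pos (by norm_num)]
  norm_num

section

variable {p : ℝ≥0∞}

theorem blockNorm_mono {j : ℤ} {f g : E3 → ℝ≥0∞} (h : ∀ᵐ ξ, f ξ ≤ g ξ) :
    blockNorm φ p j f ≤ blockNorm φ p j g := by
  refine eLpNorm_mono_ennreal ?_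
  filter_upwards [h] with ξ hξ
  gcongr

theorem blockNorm_add_le (hφ : IsLittlewoodPaley φ) (hp1 : 1 ≤ p) (j : ℤ) {f g : E3 → ℝ≥0∞}
    (hf : Measurable f) (hg : Measurable g) :
    blockNorm φ p j (fun ξ => f ξ + g ξ) ≤ blockNorm φ p j f + blockNorm φ p j g := by
  simp only [blockNorm, mul_add]
  exact eLpNorm_add_le ((hφ.measurable_lp j).mul hf).aestronglyMeasurable
    ((hφ.measurable_lp j).mul hg).aestronglyMeasurable hp1

theorem blockNorm_const_mul {j : ℤ} (c : ℝ≥0∞) (hc : c ≠ ∞) (f : E3 → ℝ≥0∞) :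
    blockNorm φ p j (fun ξ => c * f ξ) = c * blockNorm φ p j f := by
  simp only [blockNorm]
  rw [← eLpNorm_const_mul_ennreal c hc]
  congr 1; funext ξ; ring

/-- A multiplier bounded by `c` on the annulus `3/4 · 2ʲ ≤ |ξ| ≤ 8/3 · 2ʲ` acts on the `j`-th block
with norm at most `c`. -/
theorem blockNorm_mul_le (hφ : IsLittlewoodPaley φ) {j : ℤ} {m f : E3 → ℝ≥0∞} {c : ℝ≥0∞}
    (hc : c ≠ ∞)
    (h : ∀ ξ, 3 / 4 * (2 : ℝ) ^ j ≤ ‖ξ‖ → ‖ξ‖ ≤ 8 / 3 * (2 : ℝ) ^ j → m ξ ≤ c) :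
    blockNorm φ p j (fun ξ => m ξ * f ξ) ≤ c * blockNorm φ p j f := by
  rw [← blockNorm_const_mul c hc]
  refine eLpNorm_mono_ennreal (ae_of_all _ fun ξ => ?_)
  rcases eq_or_ne (lp φ j ξ) 0 with h0 | h0
  · simp [h0]
  · have := hφ.norm_bounds_of_lp h0
    have := h ξ this.1 this.2
    dsimp only
    gcongr

theorem blockNorm_lintegral_le (hφ : IsLittlewoodPaley φ) (hp1 : 1 ≤ p) (hp : p ≠ ∞) (j : ℤ)
    {β : Type*} [MeasurableSpace β] {ν : Measure β} [SFinite ν] {f : E3 → β → ℝ≥0∞}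
    (hf : Measurable (Function.uncurry f)) :
    blockNorm φ p j (fun ξ => ∫⁻ y, f ξ y ∂ν) ≤ ∫⁻ y, blockNorm φ p j (fun ξ => f ξ y) ∂ν := by
  simp only [blockNorm]
  refine le_trans (le_of_eq ?_) (eLpNorm_lintegral_le hp1 hp (f := fun ξ y => lp φ j ξ * f ξ y) ?_)
  · congr 1; funext ξ
    rw [lintegral_const_mul _ hf.of_uncurry_left]
  · exact ((hφ.measurable_lp j).comp measurable_fst).mul hf

theorem blockNorm_iSup_le (hφ : IsLittlewoodPaley φ) {j : ℤ} {f : ℕ → E3 → ℝ≥0∞}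
    (hf : ∀ n, Measurable (f n)) (hm : Monotone f) :
    blockNorm φ p j (fun ξ => ⨆ n, f n ξ) ≤ ⨆ n, blockNorm φ p j (f n) := by
  simp only [blockNorm, ENNReal.mul_iSup]
  exact eLpNorm_iSup_le (fun n => (hφ.measurable_lp j).mul (hf n))
    fun m n h ξ => mul_le_mul_right (hm h ξ) _

theorem measurable_blockNorm (hφ : IsLittlewoodPaley φ) (hp1 : 1 ≤ p) (hp : p ≠ ∞) (j : ℤ)
    {β : Type*} [MeasurableSpace β] {f : β → E3 → ℝ≥0∞} (hf : Measurable (Function.uncurry f)) :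
    Measurable fun t => blockNorm φ p j (f t) := by
  have hp0 : p ≠ 0 := (zero_lt_one.trans_le hp1).ne'
  simp only [blockNorm, eLpNorm_eq_lintegral_rpow_enorm_toReal hp0 hp, enorm_eq_self]
  refine Measurable.pow_const ?_ _
  exact ((((hφ.measurable_lp j).comp measurable_snd).mul hf).pow_const _).lintegral_prod_right'

theorem measurable_conv {β : Type*} [MeasurableSpace β] {f g : β → E3 → ℝ≥0∞}
    (hf : Measurable (Function.uncurry f)) (hg : Measurable (Function.uncurry g)) :
    Measurable fun z : β × E3 => conv (f z.1) (g z.1) z.2 := by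
  refine Measurable.lintegral_prod_right' (f := fun w : (β × E3) × E3 =>
    f w.1.1 (w.1.2 - w.2) * g w.1.1 w.2) ?_
  refine Measurable.mul ?_ ?_
  · exact hf.comp ((measurable_fst.comp measurable_fst).prodMk
      ((measurable_snd.comp measurable_fst).sub measurable_snd))
  · exact hg.comp ((measurable_fst.comp measurable_fst).prodMk measurable_snd)

/-- **Bernstein's inequality** for the blocks: `‖Δ_k f‖_{FL¹} ≲ 2^{3k(1-1/p)} ‖Δ_k f‖_{FL^p}`. -/
theorem exists_bernstein (hφ : IsLittlewoodPaley φ) (hp1 : 1 ≤ p) :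
    ∃ C : ℝ≥0∞, C ≠ ∞ ∧ ∀ (k : ℤ) (f : E3 → ℝ≥0∞), Measurable f →
      ∫⁻ ξ, lp φ k ξ * f ξ ≤ C * 2 ^ ((k : ℝ) * (3 * (1 - 1 / p.toReal))) * blockNorm φ p k f := by
  set e : ℝ := 1 - 1 / p.toReal with he
  have he0 : 0 ≤ e := by
    rcases eq_or_ne p ∞ with rfl | hp
    · simp [he]
    · have : 1 ≤ p.toReal := (ENNReal.toReal_mono hp hp1 : _)
      rw [he, sub_nonneg, div_le_one (by linarith)]; exact this
  set C : ℝ≥0∞ := (ENNReal.ofReal ((8 / 3 : ℝ) ^ 3) * volume (Metric.ball (0 : E3) 1)) ^ e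
  refine ⟨C, ENNReal.rpow_ne_top_of_nonneg he0
    (ENNReal.mul_ne_top ENNReal.ofReal_ne_top measure_ball_lt_top.ne), fun k f hf => ?_⟩
  set B := Metric.closedBall (0 : E3) (8 / 3 * (2 : ℝ) ^ k)
  have h1 : ∀ ξ, lp φ k ξ * f ξ ≠ 0 → ξ ∈ B := fun ξ h => by
    have := hφ.norm_bounds_of_lp (left_ne_zero_of_mul h)
    simpa [B] using this.2
  have h2 : volume B ^ e = C * 2 ^ ((k : ℝ) * (3 * e)) := by
    rw [Measure.addHaar_closedBall _ _ (by positivity)]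
    simp only [C, finrank_euclideanSpace, Fintype.card_fin]
    rw [mul_pow, ENNReal.ofReal_mul (by positivity), mul_right_comm,
      ENNReal.mul_rpow_of_nonneg _ _ he0]
    congr 1
    rw [ENNReal.ofReal_pow (by positivity), ofReal_two_zpow, ← ENNReal.rpow_natCast,
      ← ENNReal.rpow_mul, ← ENNReal.rpow_mul]
    push_cast; ring_nf
  calc ∫⁻ ξ, lp φ k ξ * f ξ = ∫⁻ ξ in B, lp φ k ξ * f ξ := by
        refine (setLIntegral_eq_of_support_subset ?_).symm
        exact fun ξ h => h1 ξ h
    _ = eLpNorm (fun ξ => lp φ k ξ * f ξ) 1 (volume.restrict B) := by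
        simp [eLpNorm_one_eq_lintegral_enorm]
    _ ≤ eLpNorm (fun ξ => lp φ k ξ * f ξ) p (volume.restrict B) * volume B ^ e := by
        refine (eLpNorm_le_eLpNorm_mul_rpow_measure_univ hp1
          ((hφ.measurable_lp k).mul hf).aestronglyMeasurable).trans_eq ?_
        simp [he, Pi.mul_def]
    _ ≤ blockNorm φ p k f * volume B ^ e := by
        gcongr
        exact eLpNorm_mono_measure _ Measure.restrict_le_self
    _ = _ := by rw [h2, mul_comm]

end


/-! ### Low frequencies and the product estimate -/

/-- The mass of `f` in the ball that carries the blocks of index at most `l`. -/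
def lowMass (l : ℤ) (f : E3 → ℝ≥0∞) : ℝ≥0∞ :=
  ∫⁻ ξ in Metric.closedBall (0 : E3) (8 / 3 * (2 : ℝ) ^ l), f ξ

section

variable {p : ℝ≥0∞} {s : ℝ}

theorem ae_ne_zero_E3 : ∀ᵐ ξ : E3, ξ ≠ 0 := by
  simp [ae_iff]

/-- Bernstein's inequality for one block, in terms of a bound for the weighted block norm. -/
theorem block_L1_le {φ : E3 → ℝ} {C : ℝ≥0∞} {k : ℤ} {f : E3 → ℝ≥0∞} {D : ℝ}
    (hC : ∫⁻ ξ, lp φ k ξ * f ξ ≤ C * 2 ^ ((k : ℝ) * D) * blockNorm φ p k f)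
    {M : ℝ≥0∞} (hM : 2 ^ ((k : ℝ) * s) * blockNorm φ p k f ≤ M) :
    ∫⁻ ξ, lp φ k ξ * f ξ ≤ C * 2 ^ ((k : ℝ) * (D - s)) * M := by
  refine hC.trans ?_
  have h3 : ((2 : ℝ≥0∞)) ^ ((k : ℝ) * D) = 2 ^ ((k : ℝ) * (D - s)) * 2 ^ ((k : ℝ) * s) := by
    rw [← two_rpow_add]; ring_nf
  rw [h3]
  calc C * (2 ^ ((k : ℝ) * (D - s)) * 2 ^ ((k : ℝ) * s)) * blockNorm φ p k f
      = C * 2 ^ ((k : ℝ) * (D - s)) * (2 ^ ((k : ℝ) * s) * blockNorm φ p k f) := by ring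
    _ ≤ _ := by gcongr

/-- The low-frequency part of an element of `FḂ^s_{p,∞}` with `s < 3 (1 - 1/p)` has an integrable
Fourier transform. -/
theorem exists_lowMass_le (hφ : IsLittlewoodPaley φ) (hp1 : 1 ≤ p)
    (hα : 0 < 3 * (1 - 1 / p.toReal) - s) :
    ∃ C : ℝ≥0∞, C ≠ ∞ ∧ ∀ (l : ℤ) (f : E3 → ℝ≥0∞) (M : ℝ≥0∞), Measurable f →
      (∀ k : ℤ, 2 ^ ((k : ℝ) * s) * blockNorm φ p k f ≤ M) →
      lowMass l f ≤ C * 2 ^ ((l : ℝ) * (3 * (1 - 1 / p.toReal) - s)) * M := by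
  obtain ⟨C, hC, hB⟩ := exists_bernstein hφ hp1
  set D := 3 * (1 - 1 / p.toReal)
  set α := D - s with hαd
  refine ⟨C * 2 ^ α * (1 - (2 : ℝ≥0∞) ^ (-α))⁻¹, ENNReal.mul_ne_top
    (ENNReal.mul_ne_top hC (two_rpow_ne_top _)) (geometric_ne_top hα), fun l f M hf hM => ?_⟩
  -- Only the blocks of index `l + 1 - m` with `m ≥ 0` meet the ball of radius `8/3 · 2ˡ`.
  have he : Function.Injective fun m : ℕ => l + 1 - (m : ℤ) := fun m n h => by
    simpa using h
  calc lowMass l f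
      ≤ ∫⁻ ξ in Metric.closedBall (0 : E3) (8 / 3 * (2 : ℝ) ^ l),
          ∑' m : ℕ, lp φ (l + 1 - m) ξ * f ξ := by
        refine setLIntegral_mono_ae' measurableSet_closedBall ?_
        filter_upwards [ae_ne_zero_E3] with ξ hξ hball
        refine (hφ.eq_tsum hξ he (fun j hj => ?_) (f ξ)).le
        have h1 := (hφ.norm_bounds_of_lp hj).1
        have h2 : ‖ξ‖ ≤ 8 / 3 * (2 : ℝ) ^ l := by simpa using hball
        have h3 : (2 : ℝ) ^ j < 2 ^ (l + 2) := by
          rw [zpow_add₀ (by norm_num)]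
          have : (0 : ℝ) < 2 ^ l := by positivity
          norm_num; linarith
        have h4 : j < l + 2 := (zpow_lt_zpow_iff_right₀ (by norm_num)).1 h3
        exact ⟨(l + 1 - j).toNat, by dsimp only; omega⟩
    _ ≤ ∫⁻ ξ, ∑' m : ℕ, lp φ (l + 1 - m) ξ * f ξ := lintegral_mono' Measure.restrict_le_self le_rfl
    _ = ∑' m : ℕ, ∫⁻ ξ, lp φ (l + 1 - m) ξ * f ξ :=
        lintegral_tsum fun m => ((hφ.measurable_lp _).mul hf).aemeasurable
    _ ≤ ∑' m : ℕ, C * 2 ^ ((l : ℝ) * α) * 2 ^ α * M * ((2 : ℝ≥0∞) ^ (-α)) ^ m := by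
        refine ENNReal.tsum_le_tsum fun m => ?_
        refine (block_L1_le (hB _ f hf) (hM _)).trans_eq ?_
        have h3 : (2 : ℝ≥0∞) ^ (((l + 1 - m : ℤ) : ℝ) * α) =
            2 ^ ((l : ℝ) * α) * 2 ^ α * (2 ^ (-α)) ^ m := by
          rw [← two_rpow_neg_mul, ← two_rpow_add, ← two_rpow_add]
          push_cast; ring_nf
        rw [h3]; ring
    _ = _ := by rw [ENNReal.tsum_mul_left, ENNReal.tsum_geometric]; ring

/-- The embedding of `FḂ^s_{p,∞}` in a weighted `FL¹` space. -/
theorem exists_weighted_le (hφ : IsLittlewoodPaley φ) (hp1 : 1 ≤ p)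
    (hα : 0 < 3 * (1 - 1 / p.toReal) - s) (hα1 : 3 * (1 - 1 / p.toReal) - s < 1) :
    ∃ C : ℝ≥0∞, C ≠ ∞ ∧ ∀ (f : E3 → ℝ≥0∞) (M : ℝ≥0∞), Measurable f →
      (∀ k : ℤ, 2 ^ ((k : ℝ) * s) * blockNorm φ p k f ≤ M) →
      ∫⁻ ξ, ENNReal.ofReal (1 + ‖ξ‖)⁻¹ * f ξ ≤ C * M := by
  obtain ⟨C, hC, hB⟩ := exists_bernstein hφ hp1
  obtain ⟨C', hC', hL⟩ := exists_lowMass_le (s := s) hφ hp1 hα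
  set D := 3 * (1 - 1 / p.toReal)
  set α := D - s with hαd
  refine ⟨C' + 2 * C * (1 - (2 : ℝ≥0∞) ^ (-(1 - α)))⁻¹, ENNReal.add_ne_top.2 ⟨hC',
    ENNReal.mul_ne_top (ENNReal.mul_ne_top (by norm_num) hC) (geometric_ne_top (by linarith))⟩,
    fun f M hf hM => ?_⟩
  set B := Metric.closedBall (0 : E3) (8 / 3 * (2 : ℝ) ^ (0 : ℤ)) with hBdef
  have he : Function.Injective fun m : ℕ => (m : ℤ) := Nat.cast_injective
  have hdec : ∀ᵐ ξ : E3, ENNReal.ofReal (1 + ‖ξ‖)⁻¹ * f ξ ≤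
      B.indicator f ξ + ∑' m : ℕ, 2 * 2 ^ (-(m : ℝ)) * (lp φ m ξ * f ξ) := by
    filter_upwards [ae_ne_zero_E3] with ξ hξ
    by_cases hξB : ξ ∈ B
    · refine le_add_right ?_
      rw [Set.indicator_of_mem hξB]
      refine mul_le_of_le_one_left zero_le ?_
      rw [ENNReal.ofReal_le_one]
      exact inv_le_one_of_one_le₀ (by linarith [norm_nonneg ξ])
    · refine le_add_left ?_
      have hlarge : 8 / 3 < ‖ξ‖ := by simpa [hBdef] using hξB
      have hran : ∀ j, lp φ j ξ ≠ 0 → j ∈ Set.range fun m : ℕ => (m : ℤ) := fun j hj => by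
        have h1 := (hφ.norm_bounds_of_lp hj).2
        have h3 : (2 : ℝ) ^ (0 : ℤ) < 2 ^ j := by rw [zpow_zero]; linarith
        have h4 : 0 < j := (zpow_lt_zpow_iff_right₀ (by norm_num)).1 h3
        exact ⟨j.toNat, by dsimp only; omega⟩
      refine (mul_le_mul_right (hφ.eq_tsum hξ he hran (f ξ)).le _).trans ?_
      rw [← ENNReal.tsum_mul_left]
      refine ENNReal.tsum_le_tsum fun m => ?_
      rcases eq_or_ne (lp φ m ξ) 0 with h0 | h0
      · simp [h0]
      · refine mul_le_mul_left ?_ _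
        have h1 := (hφ.norm_bounds_of_lp h0).1
        have h5 : (2 : ℝ≥0∞) * 2 ^ (-(m : ℝ)) = ENNReal.ofReal (2 * 2 ^ (-(m : ℤ))) := by
          rw [ENNReal.ofReal_mul (by norm_num), ofReal_two_zpow]; norm_num
        rw [h5]
        refine ENNReal.ofReal_le_ofReal ?_
        rw [zpow_neg, ← div_eq_mul_inv, le_div_iff₀ (by positivity), inv_mul_eq_div,
          div_le_iff₀ (by positivity)]
        linarith
  have hmeas : ∀ m : ℕ, Measurable fun ξ => lp φ m ξ * f ξ := fun m => (hφ.measurable_lp _).mul hf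
  calc ∫⁻ ξ, ENNReal.ofReal (1 + ‖ξ‖)⁻¹ * f ξ
      ≤ ∫⁻ ξ, (B.indicator f ξ + ∑' m : ℕ, 2 * 2 ^ (-(m : ℝ)) * (lp φ m ξ * f ξ)) :=
        lintegral_mono_ae hdec
    _ = lowMass 0 f + ∑' m : ℕ, 2 * 2 ^ (-(m : ℝ)) * ∫⁻ ξ, lp φ m ξ * f ξ := by
        rw [lintegral_add_left (hf.indicator measurableSet_closedBall),
          lintegral_indicator measurableSet_closedBall,
          lintegral_tsum fun m => ((hmeas m).const_mul _).aemeasurable]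
        simp_rw [lintegral_const_mul _ (hmeas _)]
        rfl
    _ ≤ C' * M + ∑' m : ℕ, 2 * C * M * ((2 : ℝ≥0∞) ^ (-(1 - α))) ^ m := by
        refine add_le_add ?_ (ENNReal.tsum_le_tsum fun m => ?_)
        · simpa using hL 0 f M hf hM
        · refine (mul_le_mul_right (block_L1_le (hB _ f hf) (hM _)) _).trans_eq ?_
          rw [← two_rpow_neg_mul]
          have h3 : (2 : ℝ≥0∞) ^ (-((m : ℝ) * (1 - α))) = 2 ^ (-(m : ℝ)) * 2 ^ ((m : ℝ) * α) := by
            rw [← two_rpow_add]; ring_nf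
          rw [h3]; push_cast; ring
    _ = _ := by rw [ENNReal.tsum_mul_left, ENNReal.tsum_geometric]; ring

theorem conv_comm (f g : E3 → ℝ≥0∞) (ξ : E3) : conv f g ξ = conv g f ξ := by
  rw [conv, ← lintegral_sub_left_eq_self _ ξ]
  simp [conv, mul_comm]

theorem measurable_conv_const {f g : E3 → ℝ≥0∞} (hf : Measurable f) (hg : Measurable g) :
    Measurable (conv f g) :=
  Measurable.lintegral_prod_right' (f := fun w : E3 × E3 => f (w.1 - w.2) * g w.2)
    ((hf.comp (measurable_fst.sub measurable_snd)).mul (hg.comp measurable_snd))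

/-- Young's inequality for the interaction of low frequencies of `f` with the `l`-th block of `g`. -/
theorem eLpNorm_low_conv_block_le (hφ : IsLittlewoodPaley φ) (hp1 : 1 ≤ p) (hp : p ≠ ∞)
    {f g : E3 → ℝ≥0∞} (hf : Measurable f) (hg : Measurable g) (l : ℤ) :
    eLpNorm (conv ((Metric.closedBall (0 : E3) (8 / 3 * (2 : ℝ) ^ l)).indicator f)
      fun η => lp φ l η * g η) p volume ≤ lowMass l f * blockNorm φ p l g := by
  refine (eLpNorm_convolution_le hp1 hp (hf.indicator measurableSet_closedBall)
    ((hφ.measurable_lp l).mul hg)).trans_eq ?_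
  rw [lintegral_indicator measurableSet_closedBall]
  rfl

/-- In a convolution the larger of the two interacting frequencies is at least comparable to the
frequency of the output: `Δ_j` of a product only sees blocks of index `≥ j - 2` of one factor,
against lower frequencies of the other one. -/
theorem blockNorm_conv_le (hφ : IsLittlewoodPaley φ) (hp1 : 1 ≤ p) (hp : p ≠ ∞)
    {f g : E3 → ℝ≥0∞} (hf : Measurable f) (hg : Measurable g) (j : ℤ) :
    blockNorm φ p j (conv f g) ≤
      ∑' m : ℕ, (lowMass (j + (-2 + m)) f * blockNorm φ p (j + (-2 + m)) g +
        lowMass (j + (-2 + m)) g * blockNorm φ p (j + (-2 + m)) f) := by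
  set B : ℤ → Set E3 := fun l => Metric.closedBall (0 : E3) (8 / 3 * (2 : ℝ) ^ l)
  have he : Function.Injective fun m : ℕ => j + (-2 + (m : ℤ)) := fun m n h => by simpa using h
  set P : (E3 → ℝ≥0∞) → (E3 → ℝ≥0∞) → ℕ → E3 → ℝ≥0∞ := fun f g m =>
    conv ((B (j + (-2 + m))).indicator f) fun η => lp φ (j + (-2 + m)) η * g η with hP
  have hPm : ∀ {f g : E3 → ℝ≥0∞}, Measurable f → Measurable g → ∀ m, Measurable (P f g m) :=
    fun hf hg m => measurable_conv_const (hf.indicator measurableSet_closedBall)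
      ((hφ.measurable_lp _).mul hg)
  -- Where `|ξ - η| ≤ |η|`, the triangle inequality gives `|ξ| ≤ 2 |η|`, so `η` lies in blocks of index
  -- at least `j - 2`; the complementary region is this one with the factors exchanged.
  have hhalf : ∀ {f g : E3 → ℝ≥0∞}, Measurable f → Measurable g → ∀ ξ, lp φ j ξ ≠ 0 →
      ∫⁻ η in {η | ‖ξ - η‖ ≤ ‖η‖}, f (ξ - η) * g η ≤ ∑' m, P f g m ξ := by
    intro f g hf hg ξ hξ
    simp only [hP, conv]
    rw [← lintegral_tsum (f := fun (m : ℕ) η => (B (j + (-2 + m))).indicator f (ξ - η) *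
      (lp φ (j + (-2 + m)) η * g η)) fun m => Measurable.aemeasurable
      (((hf.indicator measurableSet_closedBall).comp (measurable_id.const_sub ξ)).mul
        ((hφ.measurable_lp _).mul hg))]
    refine le_trans (setLIntegral_mono_ae' (measurableSet_le (by fun_prop) (by fun_prop)) ?_)
      (lintegral_mono' Measure.restrict_le_self le_rfl)
    filter_upwards [ae_ne_zero_E3] with η hη hle
    change ‖ξ - η‖ ≤ ‖η‖ at hle
    have h1 := (hφ.norm_bounds_of_lp hξ).1
    have h2 : ‖ξ‖ ≤ ‖ξ - η‖ + ‖η‖ := by simpa using norm_add_le (ξ - η) η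
    have hran : ∀ l, lp φ l η ≠ 0 → l ∈ Set.range fun m : ℕ => j + (-2 + (m : ℤ)) := fun l hl => by
      have h4 := (hφ.norm_bounds_of_lp hl).2
      have h5 : (2 : ℝ) ^ j < 2 ^ (l + 3) := by
        rw [zpow_add₀ (by norm_num)]
        have : (0 : ℝ) < 2 ^ l := by positivity
        norm_num; linarith
      have h6 : j < l + 3 := (zpow_lt_zpow_iff_right₀ (by norm_num)).1 h5
      exact ⟨(l - j + 2).toNat, by dsimp only; omega⟩
    refine (mul_le_mul_right (hφ.eq_tsum hη he hran (g η)).le _).trans ?_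
    rw [← ENNReal.tsum_mul_left]
    refine ENNReal.tsum_le_tsum fun m => ?_
    rcases eq_or_ne (lp φ (j + (-2 + m)) η) 0 with h0 | h0
    · simp [h0]
    · have h3 := (hφ.norm_bounds_of_lp h0).2
      rw [Set.indicator_of_mem (by simpa [B] using hle.trans h3)]
  have hpt : ∀ ξ, lp φ j ξ * conv f g ξ ≤ ∑' m, (P f g m ξ + P g f m ξ) := by
    intro ξ
    rcases eq_or_ne (lp φ j ξ) 0 with h0 | h0
    · simp [h0]
    refine (mul_le_of_le_one_left zero_le (hφ.lp_le_one j ξ)).trans ?_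
    rw [ENNReal.tsum_add]
    have hS : MeasurableSet {η : E3 | ‖ξ - η‖ ≤ ‖η‖} :=
      measurableSet_le (by fun_prop) (by fun_prop)
    rw [conv, ← lintegral_add_compl _ hS]
    refine add_le_add (hhalf hf hg ξ h0) (le_trans ?_ (hhalf hg hf ξ h0))
    rw [← lintegral_indicator hS.compl, ← lintegral_sub_left_eq_self _ ξ,
      ← lintegral_indicator hS]
    refine lintegral_mono fun η => ?_
    simp only [Set.indicator_apply, Set.mem_compl_iff, Set.mem_ofPred_eq, sub_sub_cancel, not_le]
    split_ifs with h1 h2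
    · rw [mul_comm]
    · exact absurd h1.le h2
    · exact zero_le
    · exact le_rfl
  calc blockNorm φ p j (conv f g)
      ≤ eLpNorm (fun ξ => ∑' m, (P f g m ξ + P g f m ξ)) p volume :=
        eLpNorm_mono_ennreal (ae_of_all _ hpt)
    _ ≤ ∑' m, eLpNorm (fun ξ => P f g m ξ + P g f m ξ) p volume := by
        simp_rw [← lintegral_count]
        refine eLpNorm_lintegral_le hp1 hp (f := fun ξ m => P f g m ξ + P g f m ξ) ?_
        exact measurable_from_prod_countable_left fun m => (hPm hf hg m).add (hPm hg hf m)
    _ ≤ _ := by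
        refine ENNReal.tsum_le_tsum fun m => ?_
        refine (eLpNorm_add_le (hPm hf hg m).aestronglyMeasurable
          (hPm hg hf m).aestronglyMeasurable hp1).trans ?_
        exact add_le_add (eLpNorm_low_conv_block_le hφ hp1 hp hf hg _)
          (eLpNorm_low_conv_block_le hφ hp1 hp hg hf _)

end


/-! ### Space-time norms and the bilinear estimate -/

/-- The `j`-th term of the norm of `L̃^∞(a, b; FḂ^s_{p,q}) ∩ L̃¹(a, b; FḂ^{s+2}_{p,q})`, for a
non-negative function of time and frequency. -/
def slab (φ : E3 → ℝ) (s : ℝ) (p : ℝ≥0∞) (a b : ℝ) (f : ℝ → E3 → ℝ≥0∞) (j : ℤ) : ℝ≥0∞ :=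
  2 ^ ((j : ℝ) * s) * (eLpNorm (fun t => blockNorm φ p j (f t)) ∞ (volume.restrict (Set.Ioo a b)) +
    2 ^ ((j : ℝ) * 2) * ∫⁻ t in Set.Ioo a b, blockNorm φ p j (f t))

/-- The norm of `L̃^∞(a, b; FḂ^s_{p,q}) ∩ L̃¹(a, b; FḂ^{s+2}_{p,q})`, for a non-negative function of
time and frequency. -/
def slabNorm (φ : E3 → ℝ) (s : ℝ) (p q : ℝ≥0∞) (a b : ℝ) (f : ℝ → E3 → ℝ≥0∞) : ℝ≥0∞ :=
  seqNorm q (slab φ s p a b f)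

/-- The constant in the bound `divConst * |ξ|` for the symbol of `ℙ div`: a factor `2π` comes from the
derivative, `3` from the sum over the coordinates, and `2` from the symbol of `ℙ`. -/
def divConst : ℝ := 12 * Real.pi

/-- The majorant of the Duhamel term on `(a, t)` without the heat kernel. -/
def fluxMaj (f g : ℝ → E3 → ℝ≥0∞) (a t : ℝ) (ξ : E3) : ℝ≥0∞ :=
  ∫⁻ τ in Set.Ioo a t, ENNReal.ofReal (divConst * ‖ξ‖) * conv (f τ) (g τ) ξ

/-- The majorant of the Duhamel term on `(a, t)`. -/
def duhamelMaj (ν : ℝ) (f g : ℝ → E3 → ℝ≥0∞) (a t : ℝ) (ξ : E3) : ℝ≥0∞ :=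
  ∫⁻ τ in Set.Ioo a t, ENNReal.ofReal (heatSymbol ν (t - τ) ξ) *
    (ENNReal.ofReal (divConst * ‖ξ‖) * conv (f τ) (g τ) ξ)

theorem divConst_pos : 0 < divConst := by unfold divConst; positivity

theorem heatSymbol_pos (ν t : ℝ) (ξ : E3) : 0 < heatSymbol ν t ξ := Real.exp_pos _

theorem heatSymbol_le_one {ν t : ℝ} (hν : 0 ≤ ν) (ht : 0 ≤ t) (ξ : E3) :
    heatSymbol ν t ξ ≤ 1 := by
  rw [heatSymbol, Real.exp_le_one_iff, neg_nonpos]; positivity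

theorem measurable_heatSymbol (ν : ℝ) : Measurable fun z : ℝ × E3 => heatSymbol ν z.1 z.2 := by
  unfold heatSymbol; fun_prop

section

variable {p q : ℝ≥0∞} {s : ℝ} {a b : ℝ}

theorem slab_mono {f g : ℝ → E3 → ℝ≥0∞} (j : ℤ)
    (h : ∀ᵐ t ∂(volume.restrict (Set.Ioo a b)), ∀ᵐ ξ, f t ξ ≤ g t ξ) :
    slab φ s p a b f j ≤ slab φ s p a b g j := by
  have h' : ∀ᵐ t ∂(volume.restrict (Set.Ioo a b)), blockNorm φ p j (f t) ≤ blockNorm φ p j (g t) := by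
    filter_upwards [h] with t ht using blockNorm_mono ht
  exact mul_le_mul_right (add_le_add (eLpNorm_mono_ennreal h')
    (mul_le_mul_right (lintegral_mono_ae h') _)) _

theorem slabNorm_mono (hq : 1 ≤ q) {f g : ℝ → E3 → ℝ≥0∞}
    (h : ∀ᵐ t ∂(volume.restrict (Set.Ioo a b)), ∀ᵐ ξ, f t ξ ≤ g t ξ) :
    slabNorm φ s p q a b f ≤ slabNorm φ s p q a b g :=
  seqNorm_mono hq fun j => slab_mono j h

theorem slabNorm_mono_interval (hq : 1 ≤ q) {a' b' : ℝ} (h : Set.Ioo a b ⊆ Set.Ioo a' b')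
    (f : ℝ → E3 → ℝ≥0∞) :
    slabNorm φ s p q a b f ≤ slabNorm φ s p q a' b' f := by
  refine seqNorm_mono hq fun j => ?_
  exact mul_le_mul_right (add_le_add (eLpNorm_mono_measure _ (Measure.restrict_mono h le_rfl))
    (mul_le_mul_right (lintegral_mono_set h) _)) _

theorem slabNorm_add_le (hφ : IsLittlewoodPaley φ) (hp1 : 1 ≤ p) (hp : p ≠ ∞) (hq : 1 ≤ q)
    {f g : ℝ → E3 → ℝ≥0∞} (hf : Measurable (Function.uncurry f))
    (hg : Measurable (Function.uncurry g)) :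
    slabNorm φ s p q a b (fun t ξ => f t ξ + g t ξ) ≤
      slabNorm φ s p q a b f + slabNorm φ s p q a b g := by
  refine le_trans (seqNorm_mono hq fun j => ?_) (seqNorm_add_le hq _ _)
  have hF := measurable_blockNorm hφ hp1 hp j hf
  have hG := measurable_blockNorm hφ hp1 hp j hg
  have h1 : ∀ t, blockNorm φ p j (fun ξ => f t ξ + g t ξ) ≤
      blockNorm φ p j (f t) + blockNorm φ p j (g t) := fun t =>
    blockNorm_add_le hφ hp1 j hf.of_uncurry_left hg.of_uncurry_left
  unfold slab
  rw [← mul_add, add_add_add_comm, ← mul_add, ← lintegral_add_left hF]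
  exact mul_le_mul_right (add_le_add ((eLpNorm_mono_ennreal (ae_of_all _ h1)).trans
    (eLpNorm_add_le hF.aestronglyMeasurable hG.aestronglyMeasurable le_top))
    (mul_le_mul_right (lintegral_mono h1) _)) _

theorem ae_block_le_slab (j : ℤ) (f : ℝ → E3 → ℝ≥0∞) :
    ∀ᵐ t ∂(volume.restrict (Set.Ioo a b)),
      2 ^ ((j : ℝ) * s) * blockNorm φ p j (f t) ≤ slab φ s p a b f j := by
  have := ENNReal.ae_le_essSup (μ := volume.restrict (Set.Ioo a b))
    (fun t => blockNorm φ p j (f t))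
  filter_upwards [this] with t ht
  unfold slab
  gcongr
  refine le_add_right ?_
  simpa [eLpNorm_exponent_top, eLpNormEssSup] using ht

theorem ae_block_le_slabNorm (hq : 1 ≤ q) (f : ℝ → E3 → ℝ≥0∞) :
    ∀ᵐ t ∂(volume.restrict (Set.Ioo a b)), ∀ j : ℤ,
      2 ^ ((j : ℝ) * s) * blockNorm φ p j (f t) ≤ slabNorm φ s p q a b f := by
  rw [ae_all_iff]
  intro j
  filter_upwards [ae_block_le_slab (φ := φ) (p := p) (s := s) (a := a) (b := b) j f] with t ht
  exact ht.trans (le_seqNorm hq _ j)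

/-- On a short interval the two parts of the norm are interpolated: this is where the gain of a
power of the length of the interval comes from. -/
theorem lintegral_block_le {δ : ℝ} (hδ0 : 0 < δ) (hδ2 : δ < 2) (j : ℤ)
    (f : ℝ → E3 → ℝ≥0∞) :
    ∫⁻ t in Set.Ioo a b, blockNorm φ p j (f t) ≤
      ENNReal.ofReal (b - a) ^ (δ / 2) * 2 ^ (-((j : ℝ) * (s + 2 - δ))) * slab φ s p a b f j := by
  set X := eLpNorm (fun t => blockNorm φ p j (f t)) ∞ (volume.restrict (Set.Ioo a b)) with hX
  set Y := ∫⁻ t in Set.Ioo a b, blockNorm φ p j (f t) with hY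
  set h := ENNReal.ofReal (b - a)
  have h1 : Y ≤ h * X := by
    have : ∀ᵐ t ∂(volume.restrict (Set.Ioo a b)), blockNorm φ p j (f t) ≤ X := by
      have := ENNReal.ae_le_essSup (μ := volume.restrict (Set.Ioo a b))
        (fun t => blockNorm φ p j (f t))
      simpa [hX, eLpNorm_exponent_top, eLpNormEssSup] using this
    refine (lintegral_mono_ae this).trans_eq ?_
    simp [h, mul_comm]
  set Z := X + 2 ^ ((j : ℝ) * 2) * Y
  have h2 : Y ≤ 2 ^ (-((j : ℝ) * 2)) * Z := by
    calc Y = 2 ^ (-((j : ℝ) * 2)) * (2 ^ ((j : ℝ) * 2) * Y) := by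
          rw [← mul_assoc, ← two_rpow_add]; simp
      _ ≤ _ := by gcongr; exact le_add_self
  have hZ : slab φ s p a b f j = 2 ^ ((j : ℝ) * s) * Z := rfl
  calc Y = Y ^ (δ / 2) * Y ^ (1 - δ / 2) := by
        rw [← ENNReal.rpow_add_of_nonneg _ _ (by linarith) (by linarith)]; simp
    _ ≤ (h * Z) ^ (δ / 2) * (2 ^ (-((j : ℝ) * 2)) * Z) ^ (1 - δ / 2) := by
        gcongr
        · exact h1.trans (by gcongr; exact le_self_add)
        · linarith
    _ = h ^ (δ / 2) * 2 ^ (-((j : ℝ) * (2 - δ))) * (Z ^ (δ / 2) * Z ^ (1 - δ / 2)) := by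
        rw [ENNReal.mul_rpow_of_nonneg _ _ (by linarith),
          ENNReal.mul_rpow_of_nonneg _ _ (by linarith), ← ENNReal.rpow_mul]
        have : -((j : ℝ) * 2) * (1 - δ / 2) = -((j : ℝ) * (2 - δ)) := by ring
        rw [this]; ring
    _ = h ^ (δ / 2) * 2 ^ (-((j : ℝ) * (2 - δ))) * Z := by
        rw [← ENNReal.rpow_add_of_nonneg _ _ (by linarith) (by linarith)]; simp
    _ = _ := by
        rw [hZ]
        have : (2 : ℝ≥0∞) ^ (-((j : ℝ) * (2 - δ))) =
            2 ^ (-((j : ℝ) * (s + 2 - δ))) * 2 ^ ((j : ℝ) * s) := by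
          rw [← two_rpow_add]; ring_nf
        rw [this]; ring

/-- **The product estimate** in the space-time norms: the low-frequency factor costs `2^{lα}`, with
`α = 3 (1 - 1/p) - s`, and the time integral of the other one gains `(b - a)^{(1-α)/2}`. -/
theorem exists_product_le (hφ : IsLittlewoodPaley φ) (hp1 : 1 ≤ p) (hp : p ≠ ∞) (hq : 1 ≤ q)
    (hα : 0 < 3 * (1 - 1 / p.toReal) - s) (hα1 : 3 * (1 - 1 / p.toReal) - s < 1) (hs : -1 < s) :
    ∃ C : ℝ≥0∞, C ≠ ∞ ∧ ∀ (a b : ℝ), a ≤ b → ∀ f g : ℝ → E3 → ℝ≥0∞,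
      Measurable (Function.uncurry f) → Measurable (Function.uncurry g) →
      seqNorm q (fun j => 2 ^ ((j : ℝ) * (s + 1)) *
        ∫⁻ τ in Set.Ioo a b, blockNorm φ p j (conv (f τ) (g τ))) ≤
      C * ENNReal.ofReal (b - a) ^ ((1 - (3 * (1 - 1 / p.toReal) - s)) / 2) *
        slabNorm φ s p q a b f * slabNorm φ s p q a b g := by
  obtain ⟨C, hC, hL⟩ := exists_lowMass_le (s := s) hφ hp1 hα
  set α := 3 * (1 - 1 / p.toReal) - s with hαd
  set δ := 1 - α with hδ
  refine ⟨2 * C * 2 ^ (2 * (s + 1)) * (1 - (2 : ℝ≥0∞) ^ (-(s + 1)))⁻¹, ENNReal.mul_ne_top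
    (ENNReal.mul_ne_top (ENNReal.mul_ne_top (by norm_num) hC) (two_rpow_ne_top _))
    (geometric_ne_top (by linarith)), fun a b hab f g hf hg => ?_⟩
  set Mf := slabNorm φ s p q a b f with hMf
  set Mg := slabNorm φ s p q a b g with hMg
  set h := ENNReal.ofReal (b - a) ^ (δ / 2) with hh
  set A : ℤ → ℝ≥0∞ := fun l => Mf * slab φ s p a b g l + Mg * slab φ s p a b f l with hA
  have hmf : ∀ l, Measurable fun t => blockNorm φ p l (f t) := fun l =>
    measurable_blockNorm hφ hp1 hp l hf
  have hmg : ∀ l, Measurable fun t => blockNorm φ p l (g t) := fun l =>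
    measurable_blockNorm hφ hp1 hp l hg
  have hbound : ∀ j : ℤ, ∫⁻ τ in Set.Ioo a b, blockNorm φ p j (conv (f τ) (g τ)) ≤
      ∑' m : ℕ, C * h * 2 ^ (-(((j + (-2 + m) : ℤ) : ℝ) * (s + 1))) * A (j + (-2 + m)) := by
    intro j
    calc ∫⁻ τ in Set.Ioo a b, blockNorm φ p j (conv (f τ) (g τ))
        ≤ ∫⁻ τ in Set.Ioo a b, ∑' m : ℕ,
          (C * 2 ^ (((j + (-2 + m) : ℤ) : ℝ) * α) * Mf * blockNorm φ p (j + (-2 + m)) (g τ) +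
            C * 2 ^ (((j + (-2 + m) : ℤ) : ℝ) * α) * Mg * blockNorm φ p (j + (-2 + m)) (f τ)) := by
          refine lintegral_mono_ae ?_
          filter_upwards [ae_block_le_slabNorm (φ := φ) (p := p) (s := s) hq f,
            ae_block_le_slabNorm (φ := φ) (p := p) (s := s) hq g] with τ h1 h2
          refine (blockNorm_conv_le hφ hp1 hp hf.of_uncurry_left hg.of_uncurry_left j).trans ?_
          refine ENNReal.tsum_le_tsum fun m => ?_
          gcongr
          · exact hL _ _ _ hf.of_uncurry_left h1
          · exact hL _ _ _ hg.of_uncurry_left h2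
      _ = ∑' m : ℕ,
          (C * 2 ^ (((j + (-2 + m) : ℤ) : ℝ) * α) * Mf *
              (∫⁻ τ in Set.Ioo a b, blockNorm φ p (j + (-2 + m)) (g τ)) +
            C * 2 ^ (((j + (-2 + m) : ℤ) : ℝ) * α) * Mg *
              ∫⁻ τ in Set.Ioo a b, blockNorm φ p (j + (-2 + m)) (f τ)) := by
          rw [lintegral_tsum (f := fun (m : ℕ) τ =>
            C * 2 ^ (((j + (-2 + m) : ℤ) : ℝ) * α) * Mf * blockNorm φ p (j + (-2 + m)) (g τ) +
            C * 2 ^ (((j + (-2 + m) : ℤ) : ℝ) * α) * Mg * blockNorm φ p (j + (-2 + m)) (f τ))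
            fun m => (((hmg _).const_mul _).add ((hmf _).const_mul _)).aemeasurable]
          refine tsum_congr fun m => ?_
          rw [lintegral_add_left ((hmg _).const_mul _), lintegral_const_mul _ (hmg _),
            lintegral_const_mul _ (hmf _)]
      _ ≤ _ := by
          refine ENNReal.tsum_le_tsum fun m => ?_
          -- Interpolation with `δ = 1 - α` turns the cost `2^{lα}` into exactly `2^{-l(s+1)}`.
          set l : ℤ := j + (-2 + m)
          have e1 : (2 : ℝ≥0∞) ^ (-((l : ℝ) * (s + 1))) =
              2 ^ ((l : ℝ) * α) * 2 ^ (-((l : ℝ) * (s + 2 - δ))) := by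
            rw [← two_rpow_add, hδ]; ring_nf
          calc _ ≤ C * 2 ^ ((l : ℝ) * α) * Mf *
                (h * 2 ^ (-((l : ℝ) * (s + 2 - δ))) * slab φ s p a b g l) +
                C * 2 ^ ((l : ℝ) * α) * Mg *
                (h * 2 ^ (-((l : ℝ) * (s + 2 - δ))) * slab φ s p a b f l) := by
                gcongr
                · exact lintegral_block_le (by linarith) (by linarith) l g
                · exact lintegral_block_le (by linarith) (by linarith) l f
            _ = _ := by rw [e1, hA]; ring
  -- The weights leave the kernel `2^{-m(s+1)}`, which is summable since `s > -1`.
  calc seqNorm q (fun j => 2 ^ ((j : ℝ) * (s + 1)) *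
        ∫⁻ τ in Set.Ioo a b, blockNorm φ p j (conv (f τ) (g τ)))
      ≤ seqNorm q (fun j => C * h * 2 ^ (2 * (s + 1)) *
          ∑' m : ℕ, ((2 : ℝ≥0∞) ^ (-(s + 1))) ^ m * A (j + (-2 + m))) := by
        refine seqNorm_mono hq fun j => ?_
        refine (mul_le_mul_right (hbound j) _).trans_eq ?_
        rw [← ENNReal.tsum_mul_left, ← ENNReal.tsum_mul_left]
        refine tsum_congr fun m => ?_
        have e2 : (2 : ℝ≥0∞) ^ ((j : ℝ) * (s + 1)) *
            2 ^ (-(((j + (-2 + m) : ℤ) : ℝ) * (s + 1))) =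
            2 ^ (2 * (s + 1)) * (2 ^ (-(s + 1))) ^ m := by
          rw [← two_rpow_neg_mul, ← two_rpow_add, ← two_rpow_add]; push_cast; ring_nf
        calc _ = C * h * (2 ^ ((j : ℝ) * (s + 1)) *
            2 ^ (-(((j + (-2 + m) : ℤ) : ℝ) * (s + 1)))) * A (j + (-2 + m)) := by ring
          _ = _ := by rw [e2]; ring
    _ ≤ C * h * 2 ^ (2 * (s + 1)) * ((1 - (2 : ℝ≥0∞) ^ (-(s + 1)))⁻¹ * seqNorm q A) := by
        rw [seqNorm_const_mul hq]
        gcongr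
        exact seqNorm_geometric_le hq _ _ _
    _ ≤ C * h * 2 ^ (2 * (s + 1)) * ((1 - (2 : ℝ≥0∞) ^ (-(s + 1)))⁻¹ * (Mf * Mg + Mg * Mf)) := by
        gcongr
        refine (seqNorm_add_le hq _ _).trans ?_
        rw [seqNorm_const_mul hq, seqNorm_const_mul hq]
        rfl
    _ = _ := by ring

/-! ### The heat semigroup and the majorant of the Duhamel term -/

theorem lintegral_exp_decay_le {c : ℝ} (hc : 0 < c) (a : ℝ) :
    ∫⁻ t in Set.Ioi a, ENNReal.ofReal (Real.exp (-(c * (t - a)))) ≤ ENNReal.ofReal (1 / c) := by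
  have h1 : (fun t => Real.exp (-(c * (t - a)))) = fun t => Real.exp (c * a) * Real.exp (-c * t) := by
    funext t; rw [← Real.exp_add]; ring_nf
  have hint : IntegrableOn (fun t => Real.exp (-(c * (t - a)))) (Set.Ioi a) := by
    rw [h1]; exact (integrableOn_exp_mul_Ioi (by linarith) a).const_mul _
  rw [← ofReal_integral_eq_lintegral_ofReal hint (ae_of_all _ fun t => (Real.exp_pos _).le)]
  refine ENNReal.ofReal_le_ofReal ?_
  rw [h1, integral_const_mul, integral_exp_mul_Ioi (by linarith)]
  rw [neg_mul, Real.exp_neg]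
  field_simp
  exact le_rfl

theorem heatSymbol_le_of_block {ν t : ℝ} (hν : 0 ≤ ν) (ht : 0 ≤ t) {j : ℤ} {ξ : E3}
    (h : 3 / 4 * (2 : ℝ) ^ j ≤ ‖ξ‖) :
    heatSymbol ν t ξ ≤ Real.exp (-(9 / 4 * Real.pi ^ 2 * ν * (2 : ℝ) ^ (2 * j) * t)) := by
  rw [heatSymbol, Real.exp_le_exp, neg_le_neg_iff]
  have h1 : (3 / 4 * (2 : ℝ) ^ j) ^ 2 ≤ ‖ξ‖ ^ 2 := by gcongr
  have h2 : (3 / 4 * (2 : ℝ) ^ j) ^ 2 = 9 / 16 * (2 : ℝ) ^ (2 * j) := by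
    rw [mul_pow, two_mul, zpow_add₀ (by norm_num)]; ring
  rw [h2] at h1
  have h3 : 0 ≤ 4 * Real.pi ^ 2 * ν * t := by positivity
  nlinarith [mul_le_mul_of_nonneg_left h1 h3]

/-- The decay of the heat kernel on the `j`-th block, integrated in time, gains the factor `2^{-2j}`. -/
theorem two_sq_mul_lintegral_decay_le {ν : ℝ} (hν : 0 < ν) (j : ℤ) (a : ℝ) :
    2 ^ ((j : ℝ) * 2) * ∫⁻ t in Set.Ioi a,
      ENNReal.ofReal (Real.exp (-(9 / 4 * Real.pi ^ 2 * ν * (2 : ℝ) ^ (2 * j) * (t - a)))) ≤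
      ENNReal.ofReal (1 / (9 / 4 * Real.pi ^ 2 * ν)) := by
  have h0 : 0 < 9 / 4 * Real.pi ^ 2 * ν := by positivity
  refine (mul_le_mul_right (lintegral_exp_decay_le (by positivity) a) _).trans_eq ?_
  have h2 : (2 : ℝ≥0∞) ^ ((j : ℝ) * 2) = ENNReal.ofReal ((2 : ℝ) ^ (2 * j)) := by
    rw [ofReal_two_zpow]; push_cast; ring_nf
  rw [h2, ← ENNReal.ofReal_mul (by positivity)]
  congr 1
  have : (2 : ℝ) ^ (2 * j) ≠ 0 := by positivity
  field_simp

/-- The heat flow is bounded from `FḂ^s_{p,q}` to the space-time norm, block by block and uniformly in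
the length of the time interval. -/
theorem exists_heat_slab_le (hφ : IsLittlewoodPaley φ) {ν : ℝ} (hν : 0 < ν) :
    ∃ C : ℝ≥0∞, C ≠ ∞ ∧ ∀ (b : ℝ) (f : E3 → ℝ≥0∞) (j : ℤ),
      slab φ s p 0 b (fun t ξ => ENNReal.ofReal (heatSymbol ν t ξ) * f ξ) j ≤
        C * (2 ^ ((j : ℝ) * s) * blockNorm φ p j f) := by
  set c := 9 / 4 * Real.pi ^ 2 * ν with hc
  refine ⟨1 + ENNReal.ofReal (1 / c), by simp, fun b f j => ?_⟩
  have h1 : ∀ t, 0 < t → blockNorm φ p j (fun ξ => ENNReal.ofReal (heatSymbol ν t ξ) * f ξ) ≤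
      ENNReal.ofReal (Real.exp (-(c * (2 : ℝ) ^ (2 * j) * (t - 0)))) * blockNorm φ p j f := by
    intro t ht
    refine blockNorm_mul_le hφ ENNReal.ofReal_ne_top fun ξ hξ _ => ENNReal.ofReal_le_ofReal ?_
    rw [sub_zero]
    exact heatSymbol_le_of_block hν.le ht.le hξ
  have hc0 : 0 < c := by positivity
  unfold slab
  rw [mul_left_comm, add_mul, one_mul]
  refine mul_le_mul_right (add_le_add ?_ ?_) _
  · rw [eLpNorm_exponent_top, eLpNormEssSup]
    refine essSup_le_of_ae_le _ ?_
    filter_upwards [ae_restrict_mem measurableSet_Ioo] with t ht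
    refine (h1 t ht.1).trans (mul_le_of_le_one_left zero_le ?_)
    rw [ENNReal.ofReal_le_one, Real.exp_le_one_iff, neg_nonpos]
    have := ht.1
    rw [sub_zero]
    positivity
  · calc _ ≤ 2 ^ ((j : ℝ) * 2) * ∫⁻ t in Set.Ioi (0 : ℝ),
            ENNReal.ofReal (Real.exp (-(c * (2 : ℝ) ^ (2 * j) * (t - 0)))) * blockNorm φ p j f := by
          refine mul_le_mul_right ?_ _
          refine (setLIntegral_mono_ae' measurableSet_Ioo (ae_of_all _ fun t ht => h1 t ht.1)).trans ?_
          exact lintegral_mono' (Measure.restrict_mono (fun t ht => ht.1) le_rfl) le_rfl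
      _ ≤ _ := by
          rw [lintegral_mul_const _ (by fun_prop), ← mul_assoc]
          exact mul_le_mul_left (two_sq_mul_lintegral_decay_le hν j 0) _

/-- The derivative costs a factor `2ʲ` on the `j`-th block. -/
theorem fluxMaj_block_le (hφ : IsLittlewoodPaley φ) (hp1 : 1 ≤ p) (hp : p ≠ ∞)
    {f g : ℝ → E3 → ℝ≥0∞} (hf : Measurable (Function.uncurry f))
    (hg : Measurable (Function.uncurry g)) (a t : ℝ) (j : ℤ) :
    2 ^ ((j : ℝ) * s) * blockNorm φ p j (fluxMaj f g a t) ≤ ENNReal.ofReal (divConst * (8 / 3)) *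
      (2 ^ ((j : ℝ) * (s + 1)) * ∫⁻ τ in Set.Ioo a t, blockNorm φ p j (conv (f τ) (g τ))) := by
  have hκ := divConst_pos
  have h1 : blockNorm φ p j (fluxMaj f g a t) ≤ ∫⁻ τ in Set.Ioo a t,
      blockNorm φ p j (fun ξ => ENNReal.ofReal (divConst * ‖ξ‖) * conv (f τ) (g τ) ξ) := by
    refine blockNorm_lintegral_le hφ hp1 hp j
      (f := fun ξ τ => ENNReal.ofReal (divConst * ‖ξ‖) * conv (f τ) (g τ) ξ) ?_
    refine Measurable.mul (by fun_prop) ?_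
    exact (measurable_conv hf hg).comp measurable_swap
  have h2 : ∀ τ, blockNorm φ p j (fun ξ => ENNReal.ofReal (divConst * ‖ξ‖) * conv (f τ) (g τ) ξ) ≤
      ENNReal.ofReal (divConst * (8 / 3 * (2 : ℝ) ^ j)) * blockNorm φ p j (conv (f τ) (g τ)) :=
    fun τ => blockNorm_mul_le hφ ENNReal.ofReal_ne_top fun ξ _ hξ =>
      ENNReal.ofReal_le_ofReal (by gcongr)
  have h3 : ENNReal.ofReal (divConst * (8 / 3 * (2 : ℝ) ^ j)) =
      ENNReal.ofReal (divConst * (8 / 3)) * 2 ^ (j : ℝ) := by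
    rw [← mul_assoc, ENNReal.ofReal_mul (by positivity), ofReal_two_zpow]
  have h4 : (2 : ℝ≥0∞) ^ ((j : ℝ) * (s + 1)) = 2 ^ ((j : ℝ) * s) * 2 ^ (j : ℝ) := by
    rw [← two_rpow_add]; ring_nf
  calc _ ≤ 2 ^ ((j : ℝ) * s) * ∫⁻ τ in Set.Ioo a t,
        ENNReal.ofReal (divConst * (8 / 3 * (2 : ℝ) ^ j)) * blockNorm φ p j (conv (f τ) (g τ)) := by
        gcongr
        exact h1.trans (lintegral_mono h2)
    _ = _ := by
        rw [lintegral_const_mul' _ _ ENNReal.ofReal_ne_top, h3, h4]; ring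

theorem duhamelMaj_le_fluxMaj {ν : ℝ} (hν : 0 ≤ ν) (f g : ℝ → E3 → ℝ≥0∞) (a t : ℝ) (ξ : E3) :
    duhamelMaj ν f g a t ξ ≤ fluxMaj f g a t ξ := by
  refine setLIntegral_mono' measurableSet_Ioo fun τ hτ => mul_le_of_le_one_left zero_le ?_
  rw [ENNReal.ofReal_le_one]
  exact heatSymbol_le_one hν (by linarith [hτ.2]) ξ

theorem measurable_duhamelMaj (ν a : ℝ) {f g : ℝ → E3 → ℝ≥0∞}
    (hf : Measurable (Function.uncurry f)) (hg : Measurable (Function.uncurry g)) :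
    Measurable (Function.uncurry fun t ξ => duhamelMaj ν f g a t ξ) := by
  have h1 : (Function.uncurry fun t ξ => duhamelMaj ν f g a t ξ) = fun z : ℝ × E3 =>
      ∫⁻ τ, {w : (ℝ × E3) × ℝ | a < w.2 ∧ w.2 < w.1.1}.indicator (fun w =>
        ENNReal.ofReal (heatSymbol ν (w.1.1 - w.2) w.1.2) *
        (ENNReal.ofReal (divConst * ‖w.1.2‖) * conv (f w.2) (g w.2) w.1.2)) (z, τ) := by
    funext z
    simp only [Function.uncurry, duhamelMaj]
    rw [← lintegral_indicator measurableSet_Ioo]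
    rfl
  rw [h1]
  refine Measurable.lintegral_prod_right' (Measurable.indicator ?_ ?_)
  · refine Measurable.mul ?_ (Measurable.mul (by fun_prop) ?_)
    · exact ((measurable_heatSymbol ν).comp (((measurable_fst.comp measurable_fst).sub
        measurable_snd).prodMk (measurable_snd.comp measurable_fst))).ennreal_ofReal
    · exact (measurable_conv hf hg).comp
        (measurable_snd.prodMk (measurable_snd.comp measurable_fst))
  · exact (measurableSet_lt measurable_const measurable_snd).inter
      (measurableSet_lt measurable_snd (measurable_fst.comp measurable_fst))

theorem measurable_fluxMaj {f g : ℝ → E3 → ℝ≥0∞}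
    (hf : Measurable (Function.uncurry f)) (hg : Measurable (Function.uncurry g)) (a t : ℝ) :
    Measurable (fluxMaj f g a t) := by
  refine Measurable.lintegral_prod_right' (f := fun w : E3 × ℝ =>
    ENNReal.ofReal (divConst * ‖w.1‖) * conv (f w.2) (g w.2) w.1) ?_
  exact Measurable.mul (by fun_prop) ((measurable_conv hf hg).comp measurable_swap)

/-- Smoothing of the inhomogeneous heat equation, block by block: the time integral of the forcing
controls both parts of the space-time norm, with two more derivatives in the `L¹` part. -/
theorem exists_duhamelMaj_slab_le (hφ : IsLittlewoodPaley φ) {ν : ℝ} (hν : 0 < ν) (hp1 : 1 ≤ p)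
    (hp : p ≠ ∞) :
    ∃ C : ℝ≥0∞, C ≠ ∞ ∧ ∀ (a b : ℝ) (f g : ℝ → E3 → ℝ≥0∞), Measurable (Function.uncurry f) →
      Measurable (Function.uncurry g) → ∀ j,
      slab φ s p a b (duhamelMaj ν f g a) j ≤ C * (2 ^ ((j : ℝ) * (s + 1)) *
        ∫⁻ τ in Set.Ioo a b, blockNorm φ p j (conv (f τ) (g τ))) := by
  set c := 9 / 4 * Real.pi ^ 2 * ν with hc
  have hκ := divConst_pos
  refine ⟨ENNReal.ofReal (divConst * (8 / 3)) + ENNReal.ofReal (1 / c) *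
    ENNReal.ofReal (divConst * (8 / 3)), ENNReal.add_ne_top.2 ⟨ENNReal.ofReal_ne_top,
      ENNReal.mul_ne_top ENNReal.ofReal_ne_top ENNReal.ofReal_ne_top⟩, fun a b f g hf hg j => ?_⟩
  set n : ℝ → ℝ≥0∞ := fun τ => blockNorm φ p j (conv (f τ) (g τ)) with hn
  have hnm : Measurable n := measurable_blockNorm hφ hp1 hp j (measurable_conv hf hg)
  set c₁ : ℝ≥0∞ := ENNReal.ofReal (divConst * (8 / 3 * (2 : ℝ) ^ j)) with hc₁
  set E : ℝ → ℝ → ℝ≥0∞ := fun t τ =>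
    ENNReal.ofReal (Real.exp (-(c * (2 : ℝ) ^ (2 * j) * (t - τ)))) with hE
  have hEm : Measurable (Function.uncurry E) := by
    simp only [hE, Function.uncurry_def]; fun_prop
  have h1 : ∀ t, blockNorm φ p j (duhamelMaj ν f g a t) ≤
      ∫⁻ τ in Set.Ioo a t, E t τ * (c₁ * n τ) := by
    intro t
    refine (blockNorm_lintegral_le hφ hp1 hp j (f := fun ξ τ =>
      ENNReal.ofReal (heatSymbol ν (t - τ) ξ) *
      (ENNReal.ofReal (divConst * ‖ξ‖) * conv (f τ) (g τ) ξ)) ?_).trans ?_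
    · refine Measurable.mul ?_ (Measurable.mul (by fun_prop) ?_)
      · exact ((measurable_heatSymbol ν).comp
          ((measurable_snd.const_sub t).prodMk measurable_fst)).ennreal_ofReal
      · exact (measurable_conv hf hg).comp measurable_swap
    · refine setLIntegral_mono' measurableSet_Ioo fun τ hτ => ?_
      refine (blockNorm_mul_le hφ ENNReal.ofReal_ne_top fun ξ hξ _ => ENNReal.ofReal_le_ofReal
        (heatSymbol_le_of_block hν.le (by linarith [hτ.2]) hξ)).trans ?_
      gcongr
      exact blockNorm_mul_le hφ ENNReal.ofReal_ne_top fun ξ _ hξ =>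
        ENNReal.ofReal_le_ofReal (by gcongr)
  -- Tonelli's theorem on `a < τ < t < b`, then extension of the integral in `t` to `(τ, ∞)`.
  have h2 : ∫⁻ t in Set.Ioo a b, ∫⁻ τ in Set.Ioo a t, E t τ * (c₁ * n τ) ≤
      ∫⁻ τ in Set.Ioo a b, (∫⁻ t in Set.Ioi τ, E t τ) * (c₁ * n τ) := by
    have hm : Measurable fun z : ℝ × ℝ =>
        {w : ℝ × ℝ | w.2 < w.1}.indicator (fun w => E w.1 w.2 * (c₁ * n w.2)) z := by
      refine Measurable.indicator (hEm.mul ?_) (measurableSet_lt measurable_snd measurable_fst)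
      exact (hnm.comp measurable_snd).const_mul _
    calc _ ≤ ∫⁻ t in Set.Ioo a b, ∫⁻ τ in Set.Ioo a b,
          {w : ℝ × ℝ | w.2 < w.1}.indicator (fun w => E w.1 w.2 * (c₁ * n w.2)) (t, τ) := by
          refine setLIntegral_mono' measurableSet_Ioo fun t ht => ?_
          rw [← lintegral_indicator measurableSet_Ioo, ← lintegral_indicator measurableSet_Ioo]
          refine lintegral_mono fun τ => ?_
          by_cases hτ : τ ∈ Set.Ioo a t
          · rw [Set.indicator_of_mem hτ,
              Set.indicator_of_mem (show τ ∈ Set.Ioo a b from ⟨hτ.1, hτ.2.trans ht.2⟩),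
              Set.indicator_of_mem (show (t, τ) ∈ {w : ℝ × ℝ | w.2 < w.1} from hτ.2)]
          · rw [Set.indicator_of_notMem hτ]; exact zero_le
      _ = ∫⁻ τ in Set.Ioo a b, ∫⁻ t in Set.Ioo a b,
          {w : ℝ × ℝ | w.2 < w.1}.indicator (fun w => E w.1 w.2 * (c₁ * n w.2)) (t, τ) :=
          lintegral_lintegral_swap hm.aemeasurable
      _ ≤ _ := by
          refine lintegral_mono fun τ => ?_
          rw [← lintegral_mul_const _ (hEm.of_uncurry_right)]
          rw [← lintegral_indicator measurableSet_Ioi]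
          refine (lintegral_mono' Measure.restrict_le_self le_rfl).trans (lintegral_mono fun t => ?_)
          by_cases hτ : τ < t
          · rw [Set.indicator_of_mem (by exact hτ), Set.indicator_of_mem (by exact hτ)]
          · rw [Set.indicator_of_notMem (by exact hτ)]; exact zero_le
  have h3 : c₁ = ENNReal.ofReal (divConst * (8 / 3)) * 2 ^ (j : ℝ) := by
    rw [hc₁, ← mul_assoc, ENNReal.ofReal_mul (by positivity), ofReal_two_zpow]
  have h4 : (2 : ℝ≥0∞) ^ ((j : ℝ) * (s + 1)) = 2 ^ ((j : ℝ) * s) * 2 ^ (j : ℝ) := by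
    rw [← two_rpow_add]; ring_nf
  have h5 : 2 ^ ((j : ℝ) * 2) * ∫⁻ t in Set.Ioo a b, blockNorm φ p j (duhamelMaj ν f g a t) ≤
      ENNReal.ofReal (1 / c) * (c₁ * ∫⁻ τ in Set.Ioo a b, n τ) := by
    calc _ ≤ 2 ^ ((j : ℝ) * 2) * ∫⁻ τ in Set.Ioo a b, (∫⁻ t in Set.Ioi τ, E t τ) * (c₁ * n τ) := by
          exact mul_le_mul_right ((lintegral_mono h1).trans h2) _
      _ = ∫⁻ τ in Set.Ioo a b, 2 ^ ((j : ℝ) * 2) * (∫⁻ t in Set.Ioi τ, E t τ) * (c₁ * n τ) := by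
          rw [← lintegral_const_mul' _ _ (two_rpow_ne_top _)]
          simp_rw [mul_assoc]
      _ ≤ ∫⁻ τ in Set.Ioo a b, ENNReal.ofReal (1 / c) * (c₁ * n τ) := by
          refine lintegral_mono fun τ => ?_
          dsimp only
          gcongr
          exact two_sq_mul_lintegral_decay_le hν j τ
      _ = _ := by
          rw [lintegral_const_mul' _ _ ENNReal.ofReal_ne_top,
            lintegral_const_mul' _ _ ENNReal.ofReal_ne_top]
  have h6 : eLpNorm (fun t => blockNorm φ p j (duhamelMaj ν f g a t)) ∞
      (volume.restrict (Set.Ioo a b)) ≤ c₁ * ∫⁻ τ in Set.Ioo a b, n τ := by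
    rw [eLpNorm_exponent_top, eLpNormEssSup]
    refine essSup_le_of_ae_le _ ?_
    filter_upwards [ae_restrict_mem measurableSet_Ioo] with t ht
    refine (h1 t).trans ?_
    rw [← lintegral_const_mul' _ _ ENNReal.ofReal_ne_top]
    refine (setLIntegral_mono' measurableSet_Ioo fun τ hτ => mul_le_of_le_one_left zero_le ?_).trans
      (lintegral_mono' (Measure.restrict_mono (Set.Ioo_subset_Ioo_right ht.2.le) le_rfl) le_rfl)
    rw [hE, ENNReal.ofReal_le_one, Real.exp_le_one_iff, neg_nonpos]
    have : 0 ≤ t - τ := by linarith [hτ.2]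
    positivity
  calc _ ≤ 2 ^ ((j : ℝ) * s) * (c₁ * (∫⁻ τ in Set.Ioo a b, n τ) +
        ENNReal.ofReal (1 / c) * (c₁ * ∫⁻ τ in Set.Ioo a b, n τ)) := by
        unfold slab; gcongr
    _ = _ := by rw [h3, h4]; ring

/-- **The bilinear estimate**: on an interval of length `h` the Duhamel term is bounded with a gain
`h^{δ/2}`, where `δ = s - s_p`. -/
theorem exists_bilinear_le (hφ : IsLittlewoodPaley φ) {ν : ℝ} (hν : 0 < ν) (hp1 : 1 ≤ p)
    (hp : p ≠ ∞) (hq : 1 ≤ q) (hα : 0 < 3 * (1 - 1 / p.toReal) - s)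
    (hα1 : 3 * (1 - 1 / p.toReal) - s < 1) (hs : -1 < s) :
    ∃ C : ℝ≥0∞, C ≠ ∞ ∧ ∀ (a b : ℝ), a ≤ b → ∀ f g : ℝ → E3 → ℝ≥0∞,
      Measurable (Function.uncurry f) → Measurable (Function.uncurry g) →
      slabNorm φ s p q a b (duhamelMaj ν f g a) ≤
        C * ENNReal.ofReal (b - a) ^ ((1 - (3 * (1 - 1 / p.toReal) - s)) / 2) *
          slabNorm φ s p q a b f * slabNorm φ s p q a b g ∧
      seqNorm q (fun j => 2 ^ ((j : ℝ) * s) * blockNorm φ p j (fluxMaj f g a b)) ≤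
        C * ENNReal.ofReal (b - a) ^ ((1 - (3 * (1 - 1 / p.toReal) - s)) / 2) *
          slabNorm φ s p q a b f * slabNorm φ s p q a b g := by
  obtain ⟨C₁, hC₁, h₁⟩ := exists_product_le hφ hp1 hp hq hα hα1 hs
  obtain ⟨C₂, hC₂, h₂⟩ := exists_duhamelMaj_slab_le (s := s) hφ hν hp1 hp
  set C₃ := ENNReal.ofReal (divConst * (8 / 3))
  refine ⟨(C₂ + C₃) * C₁, ENNReal.mul_ne_top (ENNReal.add_ne_top.2 ⟨hC₂, ENNReal.ofReal_ne_top⟩) hC₁,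
    fun a b hab f g hf hg => ⟨?_, ?_⟩⟩
  · refine (seqNorm_mono hq (h₂ a b f g hf hg)).trans ?_
    rw [seqNorm_const_mul hq]
    refine (mul_le_mul' (le_self_add : C₂ ≤ C₂ + C₃) (h₁ a b hab f g hf hg)).trans_eq ?_
    ring
  · refine (seqNorm_mono hq (fluxMaj_block_le hφ hp1 hp hf hg a b)).trans ?_
    rw [seqNorm_const_mul hq]
    refine (mul_le_mul' (le_add_self : C₃ ≤ C₂ + C₃) (h₁ a b hab f g hf hg)).trans_eq ?_
    ring

end


/-! ### The Duhamel term as a vector field -/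

/-- The Duhamel term of the Navier-Stokes equations in Fourier variables. -/
def duhamel (ν : ℝ) (f : ℝ → E3 → V3) (t : ℝ) (ξ : E3) : V3 :=
  ∫ τ in Set.Ioo 0 t, heatSymbol ν (t - τ) ξ • leraySymbol ξ (convectionSymbol (f τ) ξ)

/-- The integrands of the convolutions in the Duhamel term at `(t, ξ)` are integrable. -/
def ConvIntegrable (f : ℝ → E3 → V3) (t : ℝ) (ξ : E3) : Prop :=
  ∀ k : Fin 3, Integrable (fun z : ℝ × E3 => f z.1 (ξ - z.2) k • f z.1 z.2)
    ((volume.restrict (Set.Ioo 0 t)).prod volume)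

/-- The symbol of the Leray projector at a given frequency, as a continuous linear map. -/
def lerayCLM (ξ : E3) : V3 →L[ℂ] V3 :=
  LinearMap.toContinuousLinearMap
    { toFun := leraySymbol ξ
      map_add' := fun v w => by
        ext i
        simp only [leraySymbol, PiLp.add_apply, mul_add, Finset.sum_add_distrib]
        ring
      map_smul' := fun c v => by
        ext i
        simp only [leraySymbol, PiLp.smul_apply, smul_eq_mul, RingHom.id_apply]
        have : ∑ k, (ξ k : ℂ) * (c * v k) = c * ∑ k, (ξ k : ℂ) * v k := by
          rw [Finset.mul_sum]; exact Finset.sum_congr rfl fun k _ => by ring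
        rw [this]; ring }

theorem lerayCLM_apply (ξ : E3) (v : V3) : lerayCLM ξ v = leraySymbol ξ v := rfl

theorem norm_coord_le (v : V3) (i : Fin 3) : ‖v i‖ ≤ ‖v‖ := PiLp.norm_apply_le v i

theorem abs_coord_le (ξ : E3) (i : Fin 3) : |ξ i| ≤ ‖ξ‖ := PiLp.norm_apply_le ξ i

/-- The vector `ξ`, viewed in the complexified space. -/
def toV (ξ : E3) : V3 := WithLp.toLp 2 fun i => (ξ i : ℂ)

theorem norm_toV (ξ : E3) : ‖toV ξ‖ = ‖ξ‖ := by
  simp [toV, EuclideanSpace.norm_eq]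

theorem norm_leraySymbol_le (ξ : E3) (v : V3) : ‖leraySymbol ξ v‖ ≤ 2 * ‖v‖ := by
  have h1 : ∑ k, (ξ k : ℂ) * v k = inner ℂ (toV ξ) v := by
    simp [toV, PiLp.inner_apply, mul_comm]
  have h2 : leraySymbol ξ v = v - ((inner ℂ (toV ξ) v) / ((‖ξ‖ : ℂ) ^ 2)) • toV ξ := by
    ext i
    simp only [leraySymbol, h1, PiLp.sub_apply, PiLp.smul_apply, smul_eq_mul, toV]
    ring
  have h3 : ‖((inner ℂ (toV ξ) v) / ((‖ξ‖ : ℂ) ^ 2)) • toV ξ‖ ≤ ‖v‖ := by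
    rw [norm_smul, norm_div, norm_pow, Complex.norm_real, norm_norm, norm_toV]
    rcases eq_or_ne ξ 0 with rfl | hξ
    · simp
    have h4 : 0 < ‖ξ‖ := norm_pos_iff.2 hξ
    have h5 : ‖(inner ℂ (toV ξ) v : ℂ)‖ ≤ ‖ξ‖ * ‖v‖ := by
      rw [← norm_toV ξ]; exact norm_inner_le_norm _ _
    rw [div_mul_eq_mul_div, div_le_iff₀ (by positivity)]
    nlinarith
  rw [h2]
  linarith [norm_sub_le v (((inner ℂ (toV ξ) v) / ((‖ξ‖ : ℂ) ^ 2)) • toV ξ)]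

theorem sum_coord_mul_leraySymbol {ξ : E3} (hξ : ξ ≠ 0) (v : V3) :
    ∑ k, (ξ k : ℂ) * leraySymbol ξ v k = 0 := by
  have h1 : ((‖ξ‖ : ℂ)) ^ 2 = ∑ k, (ξ k : ℂ) * ξ k := by
    rw [← Complex.ofReal_pow, EuclideanSpace.norm_sq_eq]
    push_cast
    refine Finset.sum_congr rfl fun k _ => ?_
    rw [← Complex.ofReal_pow, Real.norm_eq_abs, sq_abs]; push_cast; ring
  have h2 : ((‖ξ‖ : ℂ)) ^ 2 ≠ 0 := by simpa using hξ
  simp only [leraySymbol]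
  set S := ∑ k, (ξ k : ℂ) * v k with hS
  have h3 : ∀ k, (ξ k : ℂ) * (v k - (ξ k : ℂ) * S / (‖ξ‖ : ℂ) ^ 2) =
      (ξ k : ℂ) * v k - (ξ k : ℂ) * ξ k * (S / (‖ξ‖ : ℂ) ^ 2) := fun k => by ring
  rw [Finset.sum_congr rfl fun k _ => h3 k, Finset.sum_sub_distrib, ← Finset.sum_mul, ← h1, ← hS,
    mul_div_cancel₀ _ h2, sub_self]

theorem measurable_leraySymbol : Measurable fun z : E3 × V3 => leraySymbol z.1 z.2 := by
  unfold leraySymbol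
  refine (WithLp.measurable_toLp 2 _).comp (measurable_pi_lambda _ fun i => ?_)
  have h1 : ∀ k, Measurable fun z : E3 × V3 => (z.1 k : ℂ) := fun k => by fun_prop
  have h2 : ∀ k, Measurable fun z : E3 × V3 => z.2 k := fun k => by fun_prop
  refine (h2 i).sub (Measurable.div ((h1 i).mul ?_) (by fun_prop))
  exact Finset.measurable_sum _ fun k _ => (h1 k).mul (h2 k)

theorem measurable_convectionSymbol {β : Type*} [MeasurableSpace β] {f : β → E3 → V3}
    (hf : Measurable (Function.uncurry f)) :
    Measurable fun z : β × E3 => convectionSymbol (f z.1) z.2 := by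
  unfold convectionSymbol
  refine Finset.measurable_sum _ fun k _ => Measurable.fun_smul (by fun_prop) ?_
  refine StronglyMeasurable.measurable (StronglyMeasurable.integral_prod_right'
    (f := fun w : (β × E3) × E3 => f w.1.1 (w.1.2 - w.2) k • f w.1.1 w.2) ?_)
  refine Measurable.stronglyMeasurable (Measurable.fun_smul ?_ ?_)
  · have : Measurable fun w : (β × E3) × E3 => f w.1.1 (w.1.2 - w.2) :=
      hf.comp ((measurable_fst.comp measurable_fst).prodMk
        ((measurable_snd.comp measurable_fst).sub measurable_snd))
    fun_prop
  · exact hf.comp ((measurable_fst.comp measurable_fst).prodMk measurable_snd)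

theorem measurable_duhamel (ν : ℝ) {f : ℝ → E3 → V3} (hf : Measurable (Function.uncurry f)) :
    Measurable (Function.uncurry (duhamel ν f)) := by
  have h1 : Function.uncurry (duhamel ν f) = fun z : ℝ × E3 =>
      ∫ τ, {w : (ℝ × E3) × ℝ | 0 < w.2 ∧ w.2 < w.1.1}.indicator (fun w =>
        heatSymbol ν (w.1.1 - w.2) w.1.2 •
          leraySymbol w.1.2 (convectionSymbol (f w.2) w.1.2)) (z, τ) := by
    funext z
    simp only [Function.uncurry, duhamel]
    rw [← integral_indicator measurableSet_Ioo]
    rfl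
  rw [h1]
  refine StronglyMeasurable.measurable (StronglyMeasurable.integral_prod_right'
    (Measurable.stronglyMeasurable (Measurable.indicator (Measurable.fun_smul ?_ ?_) ?_)))
  · exact (measurable_heatSymbol ν).comp (((measurable_fst.comp measurable_fst).sub
        measurable_snd).prodMk (measurable_snd.comp measurable_fst))
  · exact measurable_leraySymbol.comp ((measurable_snd.comp measurable_fst).prodMk
      ((measurable_convectionSymbol hf).comp
        (measurable_snd.prodMk (measurable_snd.comp measurable_fst))))
  · exact (measurableSet_lt measurable_const measurable_snd).inter
      (measurableSet_lt measurable_snd (measurable_fst.comp measurable_fst))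

theorem ConvIntegrable.integrable_convection {f : ℝ → E3 → V3} {t : ℝ} {ξ : E3}
    (h : ConvIntegrable f t ξ) :
    Integrable (fun τ => convectionSymbol (f τ) ξ) (volume.restrict (Set.Ioo 0 t)) := by
  unfold convectionSymbol
  exact integrable_finsetSum _ fun k _ => (h k).integral_prod_left.fun_smul _

theorem ConvIntegrable.integrable_duhamel {ν : ℝ} (hν : 0 ≤ ν) {f : ℝ → E3 → V3} {t : ℝ} {ξ : E3}
    (h : ConvIntegrable f t ξ) :
    Integrable (fun τ => heatSymbol ν (t - τ) ξ • leraySymbol ξ (convectionSymbol (f τ) ξ))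
      (volume.restrict (Set.Ioo 0 t)) := by
  have h1 := (lerayCLM ξ).integrable_comp h.integrable_convection
  refine h1.mono ?_ ?_
  · refine AEStronglyMeasurable.fun_smul ?_ h1.aestronglyMeasurable
    have : Measurable fun τ => heatSymbol ν (t - τ) ξ := by unfold heatSymbol; fun_prop
    exact this.aestronglyMeasurable
  · filter_upwards [ae_restrict_mem measurableSet_Ioo] with τ hτ
    rw [norm_smul, Real.norm_of_nonneg (heatSymbol_pos _ _ _).le]
    exact mul_le_of_le_one_left (norm_nonneg _) (heatSymbol_le_one hν (by linarith [hτ.2]) ξ)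

/-- The difference of the quadratic terms, by `f ⊗ f - g ⊗ g = (f - g) ⊗ f + g ⊗ (f - g)`. -/
theorem enorm_leray_convection_sub_le {f g : E3 → V3} {ξ : E3}
    (hf : ∀ k : Fin 3, Integrable fun η => f (ξ - η) k • f η)
    (hg : ∀ k : Fin 3, Integrable fun η => g (ξ - η) k • g η)
    (hfm : Measurable f) (hgm : Measurable g) :
    ‖leraySymbol ξ (convectionSymbol f ξ) - leraySymbol ξ (convectionSymbol g ξ)‖ₑ ≤
      ENNReal.ofReal (divConst * ‖ξ‖) * (conv (fun η => ‖f η - g η‖ₑ) (fun η => ‖f η‖ₑ) ξ +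
        conv (fun η => ‖g η‖ₑ) (fun η => ‖f η - g η‖ₑ) ξ) := by
  set X := conv (fun η => ‖f η - g η‖ₑ) (fun η => ‖f η‖ₑ) ξ +
        conv (fun η => ‖g η‖ₑ) (fun η => ‖f η - g η‖ₑ) ξ with hX
  have hcoord : ∀ (v : V3) (k : Fin 3), ‖v k‖ₑ ≤ ‖v‖ₑ := fun v k =>
    enorm_le_iff_norm_le.2 (norm_coord_le v k)
  have h1 : ∀ k : Fin 3, ‖(∫ η, f (ξ - η) k • f η) - ∫ η, g (ξ - η) k • g η‖ₑ ≤ X := by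
    intro k
    rw [← integral_sub (hf k) (hg k)]
    refine (enorm_integral_le_lintegral_enorm _).trans ?_
    have hm1 : Measurable fun η => ‖f (ξ - η) - g (ξ - η)‖ₑ * ‖f η‖ₑ :=
      (((hfm.comp (measurable_id.const_sub ξ)).sub
        (hgm.comp (measurable_id.const_sub ξ))).enorm).mul hfm.enorm
    rw [hX, conv, conv, ← lintegral_add_left hm1]
    refine lintegral_mono fun η => ?_
    have : f (ξ - η) k • f η - g (ξ - η) k • g η =
        (f (ξ - η) - g (ξ - η)) k • f η + g (ξ - η) k • (f η - g η) := by
      rw [PiLp.sub_apply]; module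
    rw [this]
    refine (enorm_add_le _ _).trans ?_
    rw [enorm_smul, enorm_smul]
    gcongr
    · exact hcoord _ k
    · exact hcoord _ k
  have h2 : ‖convectionSymbol f ξ - convectionSymbol g ξ‖ₑ ≤
      ENNReal.ofReal (6 * Real.pi * ‖ξ‖) * X := by
    unfold convectionSymbol
    rw [← Finset.sum_sub_distrib]
    simp_rw [← smul_sub]
    refine (enorm_sum_le _ _).trans ?_
    have h3 : ∀ k : Fin 3, ‖(2 * Real.pi * Complex.I * (ξ k : ℂ)) •
        ((∫ η, f (ξ - η) k • f η) - ∫ η, g (ξ - η) k • g η)‖ₑ ≤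
        ENNReal.ofReal (2 * Real.pi * ‖ξ‖) * X := by
      intro k
      rw [enorm_smul]
      refine mul_le_mul' ?_ (h1 k)
      rw [← ofReal_norm]
      refine ENNReal.ofReal_le_ofReal ?_
      simp only [norm_mul, Complex.norm_ofNat, Complex.norm_real, Complex.norm_I, mul_one,
        Real.norm_eq_abs, abs_of_pos Real.pi_pos]
      have := abs_coord_le ξ k
      gcongr
    refine (Finset.sum_le_sum fun k _ => h3 k).trans_eq ?_
    rw [Finset.sum_const, Finset.card_univ, Fintype.card_fin, nsmul_eq_mul, ← mul_assoc]
    congr 1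
    rw [show ((3 : ℕ) : ℝ≥0∞) = ENNReal.ofReal 3 by simp, ← ENNReal.ofReal_mul (by norm_num)]
    ring_nf
  rw [← lerayCLM_apply, ← lerayCLM_apply, ← map_sub, lerayCLM_apply]
  calc ‖leraySymbol ξ (convectionSymbol f ξ - convectionSymbol g ξ)‖ₑ
      ≤ ENNReal.ofReal 2 * ‖convectionSymbol f ξ - convectionSymbol g ξ‖ₑ := by
        rw [← ofReal_norm, ← ofReal_norm, ← ENNReal.ofReal_mul (by norm_num)]
        exact ENNReal.ofReal_le_ofReal (norm_leraySymbol_le _ _)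
    _ ≤ ENNReal.ofReal 2 * (ENNReal.ofReal (6 * Real.pi * ‖ξ‖) * X) := by gcongr
    _ = _ := by
        rw [← mul_assoc, ← ENNReal.ofReal_mul (by norm_num), divConst]
        ring_nf

theorem measurable_duhamelMaj_integrand (ν t : ℝ) (ξ : E3) {A B : ℝ → E3 → ℝ≥0∞}
    (hA : Measurable (Function.uncurry A)) (hB : Measurable (Function.uncurry B)) :
    Measurable fun τ => ENNReal.ofReal (heatSymbol ν (t - τ) ξ) *
      (ENNReal.ofReal (divConst * ‖ξ‖) * conv (A τ) (B τ) ξ) := by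
  have hheat : Measurable fun τ => ENNReal.ofReal (heatSymbol ν (t - τ) ξ) := by
    unfold heatSymbol; fun_prop
  exact hheat.mul
    (((measurable_conv hA hB).comp (measurable_id.prodMk measurable_const)).const_mul _)

/-- The Duhamel term is a quadratic map with an explicit positive majorant. -/
theorem enorm_duhamel_sub_le {ν : ℝ} (hν : 0 ≤ ν) {f g : ℝ → E3 → V3}
    (hf : Measurable (Function.uncurry f)) (hg : Measurable (Function.uncurry g)) {t : ℝ} {ξ : E3}
    (hfi : ConvIntegrable f t ξ) (hgi : ConvIntegrable g t ξ) :
    ‖duhamel ν f t ξ - duhamel ν g t ξ‖ₑ ≤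
      duhamelMaj ν (fun τ η => ‖f τ η - g τ η‖ₑ) (fun τ η => ‖f τ η‖ₑ) 0 t ξ +
      duhamelMaj ν (fun τ η => ‖g τ η‖ₑ) (fun τ η => ‖f τ η - g τ η‖ₑ) 0 t ξ := by
  have hD : Measurable (Function.uncurry fun τ η => ‖f τ η - g τ η‖ₑ) := (hf.sub hg).enorm
  have hfe : Measurable (Function.uncurry fun τ η => ‖f τ η‖ₑ) := hf.enorm
  rw [duhamel, duhamel, ← integral_sub (hfi.integrable_duhamel hν) (hgi.integrable_duhamel hν)]
  refine (enorm_integral_le_lintegral_enorm _).trans ?_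
  rw [duhamelMaj, duhamelMaj, ← lintegral_add_left (measurable_duhamelMaj_integrand ν t ξ hD hfe)]
  refine lintegral_mono_ae ?_
  have h1 : ∀ᵐ τ ∂(volume.restrict (Set.Ioo 0 t)), ∀ k : Fin 3,
      Integrable fun η => f τ (ξ - η) k • f τ η := ae_all_iff.2 fun k => (hfi k).prod_right_ae
  have h2 : ∀ᵐ τ ∂(volume.restrict (Set.Ioo 0 t)), ∀ k : Fin 3,
      Integrable fun η => g τ (ξ - η) k • g τ η := ae_all_iff.2 fun k => (hgi k).prod_right_ae
  filter_upwards [h1, h2] with τ h1 h2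
  rw [← smul_sub, enorm_smul, ← mul_add, ← mul_add]
  refine mul_le_mul' ?_ (enorm_leray_convection_sub_le h1 h2 hf.of_uncurry_left hg.of_uncurry_left)
  rw [← ofReal_norm, Real.norm_of_nonneg (heatSymbol_pos _ _ _).le]

/-- Where the majorant is finite the convolutions in the Duhamel term converge absolutely. At `ξ = 0`
the majorant vanishes identically and gives no information. -/
theorem convIntegrable_of_duhamelMaj {ν : ℝ} (hν : 0 ≤ ν) {f : ℝ → E3 → V3} {F : ℝ → E3 → ℝ≥0∞}
    (hf : Measurable (Function.uncurry f))
    (hfF : ∀ τ η, ‖f τ η‖ₑ ≤ F τ η) {t : ℝ} {ξ : E3} (hξ : ξ ≠ 0)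
    (h : duhamelMaj ν F F 0 t ξ ≠ ∞) : ConvIntegrable f t ξ := by
  intro k
  have hm : Measurable fun z : ℝ × E3 => f z.1 (ξ - z.2) k • f z.1 z.2 := by
    refine Measurable.fun_smul ?_ hf
    have : Measurable fun w : ℝ × E3 => f w.1 (ξ - w.2) :=
      hf.comp (measurable_fst.prodMk (measurable_snd.const_sub ξ))
    fun_prop
  refine ⟨hm.aestronglyMeasurable, ?_⟩
  -- The factors in the majorant that multiply the convolution are bounded below on `(0, t)` by `c > 0`,
  -- since the heat kernel at time `t - τ` is at least the one at time `t`.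
  set c : ℝ≥0∞ := ENNReal.ofReal (heatSymbol ν t ξ) * ENNReal.ofReal (divConst * ‖ξ‖) with hc
  have hξ0 : 0 < ‖ξ‖ := norm_pos_iff.2 hξ
  have hc0 : c ≠ 0 := by
    refine mul_ne_zero ?_ ?_
    · simpa using heatSymbol_pos ν t ξ
    · simpa using mul_pos divConst_pos hξ0
  have hct : c ≠ ∞ := ENNReal.mul_ne_top ENNReal.ofReal_ne_top ENNReal.ofReal_ne_top
  have h1 : c * ∫⁻ τ in Set.Ioo 0 t, conv (F τ) (F τ) ξ < ∞ := by
    refine lt_of_le_of_lt ?_ h.lt_top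
    rw [← lintegral_const_mul' _ _ hct]
    refine setLIntegral_mono' measurableSet_Ioo fun τ hτ => ?_
    rw [hc, mul_assoc]
    gcongr
    unfold heatSymbol
    have h0 := hτ.1
    gcongr
    linarith
  have h2 : ∫⁻ τ in Set.Ioo 0 t, conv (F τ) (F τ) ξ < ∞ :=
    lt_of_le_of_ne le_top fun h0 => by rw [h0, ENNReal.mul_top hc0] at h1; exact lt_irrefl _ h1
  refine lt_of_le_of_lt ?_ h2
  rw [lintegral_prod _ hm.enorm.aemeasurable]
  refine lintegral_mono fun τ => lintegral_mono fun η => ?_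
  simp only [enorm_smul]
  exact mul_le_mul' ((enorm_le_iff_norm_le.2 (norm_coord_le _ k)).trans (hfF _ _)) (hfF _ _)

theorem convectionSymbol_zero_right (f : E3 → V3) : convectionSymbol f 0 = 0 := by
  simp [convectionSymbol]

/-- The method of majorants: if the increment `f - g` is bounded by the increment `F - G` of
majorants, then so is the increment of the Duhamel terms. The bound is written additively, so that
it makes sense, and is trivial, where the majorants are infinite. -/
theorem enorm_duhamel_sub_add_le {ν : ℝ} (hν : 0 ≤ ν) {f g : ℝ → E3 → V3} {F G : ℝ → E3 → ℝ≥0∞}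
    (hf : Measurable (Function.uncurry f)) (hg : Measurable (Function.uncurry g))
    (hG : Measurable (Function.uncurry G))
    (hfg : ∀ τ η, ‖f τ η - g τ η‖ₑ + G τ η ≤ F τ η) (hfF : ∀ τ η, ‖f τ η‖ₑ ≤ F τ η)
    (hgG : ∀ τ η, ‖g τ η‖ₑ ≤ G τ η) (t : ℝ) (ξ : E3) :
    ‖duhamel ν f t ξ - duhamel ν g t ξ‖ₑ + duhamelMaj ν G G 0 t ξ ≤ duhamelMaj ν F F 0 t ξ := by
  rcases eq_or_ne (duhamelMaj ν F F 0 t ξ) ∞ with h | h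
  · rw [h]; exact le_top
  rcases eq_or_ne ξ 0 with rfl | hξ
  · simp [duhamel, duhamelMaj, convectionSymbol_zero_right, ← lerayCLM_apply]
  have hGF : ∀ τ η, G τ η ≤ F τ η := fun τ η => le_add_self.trans (hfg τ η)
  have hfi := convIntegrable_of_duhamelMaj hν hf hfF hξ h
  have hgi := convIntegrable_of_duhamelMaj hν hg (fun τ η => (hgG τ η).trans (hGF τ η)) hξ h
  refine (add_le_add_left (enorm_duhamel_sub_le hν hf hg hfi hgi) _).trans ?_
  have hD : Measurable (Function.uncurry fun τ η => ‖f τ η - g τ η‖ₑ) := (hf.sub hg).enorm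
  have hfe : Measurable (Function.uncurry fun τ η => ‖f τ η‖ₑ) := hf.enorm
  unfold duhamelMaj
  rw [← lintegral_add_left (measurable_duhamelMaj_integrand ν t ξ hD hfe),
    ← lintegral_add_right _ (measurable_duhamelMaj_integrand ν t ξ hG hG)]
  refine lintegral_mono fun τ => ?_
  dsimp only
  rw [← mul_add, ← mul_add, ← mul_add, ← mul_add]
  gcongr
  have hc : ∀ {A B : ℝ → E3 → ℝ≥0∞}, Measurable (Function.uncurry A) →
      Measurable (Function.uncurry B) → Measurable fun η => A τ (ξ - η) * B τ η := fun hA hB =>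
    (hA.of_uncurry_left.comp (measurable_id.const_sub ξ)).mul hB.of_uncurry_left
  unfold conv
  rw [← lintegral_add_left (hc hD hfe), ← lintegral_add_right _ (hc hG hG)]
  refine lintegral_mono fun η => ?_
  dsimp only
  calc ‖f τ (ξ - η) - g τ (ξ - η)‖ₑ * ‖f τ η‖ₑ + ‖g τ (ξ - η)‖ₑ * ‖f τ η - g τ η‖ₑ +
        G τ (ξ - η) * G τ η
      ≤ ‖f τ (ξ - η) - g τ (ξ - η)‖ₑ * F τ η + G τ (ξ - η) * ‖f τ η - g τ η‖ₑ +
        G τ (ξ - η) * G τ η := by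
        gcongr
        · exact hfF _ _
        · exact hgG _ _
    _ = ‖f τ (ξ - η) - g τ (ξ - η)‖ₑ * F τ η + G τ (ξ - η) * (‖f τ η - g τ η‖ₑ + G τ η) := by ring
    _ ≤ ‖f τ (ξ - η) - g τ (ξ - η)‖ₑ * F τ η + G τ (ξ - η) * F τ η := by gcongr; exact hfg _ _
    _ = (‖f τ (ξ - η) - g τ (ξ - η)‖ₑ + G τ (ξ - η)) * F τ η := by ring
    _ ≤ _ := by gcongr; exact hfg _ _


/-! ### The fixed point by the method of majorants -/

theorem iSup_mul_iSup_of_monotone {f g : ℕ → ℝ≥0∞} (hf : Monotone f) (hg : Monotone g) :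
    (⨆ n, f n) * ⨆ n, g n = ⨆ n, f n * g n := by
  refine le_antisymm ?_ (iSup_le fun n => mul_le_mul' (le_iSup f n) (le_iSup g n))
  simp_rw [ENNReal.iSup_mul, ENNReal.mul_iSup]
  exact iSup_le fun i => iSup_le fun j => le_iSup_of_le (max i j)
    (mul_le_mul' (hf (le_max_left i j)) (hg (le_max_right i j)))

theorem duhamelMaj_mono {ν : ℝ} {F G F' G' : ℝ → E3 → ℝ≥0∞} (hF : ∀ t ξ, F t ξ ≤ F' t ξ)
    (hG : ∀ t ξ, G t ξ ≤ G' t ξ) (a t : ℝ) (ξ : E3) :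
    duhamelMaj ν F G a t ξ ≤ duhamelMaj ν F' G' a t ξ := by
  refine lintegral_mono fun τ => ?_
  dsimp only [conv]
  gcongr
  · exact hF _ _
  · exact hG _ _

/-- The Fatou property of the space-time norm. -/
theorem slabNorm_iSup_le (hφ : IsLittlewoodPaley φ) {s a b : ℝ} {p q : ℝ≥0∞} (hp1 : 1 ≤ p)
    (hp : p ≠ ∞) (hq : 1 ≤ q) {F : ℕ → ℝ → E3 → ℝ≥0∞}
    (hF : ∀ n, Measurable (Function.uncurry (F n))) (hm : Monotone F) :
    slabNorm φ s p q a b (fun t ξ => ⨆ n, F n t ξ) ≤ ⨆ n, slabNorm φ s p q a b (F n) := by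
  have hslab : Monotone fun n => slab φ s p a b (F n) := fun m n h j =>
    slab_mono j (ae_of_all _ fun t => ae_of_all _ fun ξ => hm h t ξ)
  refine le_trans (seqNorm_mono hq fun j => ?_) (seqNorm_iSup_le hq hslab)
  have hbm : ∀ n, Measurable fun t => blockNorm φ p j (F n t) := fun n =>
    measurable_blockNorm hφ hp1 hp j (hF n)
  have hbmono : Monotone fun n t => blockNorm φ p j (F n t) := fun m n h t =>
    blockNorm_mono (ae_of_all _ fun ξ => hm h t ξ)
  have h1 : ∀ t, blockNorm φ p j (fun ξ => ⨆ n, F n t ξ) ≤ ⨆ n, blockNorm φ p j (F n t) := fun t =>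
    blockNorm_iSup_le hφ (fun n => (hF n).of_uncurry_left) fun m n h ξ => hm h t ξ
  unfold slab
  rw [← ENNReal.mul_iSup, ← ENNReal.iSup_add_iSup_of_monotone, ← ENNReal.mul_iSup]
  · refine mul_le_mul_right (add_le_add ?_ (mul_le_mul_right ?_ _)) _
    · exact (eLpNorm_mono_ennreal (ae_of_all _ h1)).trans (eLpNorm_iSup_le hbm hbmono)
    · rw [← lintegral_iSup hbm hbmono]
      exact lintegral_mono h1
  · exact fun m n h => eLpNorm_mono_ennreal (ae_of_all _ (hbmono h))
  · exact fun m n h => mul_le_mul_right (lintegral_mono (hbmono h)) _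

/-- The Picard iterates of the scalar majorant equation. -/
def majIter (ν : ℝ) (u₀ : E3 → V3) : ℕ → ℝ → E3 → ℝ≥0∞
  | 0 => fun _ _ => 0
  | n + 1 => fun t ξ => ENNReal.ofReal (heatSymbol ν t ξ) * ‖u₀ ξ‖ₑ +
      duhamelMaj ν (majIter ν u₀ n) (majIter ν u₀ n) 0 t ξ

/-- The Picard iterates of the Navier-Stokes equations in Fourier variables. -/
def solIter (ν : ℝ) (u₀ : E3 → V3) : ℕ → ℝ → E3 → V3
  | 0 => fun _ _ => 0
  | n + 1 => fun t ξ => heatSymbol ν t ξ • u₀ ξ - duhamel ν (solIter ν u₀ n) t ξ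

/-- The minimal solution of the scalar majorant equation; it may take the value `∞`. -/
def maj (ν : ℝ) (u₀ : E3 → V3) (t : ℝ) (ξ : E3) : ℝ≥0∞ := ⨆ n, majIter ν u₀ n t ξ

open Classical in
/-- The Fourier transform of the solution of the Navier-Stokes equations: the limit of the Picard
iterates at the points where the majorant is finite, and `0` elsewhere. -/
def sol (ν : ℝ) (u₀ : E3 → V3) (t : ℝ) (ξ : E3) : V3 :=
  if maj ν u₀ t ξ = ∞ then 0 else limUnder atTop fun n => solIter ν u₀ n t ξ

section

variable {ν : ℝ} {u₀ : E3 → V3}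

theorem measurable_heat_mul {β : Type*} [MeasurableSpace β] {f : β → ℝ≥0∞} (hf : Measurable f)
    {T : β → ℝ} {X : β → E3} (hT : Measurable T) (hX : Measurable X) :
    Measurable fun z => ENNReal.ofReal (heatSymbol ν (T z) (X z)) * f z :=
  ((measurable_heatSymbol ν).comp (hT.prodMk hX)).ennreal_ofReal.mul hf

theorem measurable_majIter (hu : Measurable u₀) :
    ∀ n, Measurable (Function.uncurry (majIter ν u₀ n))
  | 0 => measurable_const
  | n + 1 => (measurable_heat_mul (hu.comp measurable_snd).enorm measurable_fst measurable_snd).add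
      (measurable_duhamelMaj ν 0 (measurable_majIter hu n) (measurable_majIter hu n))

theorem measurable_solIter (hu : Measurable u₀) :
    ∀ n, Measurable (Function.uncurry (solIter ν u₀ n))
  | 0 => measurable_const
  | n + 1 => ((measurable_heatSymbol ν).fun_smul (hu.comp measurable_snd)).sub
      (measurable_duhamel ν (measurable_solIter hu n))

theorem majIter_mono : Monotone (majIter ν u₀) := by
  refine monotone_nat_of_le_succ fun n => ?_
  induction n with
  | zero => exact fun t ξ => zero_le
  | succ n ih =>
    intro t ξ
    exact add_le_add le_rfl (duhamelMaj_mono ih ih 0 t ξ)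

theorem measurable_maj (hu : Measurable u₀) : Measurable (Function.uncurry (maj ν u₀)) :=
  Measurable.iSup fun n => measurable_majIter hu n

theorem majIter_le_maj (n : ℕ) (t : ℝ) (ξ : E3) : majIter ν u₀ n t ξ ≤ maj ν u₀ t ξ :=
  le_iSup (fun n => majIter ν u₀ n t ξ) n

theorem tendsto_majIter (t : ℝ) (ξ : E3) :
    Tendsto (fun n => majIter ν u₀ n t ξ) atTop (𝓝 (maj ν u₀ t ξ)) :=
  tendsto_atTop_iSup fun _ _ h => majIter_mono h t ξ

theorem duhamelMaj_maj (hu : Measurable u₀) (t : ℝ) (ξ : E3) :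
    duhamelMaj ν (maj ν u₀) (maj ν u₀) 0 t ξ =
      ⨆ n, duhamelMaj ν (majIter ν u₀ n) (majIter ν u₀ n) 0 t ξ := by
  have hm := measurable_majIter (ν := ν) hu
  have h1 : ∀ τ, conv (maj ν u₀ τ) (maj ν u₀ τ) ξ =
      ⨆ n, conv (majIter ν u₀ n τ) (majIter ν u₀ n τ) ξ := by
    intro τ
    unfold conv
    rw [← lintegral_iSup]
    · refine lintegral_congr fun η => ?_
      simp only [maj]
      rw [iSup_mul_iSup_of_monotone (fun m n h => majIter_mono h τ _)
        (fun m n h => majIter_mono h τ _)]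
    · exact fun n => ((hm n).of_uncurry_left.comp (measurable_id.const_sub ξ)).mul
        (hm n).of_uncurry_left
    · exact fun m n h η => mul_le_mul' (majIter_mono h τ _) (majIter_mono h τ _)
  unfold duhamelMaj
  rw [← lintegral_iSup]
  · refine lintegral_congr fun τ => ?_
    rw [h1, ENNReal.mul_iSup, ENNReal.mul_iSup]
  · exact fun n => measurable_duhamelMaj_integrand ν t ξ (hm n) (hm n)
  · intro m n h τ
    dsimp only [conv]
    gcongr
    · exact majIter_mono h τ _
    · exact majIter_mono h τ _

/-- The majorant equation. -/
theorem maj_eq (hu : Measurable u₀) (t : ℝ) (ξ : E3) :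
    maj ν u₀ t ξ = ENNReal.ofReal (heatSymbol ν t ξ) * ‖u₀ ξ‖ₑ +
      duhamelMaj ν (maj ν u₀) (maj ν u₀) 0 t ξ := by
  have h1 : Tendsto (fun n => majIter ν u₀ (n + 1) t ξ) atTop
      (𝓝 (ENNReal.ofReal (heatSymbol ν t ξ) * ‖u₀ ξ‖ₑ +
        duhamelMaj ν (maj ν u₀) (maj ν u₀) 0 t ξ)) := by
    refine Tendsto.const_add _ ?_
    rw [duhamelMaj_maj hu]
    exact tendsto_atTop_iSup fun m n h =>
      duhamelMaj_mono (fun t ξ => majIter_mono h t ξ) (fun t ξ => majIter_mono h t ξ) 0 t ξ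
  exact tendsto_nhds_unique ((tendsto_add_atTop_iff_nat 1).2 (tendsto_majIter t ξ)) h1

/-- Consecutive increments of the Picard iterates are dominated by those of the majorants. The bound
for the iterates themselves is needed at each step of the induction. -/
theorem solIter_succ_sub_le (hν : 0 ≤ ν) (hu : Measurable u₀) (n : ℕ) :
    (∀ t ξ, ‖solIter ν u₀ (n + 1) t ξ - solIter ν u₀ n t ξ‖ₑ + majIter ν u₀ n t ξ ≤
      majIter ν u₀ (n + 1) t ξ) ∧ ∀ t ξ, ‖solIter ν u₀ n t ξ‖ₑ ≤ majIter ν u₀ n t ξ := by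
  induction n with
  | zero =>
    refine ⟨fun t ξ => ?_, fun t ξ => by simp [solIter]⟩
    have h0 : duhamel ν (solIter ν u₀ 0) t ξ = 0 := by
      simp [duhamel, solIter, convectionSymbol, ← lerayCLM_apply]
    have h1 : solIter ν u₀ (0 + 1) t ξ - solIter ν u₀ 0 t ξ = heatSymbol ν t ξ • u₀ ξ := by
      change heatSymbol ν t ξ • u₀ ξ - duhamel ν (solIter ν u₀ 0) t ξ - 0 = _
      rw [h0, sub_zero, sub_zero]
    rw [h1, enorm_smul, ← ofReal_norm, Real.norm_of_nonneg (heatSymbol_pos _ _ _).le]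
    exact add_le_add le_rfl zero_le
  | succ n ih =>
    have hle : ∀ t ξ, ‖solIter ν u₀ (n + 1) t ξ‖ₑ ≤ majIter ν u₀ (n + 1) t ξ := fun t ξ => by
      calc ‖solIter ν u₀ (n + 1) t ξ‖ₑ
          = ‖(solIter ν u₀ (n + 1) t ξ - solIter ν u₀ n t ξ) + solIter ν u₀ n t ξ‖ₑ := by simp
        _ ≤ _ := (enorm_add_le _ _).trans
            ((add_le_add le_rfl (ih.2 t ξ)).trans (ih.1 t ξ))
    refine ⟨fun t ξ => ?_, hle⟩
    have h1 := enorm_duhamel_sub_add_le hν (measurable_solIter hu (n + 1))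
      (measurable_solIter hu n) (measurable_majIter hu n) ih.1 hle ih.2 t ξ
    have h2 : solIter ν u₀ (n + 1 + 1) t ξ - solIter ν u₀ (n + 1) t ξ =
        -(duhamel ν (solIter ν u₀ (n + 1)) t ξ - duhamel ν (solIter ν u₀ n) t ξ) := by
      simp only [solIter]; abel
    rw [h2, enorm_neg, majIter, majIter, add_left_comm]
    exact add_le_add le_rfl h1

theorem solIter_sub_le (hν : 0 ≤ ν) (hu : Measurable u₀) (n k : ℕ) (t : ℝ) (ξ : E3) :
    ‖solIter ν u₀ (n + k) t ξ - solIter ν u₀ n t ξ‖ₑ + majIter ν u₀ n t ξ ≤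
      majIter ν u₀ (n + k) t ξ := by
  induction k with
  | zero => simp
  | succ k ih =>
    refine le_trans ?_ ((solIter_succ_sub_le hν hu (n + k)).1 t ξ)
    refine le_trans ?_ (add_le_add le_rfl ih)
    refine (add_le_add_left (le_trans (le_of_eq ?_) (enorm_add_le _ _)) _).trans_eq (add_assoc _ _ _)
    rw [add_assoc n k 1]; congr 1; abel

theorem tendsto_solIter (hν : 0 ≤ ν) (hu : Measurable u₀) {t : ℝ} {ξ : E3}
    (h : maj ν u₀ t ξ ≠ ∞) :
    Tendsto (fun n => solIter ν u₀ n t ξ) atTop (𝓝 (sol ν u₀ t ξ)) := by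
  rw [sol, if_neg h]
  refine CauchySeq.tendsto_limUnder ?_
  refine cauchySeq_of_edist_le_of_tsum_ne_top
    (fun n => ‖solIter ν u₀ (n + 1) t ξ - solIter ν u₀ n t ξ‖ₑ) (fun n => ?_) ?_
  · rw [edist_comm, edist_eq_enorm_sub]
  · refine ne_top_of_le_ne_top h ?_
    rw [ENNReal.tsum_eq_iSup_nat]
    refine iSup_le fun N => le_trans ?_ (majIter_le_maj N t ξ)
    induction N with
    | zero => simp
    | succ N ih =>
      rw [Finset.sum_range_succ, add_comm]
      exact (add_le_add le_rfl ih).trans ((solIter_succ_sub_le hν hu N).1 t ξ)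

theorem measurable_sol (hν : 0 ≤ ν) (hu : Measurable u₀) :
    Measurable (Function.uncurry (sol ν u₀)) := by
  have hS : MeasurableSet {z : ℝ × E3 | Function.uncurry (maj ν u₀) z ≠ ∞} :=
    (measurable_maj hu (measurableSet_singleton ∞)).compl
  refine measurable_of_tendsto_metrizable (f := fun n => {z : ℝ × E3 |
    Function.uncurry (maj ν u₀) z ≠ ∞}.indicator (Function.uncurry (solIter ν u₀ n)))
    (fun n => (measurable_solIter hu n).indicator hS) (tendsto_pi_nhds.2 fun z => ?_)
  by_cases hz : Function.uncurry (maj ν u₀) z ≠ ∞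
  · simp only [Set.indicator_of_mem (show z ∈ {z : ℝ × E3 |
      Function.uncurry (maj ν u₀) z ≠ ∞} from hz)]
    exact tendsto_solIter hν hu hz
  · simp only [Set.indicator_of_notMem (show z ∉ {z : ℝ × E3 |
      Function.uncurry (maj ν u₀) z ≠ ∞} from hz)]
    have : Function.uncurry (sol ν u₀) z = 0 := by
      have hz' : maj ν u₀ z.1 z.2 = ∞ := not_not.1 hz
      simp only [Function.uncurry, sol, if_pos hz']
    rw [this]
    exact tendsto_const_nhds

/-- The distance from the `n`-th iterate to the limit is dominated by the tail of the majorants. -/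
theorem enorm_sol_sub_add_le (hν : 0 ≤ ν) (hu : Measurable u₀) (n : ℕ) (t : ℝ) (ξ : E3) :
    ‖sol ν u₀ t ξ - solIter ν u₀ n t ξ‖ₑ + majIter ν u₀ n t ξ ≤ maj ν u₀ t ξ := by
  rcases eq_or_ne (maj ν u₀ t ξ) ∞ with h | h
  · rw [h]; exact le_top
  have h1 : Tendsto (fun k => ‖solIter ν u₀ k t ξ - solIter ν u₀ n t ξ‖ₑ + majIter ν u₀ n t ξ) atTop
      (𝓝 (‖sol ν u₀ t ξ - solIter ν u₀ n t ξ‖ₑ + majIter ν u₀ n t ξ)) :=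
    (((tendsto_solIter hν hu h).sub_const _).enorm).add_const _
  refine le_of_tendsto h1 ?_
  filter_upwards [eventually_ge_atTop n] with k hk
  obtain ⟨m, rfl⟩ := Nat.exists_eq_add_of_le hk
  exact (solIter_sub_le hν hu n m t ξ).trans (majIter_le_maj _ t ξ)

theorem enorm_sol_le (hν : 0 ≤ ν) (hu : Measurable u₀) (t : ℝ) (ξ : E3) :
    ‖sol ν u₀ t ξ‖ₑ ≤ maj ν u₀ t ξ := by
  simpa [solIter, majIter] using enorm_sol_sub_add_le hν hu 0 t ξ

/-- The limit solves the Duhamel equation wherever the majorant is finite. -/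
theorem sol_eq (hν : 0 ≤ ν) (hu : Measurable u₀) {t : ℝ} {ξ : E3} (h : maj ν u₀ t ξ ≠ ∞) :
    sol ν u₀ t ξ = heatSymbol ν t ξ • u₀ ξ - duhamel ν (sol ν u₀) t ξ := by
  refine tendsto_nhds_unique ((tendsto_add_atTop_iff_nat 1).2 (tendsto_solIter hν hu h)) ?_
  rw [tendsto_iff_edist_tendsto_0]
  have h1 : ∀ n, edist (solIter ν u₀ (n + 1) t ξ)
      (heatSymbol ν t ξ • u₀ ξ - duhamel ν (sol ν u₀) t ξ) ≤
      maj ν u₀ t ξ - majIter ν u₀ (n + 1) t ξ := by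
    intro n
    have h2 := enorm_duhamel_sub_add_le hν (measurable_sol hν hu) (measurable_solIter hu n)
      (measurable_majIter hu n) (enorm_sol_sub_add_le hν hu n) (enorm_sol_le hν hu)
      (solIter_succ_sub_le hν hu n).2 t ξ
    have h3 : edist (solIter ν u₀ (n + 1) t ξ)
        (heatSymbol ν t ξ • u₀ ξ - duhamel ν (sol ν u₀) t ξ) =
        ‖duhamel ν (sol ν u₀) t ξ - duhamel ν (solIter ν u₀ n) t ξ‖ₑ := by
      rw [edist_eq_enorm_sub, solIter, sub_sub_sub_cancel_left]
    rw [h3]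
    refine ENNReal.le_sub_of_add_le_right (ne_top_of_le_ne_top h (majIter_le_maj _ t ξ)) ?_
    rw [maj_eq hu, majIter, add_left_comm]
    exact add_le_add le_rfl h2
  refine tendsto_of_tendsto_of_tendsto_of_le_of_le tendsto_const_nhds ?_ (fun _ => zero_le) h1
  have h4 := ENNReal.Tendsto.sub (tendsto_const_nhds (x := maj ν u₀ t ξ) (f := atTop (α := ℕ)))
    ((tendsto_add_atTop_iff_nat 1).2 (tendsto_majIter (ν := ν) (u₀ := u₀) t ξ)) (Or.inl h)
  simpa using h4

theorem convIntegrable_sol (hν : 0 ≤ ν) (hu : Measurable u₀) {t : ℝ} {ξ : E3} (hξ : ξ ≠ 0)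
    (h : maj ν u₀ t ξ ≠ ∞) : ConvIntegrable (sol ν u₀) t ξ := by
  refine convIntegrable_of_duhamelMaj hν (measurable_sol hν hu) (enorm_sol_le hν hu) hξ ?_
  rw [maj_eq hu] at h
  exact (ENNReal.add_ne_top.1 h).2

/-- The bound for the majorant: if the quadratic term is small, the iterates stay in a ball. -/
theorem slabNorm_maj_le (hφ : IsLittlewoodPaley φ) {p q : ℝ≥0∞} {s b : ℝ} (hp1 : 1 ≤ p)
    (hp : p ≠ ∞) (hq : 1 ≤ q) (hu : Measurable u₀) {R K : ℝ≥0∞}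
    (hlin : slabNorm φ s p q 0 b (fun t ξ => ENNReal.ofReal (heatSymbol ν t ξ) * ‖u₀ ξ‖ₑ) ≤ R)
    (hbil : ∀ f : ℝ → E3 → ℝ≥0∞, Measurable (Function.uncurry f) →
      slabNorm φ s p q 0 b (duhamelMaj ν f f 0) ≤
        K * slabNorm φ s p q 0 b f * slabNorm φ s p q 0 b f)
    (hsmall : K * (2 * R) * 2 ≤ 1) :
    slabNorm φ s p q 0 b (maj ν u₀) ≤ 2 * R := by
  have hm := measurable_majIter (ν := ν) hu
  refine (slabNorm_iSup_le hφ hp1 hp hq hm majIter_mono).trans (iSup_le fun n => ?_)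
  induction n with
  | zero =>
    have : slabNorm φ s p q 0 b (majIter ν u₀ 0) = 0 := by
      have h0 : slab φ s p 0 b (majIter ν u₀ 0) = fun _ => 0 := by
        funext j
        simp only [slab, majIter, blockNorm, mul_zero, eLpNorm_zero', lintegral_zero, add_zero]
      rw [slabNorm, h0, seqNorm_zero hq]
    rw [this]; exact zero_le
  | succ n ih =>
    have h0 : Measurable (Function.uncurry fun t ξ =>
        ENNReal.ofReal (heatSymbol ν t ξ) * ‖u₀ ξ‖ₑ) :=
      measurable_heat_mul (hu.comp measurable_snd).enorm measurable_fst measurable_snd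
    refine (slabNorm_add_le hφ hp1 hp hq h0 (measurable_duhamelMaj ν 0 (hm n) (hm n))).trans ?_
    rw [two_mul]
    refine add_le_add hlin ((hbil _ (hm n)).trans ?_)
    calc K * slabNorm φ s p q 0 b (majIter ν u₀ n) * slabNorm φ s p q 0 b (majIter ν u₀ n)
        ≤ K * (2 * R) * (2 * R) := by gcongr
      _ = K * (2 * R) * 2 * R := by ring
      _ ≤ 1 * R := by gcongr
      _ = R := one_mul R

end


/-! ### Reality and incompressibility in Fourier variables -/

/-- Complex conjugation of the values of a vector field. -/
def conjV : V3 ≃ₗᵢ[ℝ] V3 := LinearIsometryEquiv.piLpCongrRight 2 fun _ : Fin 3 => Complex.conjLIE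

theorem conjV_apply (v : V3) (i : Fin 3) : conjV v i = (starRingEnd ℂ) (v i) := rfl

theorem conjV_smul (c : ℂ) (v : V3) : conjV (c • v) = (starRingEnd ℂ) c • conjV v := by
  ext i; simp [conjV_apply]

theorem conjV_integral {α : Type*} [MeasurableSpace α] (μ : Measure α) (f : α → V3) :
    ∫ x, conjV (f x) ∂μ = conjV (∫ x, f x ∂μ) :=
  conjV.toContinuousLinearEquiv.integral_comp_comm f

theorem leraySymbol_neg_conjV (ξ : E3) (v : V3) :
    leraySymbol (-ξ) (conjV v) = conjV (leraySymbol ξ v) := by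
  ext i
  simp [leraySymbol, conjV_apply]

theorem convectionSymbol_neg {g : E3 → V3} (hg : ∀ η, g (-η) = conjV (g η)) (ξ : E3) :
    convectionSymbol g (-ξ) = conjV (convectionSymbol g ξ) := by
  unfold convectionSymbol
  rw [map_sum]
  refine Finset.sum_congr rfl fun k _ => ?_
  have h2 : ∫ η, g (-ξ - η) k • g η = ∫ η, conjV (g (ξ - η) k • g η) := by
    rw [← integral_neg_eq_self (μ := volume)]
    refine integral_congr_ae (ae_of_all _ fun η => ?_)
    have h3 : -ξ - -η = -(ξ - η) := by abel
    dsimp only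
    rw [conjV_smul, ← conjV_apply, ← hg, ← hg, h3]
  rw [conjV_smul, ← conjV_integral, h2]
  congr 1
  simp [Complex.conj_ofNat]

theorem heatSymbol_neg (ν t : ℝ) (ξ : E3) : heatSymbol ν t (-ξ) = heatSymbol ν t ξ := by
  simp [heatSymbol]

theorem duhamel_neg (ν : ℝ) {f : ℝ → E3 → V3} (hf : ∀ τ η, f τ (-η) = conjV (f τ η)) (t : ℝ)
    (ξ : E3) : duhamel ν f t (-ξ) = conjV (duhamel ν f t ξ) := by
  unfold duhamel
  rw [← conjV_integral]
  refine integral_congr_ae (ae_of_all _ fun τ => ?_)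
  dsimp only
  rw [heatSymbol_neg, convectionSymbol_neg (hf τ), leraySymbol_neg_conjV, map_smul]

theorem solIter_neg {ν : ℝ} {u₀ : E3 → V3} (hu : ∀ ξ, u₀ (-ξ) = conjV (u₀ ξ)) (n : ℕ) (t : ℝ)
    (ξ : E3) : solIter ν u₀ n t (-ξ) = conjV (solIter ν u₀ n t ξ) := by
  induction n generalizing t ξ with
  | zero => simp [solIter]
  | succ n ih =>
    change heatSymbol ν t (-ξ) • u₀ (-ξ) - duhamel ν (solIter ν u₀ n) t (-ξ) =
      conjV (heatSymbol ν t ξ • u₀ ξ - duhamel ν (solIter ν u₀ n) t ξ)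
    rw [duhamel_neg ν ih, heatSymbol_neg, hu, map_sub, map_smul]

theorem sol_neg {ν : ℝ} (hν : 0 ≤ ν) {u₀ : E3 → V3} (hum : Measurable u₀)
    (hu : ∀ ξ, u₀ (-ξ) = conjV (u₀ ξ)) {t : ℝ} {ξ : E3} (h : maj ν u₀ t ξ ≠ ∞)
    (h' : maj ν u₀ t (-ξ) ≠ ∞) : sol ν u₀ t (-ξ) = conjV (sol ν u₀ t ξ) := by
  refine tendsto_nhds_unique (tendsto_solIter hν hum h') ?_
  simp_rw [solIter_neg hu]
  exact (conjV.continuous.tendsto _).comp (tendsto_solIter hν hum h)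

theorem sum_coord_eq_inner (ξ : E3) (v : V3) : ∑ k, (ξ k : ℂ) * v k = innerSL ℂ (toV ξ) v := by
  simp [toV, PiLp.inner_apply, mul_comm]

theorem sum_coord_mul_duhamel {ν : ℝ} (hν : 0 ≤ ν) {f : ℝ → E3 → V3} {t : ℝ} {ξ : E3} (hξ : ξ ≠ 0)
    (h : ConvIntegrable f t ξ) : ∑ k, (ξ k : ℂ) * duhamel ν f t ξ k = 0 := by
  rw [sum_coord_eq_inner, duhamel,
    ← ContinuousLinearMap.integral_comp_comm _ (h.integrable_duhamel hν)]
  refine integral_eq_zero_of_ae (ae_of_all _ fun τ => ?_)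
  dsimp only
  rw [← sum_coord_eq_inner]
  have := sum_coord_mul_leraySymbol hξ (convectionSymbol (f τ) ξ)
  simp only [PiLp.smul_apply, Complex.real_smul, mul_left_comm, ← Finset.mul_sum, this]
  simp

theorem sum_coord_mul_sol {ν : ℝ} (hν : 0 ≤ ν) {u₀ : E3 → V3} (hum : Measurable u₀)
    (hu : ∀ ξ, ∑ k, (ξ k : ℂ) * u₀ ξ k = 0) {t : ℝ} {ξ : E3} (hξ : ξ ≠ 0)
    (h : maj ν u₀ t ξ ≠ ∞) : ∑ k, (ξ k : ℂ) * sol ν u₀ t ξ k = 0 := by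
  have h1 := sum_coord_mul_duhamel hν hξ (convIntegrable_sol hν hum hξ h)
  have h2 := hu ξ
  rw [sum_coord_eq_inner] at h1 h2 ⊢
  rw [sol_eq hν hum h, map_sub, h1, ← Complex.coe_smul, map_smul, h2]
  simp

/-! ### Increments in time -/

/-- At times `≥ η` the heat kernel is Lipschitz in time, uniformly in the frequency, by
`x exp (-x t) ≤ 1 / t`. -/
theorem abs_heatSymbol_sub_le {ν : ℝ} (hν : 0 ≤ ν) {η t t' : ℝ} (hη : 0 < η) (ht : η ≤ t)
    (htt' : t ≤ t') (ξ : E3) : |heatSymbol ν t' ξ - heatSymbol ν t ξ| ≤ (t' - t) / η := by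
  set x := 4 * Real.pi ^ 2 * ν * ‖ξ‖ ^ 2 with hx
  have hx0 : 0 ≤ x := by positivity
  have e1 : ∀ r, heatSymbol ν r ξ = Real.exp (-(x * r)) := fun r => by
    rw [heatSymbol, hx]; ring_nf
  rw [e1, e1]
  have h1 : Real.exp (-(x * t')) = Real.exp (-(x * t)) * Real.exp (-(x * (t' - t))) := by
    rw [← Real.exp_add]; ring_nf
  have h2 : 1 - x * (t' - t) ≤ Real.exp (-(x * (t' - t))) := by
    linarith [Real.add_one_le_exp (-(x * (t' - t)))]
  have h3 : Real.exp (-(x * (t' - t))) ≤ 1 := by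
    rw [Real.exp_le_one_iff, neg_nonpos]; exact mul_nonneg hx0 (by linarith)
  have h4 : Real.exp (-(x * t)) * (x * t) ≤ 1 := by
    rw [Real.exp_neg, inv_mul_le_iff₀ (Real.exp_pos _), mul_one]
    linarith [Real.add_one_le_exp (x * t)]
  have h5 := Real.exp_pos (-(x * t))
  rw [h1, abs_sub_comm, abs_of_nonneg (by nlinarith), le_div_iff₀ hη]
  have h6 : Real.exp (-(x * t)) - Real.exp (-(x * t)) * Real.exp (-(x * (t' - t))) ≤
      Real.exp (-(x * t)) * (x * (t' - t)) := by nlinarith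
  have h7 : 0 ≤ Real.exp (-(x * t)) * (x * (t' - t)) :=
    mul_nonneg h5.le (mul_nonneg hx0 (by linarith))
  calc _ ≤ Real.exp (-(x * t)) * (x * (t' - t)) * η := by gcongr
    _ ≤ Real.exp (-(x * t)) * (x * (t' - t)) * t := by gcongr
    _ = Real.exp (-(x * t)) * (x * t) * (t' - t) := by ring
    _ ≤ 1 * (t' - t) := mul_le_mul_of_nonneg_right h4 (by linarith)
    _ = t' - t := one_mul _

theorem enorm_leray_convection_le {f : E3 → V3} {ξ : E3}
    (hf : ∀ k : Fin 3, Integrable fun η => f (ξ - η) k • f η) (hfm : Measurable f) :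
    ‖leraySymbol ξ (convectionSymbol f ξ)‖ₑ ≤
      ENNReal.ofReal (divConst * ‖ξ‖) * conv (fun η => ‖f η‖ₑ) (fun η => ‖f η‖ₑ) ξ := by
  have h := enorm_leray_convection_sub_le (f := f) (g := fun _ => 0) hf (by simp) hfm
    measurable_const
  have h0 : convectionSymbol (fun _ => (0 : V3)) ξ = 0 := by simp [convectionSymbol]
  have h1 : leraySymbol ξ 0 = 0 := map_zero (lerayCLM ξ)
  simpa [h0, h1, conv] using h

/-- The increment of the Duhamel term between two times `t ≤ t'`: away from the diagonal the heat
kernel is Lipschitz in time, and near the diagonal the integral is small. -/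
theorem enorm_duhamel_increment_le {ν : ℝ} (hν : 0 ≤ ν) {f : ℝ → E3 → V3} {F : ℝ → E3 → ℝ≥0∞}
    (hf : Measurable (Function.uncurry f)) (hF : Measurable (Function.uncurry F))
    (hfF : ∀ τ η, ‖f τ η‖ₑ ≤ F τ η) {η t t' : ℝ} (hη : 0 < η) (htt' : t ≤ t') {ξ : E3}
    (hft : ConvIntegrable f t ξ) (hft' : ConvIntegrable f t' ξ) :
    ‖duhamel ν f t' ξ - duhamel ν f t ξ‖ₑ ≤
      ENNReal.ofReal ((t' - t) / η) * fluxMaj F F 0 t' ξ + fluxMaj F F (t - η) t' ξ := by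
  set c : ℝ → V3 := fun τ => leraySymbol ξ (convectionSymbol (f τ) ξ) with hc
  set n : ℝ → ℝ≥0∞ := fun τ => ENNReal.ofReal (divConst * ‖ξ‖) * conv (F τ) (F τ) ξ with hn
  have hnm : Measurable n :=
    ((measurable_conv hF hF).comp (measurable_id.prodMk measurable_const)).const_mul _
  have hcn : ∀ᵐ τ ∂(volume.restrict (Set.Ioo 0 t')), ‖c τ‖ₑ ≤ n τ := by
    have h1 : ∀ᵐ τ ∂(volume.restrict (Set.Ioo 0 t')), ∀ k : Fin 3,
        Integrable fun η => f τ (ξ - η) k • f τ η := ae_all_iff.2 fun k => (hft' k).prod_right_ae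
    filter_upwards [h1] with τ h1
    refine (enorm_leray_convection_le h1 hf.of_uncurry_left).trans ?_
    simp only [hn, conv]
    gcongr
    · exact hfF _ _
    · exact hfF _ _
  have hsub : Set.Ioo 0 t ⊆ Set.Ioo 0 t' := Set.Ioo_subset_Ioo_right htt'
  have e1 : duhamel ν f t ξ =
      ∫ τ in Set.Ioo 0 t', (Set.Ioo 0 t).indicator (fun τ => heatSymbol ν (t - τ) ξ • c τ) τ := by
    rw [integral_indicator measurableSet_Ioo, Measure.restrict_restrict measurableSet_Ioo,
      Set.inter_eq_left.2 hsub]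
    rfl
  have hint : Integrable ((Set.Ioo 0 t).indicator fun τ => heatSymbol ν (t - τ) ξ • c τ)
      (volume.restrict (Set.Ioo 0 t')) := by
    rw [integrable_indicator_iff measurableSet_Ioo, IntegrableOn,
      Measure.restrict_restrict measurableSet_Ioo, Set.inter_eq_left.2 hsub]
    exact hft.integrable_duhamel hν
  rw [e1, duhamel, ← integral_sub (hft'.integrable_duhamel hν) hint]
  refine (enorm_integral_le_lintegral_enorm _).trans ?_
  have h2 : ∀ᵐ τ ∂(volume.restrict (Set.Ioo 0 t')),
      ‖heatSymbol ν (t' - τ) ξ • c τ -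
        (Set.Ioo 0 t).indicator (fun τ => heatSymbol ν (t - τ) ξ • c τ) τ‖ₑ ≤
      ENNReal.ofReal ((t' - t) / η) * n τ + (Set.Ioo (t - η) t').indicator n τ := by
    filter_upwards [hcn, ae_restrict_mem measurableSet_Ioo] with τ h1 hτ
    have hb1 := heatSymbol_le_one hν (show 0 ≤ t' - τ by linarith [hτ.2]) ξ
    have hp1 := heatSymbol_pos ν (t' - τ) ξ
    by_cases hτt : τ < t
    · rw [Set.indicator_of_mem (show τ ∈ Set.Ioo 0 t from ⟨hτ.1, hτt⟩), ← sub_smul, enorm_smul]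
      rcases le_or_gt τ (t - η) with h3 | h3
      · refine le_add_right (mul_le_mul' ?_ h1)
        rw [← ofReal_norm, Real.norm_eq_abs]
        refine ENNReal.ofReal_le_ofReal ?_
        have := abs_heatSymbol_sub_le hν hη (show η ≤ t - τ by linarith)
          (show t - τ ≤ t' - τ by linarith) ξ
        simpa using this
      · refine le_add_left ?_
        rw [Set.indicator_of_mem (show τ ∈ Set.Ioo (t - η) t' from ⟨h3, hτ.2⟩)]
        refine (mul_le_of_le_one_left zero_le ?_).trans h1
        rw [← ofReal_norm, Real.norm_eq_abs, ENNReal.ofReal_le_one, abs_le]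
        have hb2 := heatSymbol_le_one hν (show 0 ≤ t - τ by linarith) ξ
        have hp2 := heatSymbol_pos ν (t - τ) ξ
        constructor <;> linarith
    · rw [Set.indicator_of_notMem (fun h => hτt h.2), sub_zero, enorm_smul]
      refine le_add_left ?_
      rw [Set.indicator_of_mem (show τ ∈ Set.Ioo (t - η) t' from ⟨by linarith, hτ.2⟩)]
      refine (mul_le_of_le_one_left zero_le ?_).trans h1
      rw [← ofReal_norm, Real.norm_of_nonneg hp1.le, ENNReal.ofReal_le_one]
      exact hb1
  refine (lintegral_mono_ae h2).trans ?_
  rw [lintegral_add_left (hnm.const_mul _), lintegral_const_mul _ hnm]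
  refine add_le_add le_rfl ?_
  refine (lintegral_mono' Measure.restrict_le_self le_rfl).trans_eq ?_
  rw [lintegral_indicator measurableSet_Ioo]
  rfl

/-- The increment of the solution at times `≥ η` is dominated by a small multiple of the initial value
and of the total flux, plus the flux over a short interval. -/
theorem enorm_sol_increment_le {ν : ℝ} (hν : 0 ≤ ν) {u₀ : E3 → V3} (hu : Measurable u₀)
    {η t t' : ℝ} (hη : 0 < η) (ht : η ≤ t) (htt' : t ≤ t') {ξ : E3} (hξ : ξ ≠ 0)
    (h : maj ν u₀ t ξ ≠ ∞) (h' : maj ν u₀ t' ξ ≠ ∞) :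
    ‖sol ν u₀ t' ξ - sol ν u₀ t ξ‖ₑ ≤
      ENNReal.ofReal ((t' - t) / η) * (‖u₀ ξ‖ₑ + fluxMaj (maj ν u₀) (maj ν u₀) 0 t' ξ) +
        fluxMaj (maj ν u₀) (maj ν u₀) (t - η) t' ξ := by
  have h1 := enorm_duhamel_increment_le hν (measurable_sol hν hu) (measurable_maj hu)
    (enorm_sol_le hν hu) hη htt' (convIntegrable_sol hν hu hξ h) (convIntegrable_sol hν hu hξ h')
  have h2 : ‖(heatSymbol ν t' ξ - heatSymbol ν t ξ) • u₀ ξ‖ₑ ≤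
      ENNReal.ofReal ((t' - t) / η) * ‖u₀ ξ‖ₑ := by
    rw [enorm_smul]
    gcongr
    rw [← ofReal_norm, Real.norm_eq_abs]
    exact ENNReal.ofReal_le_ofReal (abs_heatSymbol_sub_le hν hη ht htt' ξ)
  have h3 : sol ν u₀ t' ξ - sol ν u₀ t ξ = (heatSymbol ν t' ξ - heatSymbol ν t ξ) • u₀ ξ -
      (duhamel ν (sol ν u₀) t' ξ - duhamel ν (sol ν u₀) t ξ) := by
    rw [sol_eq hν hu h, sol_eq hν hu h', sub_smul]; abel
  rw [h3, mul_add, add_assoc]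
  exact enorm_sub_le.trans (add_le_add h2 h1)

theorem enorm_sol_sub_initial_le {ν : ℝ} (hν : 0 ≤ ν) {u₀ : E3 → V3} (hu : Measurable u₀)
    {t : ℝ} {ξ : E3} (hξ : ξ ≠ 0) (h : maj ν u₀ t ξ ≠ ∞) :
    ‖sol ν u₀ t ξ - u₀ ξ‖ₑ ≤ ‖heatSymbol ν t ξ - 1‖ₑ * ‖u₀ ξ‖ₑ +
      fluxMaj (maj ν u₀) (maj ν u₀) 0 t ξ := by
  have h3 : sol ν u₀ t ξ - u₀ ξ = (heatSymbol ν t ξ - 1) • u₀ ξ - duhamel ν (sol ν u₀) t ξ := by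
    rw [sol_eq hν hu h, sub_smul, one_smul]; abel
  have hz : ConvIntegrable (fun _ _ => (0 : V3)) t ξ := fun k => by simp
  have h4 := enorm_duhamel_sub_le hν (measurable_sol hν hu) (g := fun _ _ => 0) measurable_const
    (convIntegrable_sol hν hu hξ h) hz
  have h5 : duhamel ν (fun _ _ => (0 : V3)) t ξ = 0 := by
    simp [duhamel, convectionSymbol, ← lerayCLM_apply]
  rw [h5, sub_zero] at h4
  rw [h3, ← enorm_smul]
  refine enorm_sub_le.trans (add_le_add le_rfl (h4.trans ?_))
  have h6 : duhamelMaj ν (fun τ η => ‖(0 : V3)‖ₑ) (fun τ η => ‖sol ν u₀ τ η - 0‖ₑ) 0 t ξ = 0 := by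
    simp [duhamelMaj, conv]
  rw [h6, add_zero]
  simp only [sub_zero]
  exact (duhamelMaj_mono (enorm_sol_le hν hu) (enorm_sol_le hν hu) 0 t ξ).trans
    (duhamelMaj_le_fluxMaj hν _ _ 0 t ξ)

/-! ### Uniqueness in Fourier variables -/

theorem IsLittlewoodPaley.ae_eq_zero_of_blockNorm (hφ : IsLittlewoodPaley φ) {p : ℝ≥0∞}
    (hp1 : 1 ≤ p) {f : E3 → ℝ≥0∞} (hf : Measurable f) (h : ∀ j, blockNorm φ p j f = 0) :
    ∀ᵐ ξ, f ξ = 0 := by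
  have hp0 : p ≠ 0 := (zero_lt_one.trans_le hp1).ne'
  have h1 : ∀ᵐ ξ, ∀ j, lp φ j ξ * f ξ = 0 := by
    rw [ae_all_iff]
    intro j
    exact (eLpNorm_eq_zero_iff ((hφ.measurable_lp j).mul hf).aestronglyMeasurable hp0).1 (h j)
  filter_upwards [h1, ae_ne_zero_E3] with ξ hξ hne
  have : ∑' j, lp φ j ξ * f ξ = 0 := by simp [hξ]
  rwa [ENNReal.tsum_mul_right, hφ.tsum_lp hne, one_mul] at this

theorem conv_eq_zero_of_left {f g : E3 → ℝ≥0∞} (h : ∀ᵐ η, f η = 0) (ξ : E3) : conv f g ξ = 0 := by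
  rw [conv_comm]
  refine lintegral_eq_zero_of_ae_eq_zero ?_
  filter_upwards [h] with η hη
  simp [hη]

theorem conv_eq_zero_of_right {f g : E3 → ℝ≥0∞} (h : ∀ᵐ η, g η = 0) (ξ : E3) :
    conv f g ξ = 0 := by
  rw [conv_comm]; exact conv_eq_zero_of_left h ξ

/-- If the quadratic term vanishes up to time `a`, the Duhamel term may be started at `a`. -/
theorem duhamelMaj_le_of_vanish {ν : ℝ} {F G : ℝ → E3 → ℝ≥0∞} {a t : ℝ} {ξ : E3}
    (h : ∀ᵐ τ : ℝ, τ ∈ Set.Ioo 0 a → conv (F τ) (G τ) ξ = 0) :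
    duhamelMaj ν F G 0 t ξ ≤ duhamelMaj ν F G a t ξ := by
  unfold duhamelMaj
  rw [← lintegral_indicator measurableSet_Ioo, ← lintegral_indicator measurableSet_Ioo]
  refine lintegral_mono_ae ?_
  have hne : ∀ᵐ τ : ℝ, τ ≠ a := by simp [ae_iff]
  filter_upwards [h, hne] with τ h1 h2
  by_cases hτ : τ ∈ Set.Ioo 0 t
  · rw [Set.indicator_of_mem hτ]
    rcases lt_or_gt_of_ne h2 with h3 | h3
    · rw [h1 ⟨hτ.1, h3⟩]; simp
    · rw [Set.indicator_of_mem (show τ ∈ Set.Ioo a t from ⟨h3, hτ.2⟩)]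
  · rw [Set.indicator_of_notMem hτ]; exact zero_le

/-- Two solutions of the Duhamel equation with finite norms on `(0, b)` agree. The bilinear estimate
on a short interval shows that the set of times up to which they agree can always be enlarged by a
fixed amount. -/
theorem ae_eq_of_duhamel (hφ : IsLittlewoodPaley φ) {ν : ℝ} (hν : 0 < ν) {p q : ℝ≥0∞} {s b e : ℝ}
    (hp1 : 1 ≤ p) (hp : p ≠ ∞) (hq : 1 ≤ q) (he : 0 < e) {C : ℝ≥0∞} (hC : C ≠ ∞)
    (hbil : ∀ (a b : ℝ), a ≤ b → ∀ f g : ℝ → E3 → ℝ≥0∞, Measurable (Function.uncurry f) →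
      Measurable (Function.uncurry g) → slabNorm φ s p q a b (duhamelMaj ν f g a) ≤
        C * ENNReal.ofReal (b - a) ^ e * slabNorm φ s p q a b f * slabNorm φ s p q a b g)
    {f g : ℝ → E3 → V3} (hf : Measurable (Function.uncurry f))
    (hg : Measurable (Function.uncurry g))
    (hfn : slabNorm φ s p q 0 b (fun t ξ => ‖f t ξ‖ₑ) ≠ ∞)
    (hgn : slabNorm φ s p q 0 b (fun t ξ => ‖g t ξ‖ₑ) ≠ ∞)
    (hdiff : ∀ᵐ t : ℝ, t ∈ Set.Ioo 0 b → ∀ᵐ ξ, ConvIntegrable f t ξ ∧ ConvIntegrable g t ξ ∧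
      f t ξ - g t ξ = -(duhamel ν f t ξ - duhamel ν g t ξ)) :
    ∀ᵐ t : ℝ, t ∈ Set.Ioo 0 b → ∀ᵐ ξ, f t ξ = g t ξ := by
  set M := slabNorm φ s p q 0 b (fun t ξ => ‖f t ξ‖ₑ) + slabNorm φ s p q 0 b (fun t ξ => ‖g t ξ‖ₑ)
    with hM
  have hMt : M ≠ ∞ := ENNReal.add_ne_top.2 ⟨hfn, hgn⟩
  -- The step `h` is so short that the bilinear estimate becomes a contraction with factor `1/2`. It
  -- depends only on the norms of `f` and `g` on all of `(0, b)`, so finitely many steps suffice.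
  obtain ⟨h, hh0, hh⟩ : ∃ h : ℝ, 0 < h ∧ C * ENNReal.ofReal h ^ e * M ≤ 1 / 2 := by
    have h1 : Tendsto (fun h : ℝ => C * ENNReal.ofReal h ^ e * M) (𝓝[>] 0) (𝓝 0) := by
      have h2 : Tendsto (fun h : ℝ => ENNReal.ofReal h ^ e) (𝓝[>] 0) (𝓝 0) := by
        have h3 := ((ENNReal.continuous_rpow_const (y := e)).comp ENNReal.continuous_ofReal).tendsto 0
        simp only [Function.comp_apply, ENNReal.ofReal_zero, ENNReal.zero_rpow_of_pos he] at h3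
        exact h3.mono_left nhdsWithin_le_nhds
      have h4 := ENNReal.Tendsto.mul_const (ENNReal.Tendsto.const_mul h2 (Or.inr hC)) (Or.inr hMt)
      simpa using h4
    have h5 := (h1.eventually_le_const (show (0 : ℝ≥0∞) < 1 / 2 by simp)).and
      self_mem_nhdsWithin
    obtain ⟨h, h6, h7⟩ := h5.exists
    exact ⟨h, h7, h6⟩
  set w : ℝ → E3 → ℝ≥0∞ := fun t ξ => ‖f t ξ - g t ξ‖ₑ with hw
  set fe : ℝ → E3 → ℝ≥0∞ := fun t ξ => ‖f t ξ‖ₑ with hfe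
  set ge : ℝ → E3 → ℝ≥0∞ := fun t ξ => ‖g t ξ‖ₑ with hge
  have hwm : Measurable (Function.uncurry w) := (hf.sub hg).enorm
  have hfm : Measurable (Function.uncurry fe) := hf.enorm
  have hgm : Measurable (Function.uncurry ge) := hg.enorm
  have step : ∀ a : ℝ, 0 ≤ a → (∀ᵐ t : ℝ, t ∈ Set.Ioo 0 a → t ∈ Set.Ioo 0 b → ∀ᵐ ξ, w t ξ = 0) →
      ∀ᵐ t : ℝ, t ∈ Set.Ioo 0 (a + h) → t ∈ Set.Ioo 0 b → ∀ᵐ ξ, w t ξ = 0 := by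
    intro a ha hva
    rcases le_or_gt b a with hba | hab
    · filter_upwards [hva] with t ht _ htb
      exact ht ⟨htb.1, htb.2.trans_le hba⟩ htb
    set a' := min (a + h) b with ha'
    have haa' : a ≤ a' := le_min (by linarith) hab.le
    have hsub : Set.Ioo a a' ⊆ Set.Ioo 0 b :=
      Set.Ioo_subset_Ioo ha (min_le_right _ _)
    -- The difference vanishes on `(0, a)`, so only the Duhamel integral over `(a, t)` remains.
    have hvan : ∀ (F : ℝ → E3 → ℝ≥0∞) (ξ : E3), ∀ᵐ τ : ℝ, τ ∈ Set.Ioo 0 a →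
        conv (w τ) (F τ) ξ = 0 ∧ conv (F τ) (w τ) ξ = 0 := by
      intro F ξ
      filter_upwards [hva] with τ h1 h2
      have h3 := h1 h2 ⟨h2.1, h2.2.trans hab⟩
      exact ⟨conv_eq_zero_of_left h3 ξ, conv_eq_zero_of_right h3 ξ⟩
    have hle : ∀ᵐ t ∂(volume.restrict (Set.Ioo a a')), ∀ᵐ ξ, w t ξ ≤
        duhamelMaj ν w fe a t ξ + duhamelMaj ν ge w a t ξ := by
      rw [ae_restrict_iff' measurableSet_Ioo]
      filter_upwards [hdiff] with t ht hta
      filter_upwards [ht (hsub hta)] with ξ hξ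
      simp only [hw]
      rw [hξ.2.2, enorm_neg]
      refine (enorm_duhamel_sub_le hν.le hf hg hξ.1 hξ.2.1).trans ?_
      refine add_le_add (duhamelMaj_le_of_vanish ?_) (duhamelMaj_le_of_vanish ?_)
      · filter_upwards [hvan fe ξ] with τ h1 h2 using (h1 h2).1
      · filter_upwards [hvan ge ξ] with τ h1 h2 using (h1 h2).2
    set N := slabNorm φ s p q a a' w with hN
    have hNt : N ≠ ∞ := by
      refine ne_top_of_le_ne_top hMt ?_
      calc N ≤ slabNorm φ s p q 0 b w := slabNorm_mono_interval hq hsub w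
        _ ≤ slabNorm φ s p q 0 b (fun t ξ => fe t ξ + ge t ξ) :=
          slabNorm_mono hq (ae_of_all _ fun t => ae_of_all _ fun ξ => enorm_sub_le)
        _ ≤ M := slabNorm_add_le hφ hp1 hp hq hfm hgm
    have hN1 : N ≤ C * ENNReal.ofReal h ^ e * M * N := by
      have hlen : ENNReal.ofReal (a' - a) ≤ ENNReal.ofReal h :=
        ENNReal.ofReal_le_ofReal (by linarith [min_le_left (a + h) b])
      have hfe' : slabNorm φ s p q a a' fe ≤ slabNorm φ s p q 0 b fe :=
        slabNorm_mono_interval hq hsub fe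
      have hge' : slabNorm φ s p q a a' ge ≤ slabNorm φ s p q 0 b ge :=
        slabNorm_mono_interval hq hsub ge
      calc N ≤ slabNorm φ s p q a a'
            (fun t ξ => duhamelMaj ν w fe a t ξ + duhamelMaj ν ge w a t ξ) :=
            slabNorm_mono hq hle
        _ ≤ slabNorm φ s p q a a' (duhamelMaj ν w fe a) +
            slabNorm φ s p q a a' (duhamelMaj ν ge w a) :=
            slabNorm_add_le hφ hp1 hp hq (measurable_duhamelMaj ν a hwm hfm)
              (measurable_duhamelMaj ν a hgm hwm)
        _ ≤ C * ENNReal.ofReal (a' - a) ^ e * N * slabNorm φ s p q a a' fe +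
            C * ENNReal.ofReal (a' - a) ^ e * slabNorm φ s p q a a' ge * N :=
            add_le_add (hbil a a' haa' w fe hwm hfm) (hbil a a' haa' ge w hgm hwm)
        _ ≤ C * ENNReal.ofReal h ^ e * N * slabNorm φ s p q 0 b fe +
            C * ENNReal.ofReal h ^ e * slabNorm φ s p q 0 b ge * N := by gcongr
        _ = C * ENNReal.ofReal h ^ e * M * N := by rw [hM]; ring
    -- Absorption of the right-hand side needs `N < ∞`.
    have hN0 : N = 0 := by
      have h1 : N ≤ N / 2 := by
        calc N ≤ 1 / 2 * N := hN1.trans (by gcongr)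
          _ = N / 2 := by rw [one_div, mul_comm, div_eq_mul_inv]
      by_contra hne
      exact absurd h1 (not_le.2 (ENNReal.half_lt_self hne hNt))
    have hz : ∀ᵐ t ∂(volume.restrict (Set.Ioo a a')), ∀ᵐ ξ, w t ξ = 0 := by
      filter_upwards [ae_block_le_slabNorm (φ := φ) (p := p) (s := s) (a := a) (b := a') hq w]
        with t ht
      refine hφ.ae_eq_zero_of_blockNorm hp1 hwm.of_uncurry_left fun j => ?_
      have h1 := ht j
      rw [show slabNorm φ s p q a a' w = 0 from hN0, nonpos_iff_eq_zero, mul_eq_zero] at h1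
      exact h1.resolve_left (two_rpow_ne_zero _)
    rw [ae_restrict_iff' measurableSet_Ioo] at hz
    have hne : ∀ᵐ τ : ℝ, τ ≠ a := by simp [ae_iff]
    filter_upwards [hva, hz, hne] with t h1 h2 h3 h4 h5
    rcases lt_or_gt_of_ne h3 with h6 | h6
    · exact h1 ⟨h4.1, h6⟩ h5
    · exact h2 ⟨h6, lt_min h4.2 h5.2⟩
  have hall : ∀ n : ℕ, ∀ᵐ t : ℝ, t ∈ Set.Ioo 0 (n * h) → t ∈ Set.Ioo 0 b → ∀ᵐ ξ, w t ξ = 0 := by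
    intro n
    induction n with
    | zero => exact ae_of_all _ fun t ht => absurd (ht.1.trans ht.2) (by simp)
    | succ n ih =>
      have := step (n * h) (by positivity) ih
      simpa [add_mul] using this
  obtain ⟨n, hn⟩ := exists_nat_gt (b / h)
  filter_upwards [hall n] with t ht htb
  have h1 : t ∈ Set.Ioo 0 (n * h) := ⟨htb.1, htb.2.trans ((div_lt_iff₀ hh0).1 hn)⟩
  filter_upwards [ht h1 htb] with ξ hξ
  exact sub_eq_zero.1 (enorm_eq_zero.1 hξ)

/-! ### Tempered distributions whose Fourier transform is a function -/

theorem integral_ofReal_smul (g : E3 → ℝ) (f : E3 → V3) :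
    ∫ x, ((g x : ℝ) : ℂ) • f x = ∫ x, g x • f x := by
  simp [Complex.coe_smul]

/-- A smooth compactly supported real function as a complex Schwartz function. -/
def ofRealSchwartz (g : E3 → ℝ) (hg : ContDiff ℝ ((⊤ : ℕ∞) : WithTop ℕ∞) g)
    (hc : HasCompactSupport g) : 𝓢(E3, ℂ) :=
  (hc.comp_left (g := fun x : ℝ => (x : ℂ)) (by simp)).toSchwartzMap
    (Complex.ofRealCLM.contDiff.comp hg)

theorem ofRealSchwartz_apply (g : E3 → ℝ) (hg : ContDiff ℝ ((⊤ : ℕ∞) : WithTop ℕ∞) g)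
    (hc : HasCompactSupport g) (x : E3) : ofRealSchwartz g hg hc x = ((g x : ℝ) : ℂ) := rfl

theorem IsGivenBy.ae_eq {f : VDist} {g₁ g₂ : E3 → V3} (h₁ : IsGivenBy f g₁)
    (h₂ : IsGivenBy f g₂) : ∀ᵐ ξ, g₁ ξ = g₂ ξ := by
  refine ae_eq_of_integral_contDiff_smul_eq h₁.1 h₂.1 fun g hg hc => ?_
  rw [← integral_ofReal_smul, ← integral_ofReal_smul]
  exact ((h₁.2 (ofRealSchwartz g hg hc)).2.symm.trans (h₂.2 (ofRealSchwartz g hg hc)).2)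

theorem IsGivenBy.congr {f : VDist} {g₁ g₂ : E3 → V3} (h₁ : IsGivenBy f g₁)
    (h : ∀ᵐ ξ, g₁ ξ = g₂ ξ) : IsGivenBy f g₂ := by
  have h' : g₁ =ᵐ[volume] g₂ := h
  refine ⟨h₁.1.congr h', fun ψ => ?_⟩
  have h2 : (fun ξ => ψ ξ • g₁ ξ) =ᵐ[volume] fun ξ => ψ ξ • g₂ ξ := by
    filter_upwards [h] with ξ hξ
    rw [hξ]
  exact ⟨(h₁.2 ψ).1.congr h2, (h₁.2 ψ).2.trans (integral_congr_ae h2)⟩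

theorem IsGivenBy.dist_eq {f₁ f₂ : VDist} {g₁ g₂ : E3 → V3} (h₁ : IsGivenBy (𝓕 f₁) g₁)
    (h₂ : IsGivenBy (𝓕 f₂) g₂) (h : ∀ᵐ ξ, g₁ ξ = g₂ ξ) : f₁ = f₂ := by
  have h3 : 𝓕 f₁ = 𝓕 f₂ := by
    ext1 ψ
    rw [((h₁.congr h).2 ψ).2, (h₂.2 ψ).2]
  have h4 : ∀ f : VDist, 𝓕⁻ (𝓕 f) = f := fun f => FourierTransform.fourierInv_fourier_eq f
  rw [← h4 f₁, h3, h4]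

theorem IsGivenBy.sub {f₁ f₂ : VDist} {g₁ g₂ : E3 → V3} (h₁ : IsGivenBy f₁ g₁)
    (h₂ : IsGivenBy f₂ g₂) : IsGivenBy (f₁ - f₂) (fun ξ => g₁ ξ - g₂ ξ) := by
  refine ⟨h₁.1.sub h₂.1, fun ψ => ?_⟩
  simp only [smul_sub]
  refine ⟨(h₁.2 ψ).1.sub (h₂.2 ψ).1, ?_⟩
  rw [integral_sub (h₁.2 ψ).1 (h₂.2 ψ).1, ← (h₁.2 ψ).2, ← (h₂.2 ψ).2]
  rfl

theorem fourier_sub (f₁ f₂ : VDist) : 𝓕 (f₁ - f₂) = 𝓕 f₁ - 𝓕 f₂ := by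
  ext1 ψ
  rfl

theorem IsGivenBy.smulLeft {f : VDist} {g : E3 → V3} (h : IsGivenBy f g) {m : E3 → ℂ}
    (hm : m.HasTemperateGrowth) :
    IsGivenBy (TemperedDistribution.smulLeftCLM V3 m f) (fun ξ => m ξ • g ξ) := by
  refine ⟨h.1.continuous_smul hm.1.continuous, fun ψ => ?_⟩
  have h1 := h.2 (SchwartzMap.smulLeftCLM ℂ m ψ)
  simp only [SchwartzMap.smulLeftCLM_apply_apply hm, smul_eq_mul, mul_comm (m _), mul_smul] at h1
  exact h1

theorem flNorm_eq {f : VDist} {g : E3 → V3} (h : IsGivenBy (𝓕 f) g) (p : ℝ≥0∞) :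
    flNorm p f = eLpNorm g p volume := by
  refine le_antisymm (iInf₂_le g h) (le_iInf₂ fun g' h' => ?_)
  exact (eLpNorm_congr_ae (h.ae_eq h')).le

/-- The symbol of the dyadic block `Δ_j` as a complex-valued function. -/
def blockSymbol (φ : E3 → ℝ) (j : ℤ) (ξ : E3) : ℂ := ((φ ((2 : ℝ) ^ (-j) • ξ) : ℝ) : ℂ)

theorem fourier_block (φ : E3 → ℝ) (j : ℤ) (f : VDist) :
    𝓕 (block φ j f) = TemperedDistribution.smulLeftCLM V3 (blockSymbol φ j) (𝓕 f) := by
  unfold block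
  rw [TemperedDistribution.fourierMultiplierCLM_apply, FourierTransform.fourier_fourierInv_eq]
  rfl

theorem IsLittlewoodPaley.hasTemperateGrowth_blockSymbol (hφ : IsLittlewoodPaley φ) (j : ℤ) :
    (blockSymbol φ j).HasTemperateGrowth := by
  have hc : HasCompactSupport φ := by
    refine (isCompact_closedBall (0 : E3) (8 / 3)).of_isClosed_subset (isClosed_tsupport _) ?_
    intro ξ hξ
    simpa using (hφ.tsupport_subset hξ).2
  have h1 : HasCompactSupport fun ξ : E3 => φ ((2 : ℝ) ^ (-j) • ξ) :=
    hc.comp_smul (by positivity)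
  have h2 : HasCompactSupport (blockSymbol φ j) :=
    h1.comp_left (g := fun x : ℝ => (x : ℂ)) (by simp)
  refine h2.hasTemperateGrowth ?_
  exact Complex.ofRealCLM.contDiff.comp (hφ.contDiff.comp (contDiff_const_smul _))

theorem IsLittlewoodPaley.enorm_blockSymbol (hφ : IsLittlewoodPaley φ) (j : ℤ) (ξ : E3) :
    ‖blockSymbol φ j ξ‖ₑ = lp φ j ξ := by
  rw [blockSymbol, lp, ← ofReal_norm, Complex.norm_real, Real.norm_of_nonneg (hφ.nonneg _)]

theorem IsLittlewoodPaley.isGivenBy_block (hφ : IsLittlewoodPaley φ) {f : VDist} {g : E3 → V3}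
    (h : IsGivenBy (𝓕 f) g) (j : ℤ) :
    IsGivenBy (𝓕 (block φ j f)) (fun ξ => blockSymbol φ j ξ • g ξ) := by
  rw [fourier_block]
  exact h.smulLeft (hφ.hasTemperateGrowth_blockSymbol j)

theorem IsLittlewoodPaley.flNorm_block (hφ : IsLittlewoodPaley φ) {f : VDist} {g : E3 → V3}
    (h : IsGivenBy (𝓕 f) g) (p : ℝ≥0∞) (j : ℤ) :
    flNorm p (block φ j f) = blockNorm φ p j (fun ξ => ‖g ξ‖ₑ) := by
  rw [flNorm_eq (hφ.isGivenBy_block h j), blockNorm]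
  refine eLpNorm_congr_enorm_ae (ae_of_all _ fun ξ => ?_)
  simp [enorm_smul, hφ.enorm_blockSymbol]

theorem IsLittlewoodPaley.fhNorm_eq (hφ : IsLittlewoodPaley φ) {f : VDist} {g : E3 → V3}
    (h : IsGivenBy (𝓕 f) g) (s : ℝ) (p q : ℝ≥0∞) :
    fhNorm φ s p q f =
      seqNorm q fun j => 2 ^ ((j : ℝ) * s) * blockNorm φ p j (fun ξ => ‖g ξ‖ₑ) := by
  simp only [fhNorm, hφ.flNorm_block h]

/-! ### Functions integrable against the weight `(1 + |ξ|)⁻¹` -/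

/-- The weight `(1 + |ξ|)⁻¹`. -/
def weight (ξ : E3) : ℝ≥0∞ := ENNReal.ofReal (1 + ‖ξ‖)⁻¹

theorem measurable_weight : Measurable weight := by
  unfold weight; fun_prop

/-- A Schwartz function decays faster than the weight. -/
theorem schwartz_enorm_le (ψ : 𝓢(E3, ℂ)) (ξ : E3) :
    ‖ψ ξ‖ₑ ≤ ENNReal.ofReal
      (2 * (Finset.Iic (1, 0)).sup (schwartzSeminormFamily ℂ E3 ℂ) ψ) * weight ξ := by
  have h := SchwartzMap.one_add_le_sup_seminorm_apply (𝕜 := ℂ) (m := (1, 0)) (k := 1) (n := 0)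
    le_rfl le_rfl ψ ξ
  simp only [pow_one, norm_iteratedFDeriv_zero] at h
  rw [weight, ← ENNReal.ofReal_mul (by positivity), ← ofReal_norm]
  refine ENNReal.ofReal_le_ofReal ?_
  rw [← div_eq_mul_inv, le_div_iff₀ (by positivity), mul_comm]
  exact h

theorem lintegral_schwartz_smul_le (ψ : 𝓢(E3, ℂ)) (g : E3 → V3) :
    ∫⁻ ξ, ‖ψ ξ • g ξ‖ₑ ≤ ENNReal.ofReal
      (2 * (Finset.Iic (1, 0)).sup (schwartzSeminormFamily ℂ E3 ℂ) ψ) *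
        ∫⁻ ξ, weight ξ * ‖g ξ‖ₑ := by
  rw [← lintegral_const_mul' _ _ ENNReal.ofReal_ne_top]
  refine lintegral_mono fun ξ => ?_
  rw [enorm_smul, ← mul_assoc]
  exact mul_le_mul_left (schwartz_enorm_le ψ ξ) _

theorem integrable_schwartz_smul {g : E3 → V3} (hg : Measurable g)
    (h : ∫⁻ ξ, weight ξ * ‖g ξ‖ₑ ≠ ∞) (ψ : 𝓢(E3, ℂ)) : Integrable fun ξ => ψ ξ • g ξ := by
  refine ⟨(ψ.continuous.measurable.smul hg).aestronglyMeasurable, ?_⟩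
  exact (lintegral_schwartz_smul_le ψ g).trans_lt
    (ENNReal.mul_lt_top ENNReal.ofReal_lt_top h.lt_top)

theorem locallyIntegrable_of_weight {g : E3 → V3} (hg : Measurable g)
    (h : ∫⁻ ξ, weight ξ * ‖g ξ‖ₑ ≠ ∞) : LocallyIntegrable g := by
  have h1 : Integrable fun ξ => (1 + ‖ξ‖)⁻¹ • g ξ := by
    refine ⟨Measurable.aestronglyMeasurable (by fun_prop), ?_⟩
    refine lt_of_eq_of_lt (lintegral_congr fun ξ => ?_) h.lt_top
    rw [enorm_smul, weight, ← ofReal_norm, Real.norm_of_nonneg (by positivity)]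
  have h2 := h1.locallyIntegrable.continuous_smul (g := fun ξ : E3 => 1 + ‖ξ‖) (by fun_prop)
  refine h2.congr (ae_of_all _ fun ξ => ?_)
  dsimp only
  rw [smul_smul, mul_inv_cancel₀ (by positivity), one_smul]

/-- A function integrable against the weight is the Fourier transform of a tempered
distribution. -/
theorem exists_isGivenBy {g : E3 → V3} (hg : Measurable g)
    (h : ∫⁻ ξ, weight ξ * ‖g ξ‖ₑ ≠ ∞) : ∃ f : VDist, IsGivenBy (𝓕 f) g := by
  have hi := integrable_schwartz_smul hg h
  let T : 𝓢(E3, ℂ) →L[ℂ] V3 := SchwartzMap.mkCLMtoNormedSpace (σ := RingHom.id ℂ)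
    (fun ψ => ∫ ξ, ψ ξ • g ξ)
    (fun ψ₁ ψ₂ => by
      simp only [add_apply, add_smul]
      exact integral_add (hi ψ₁) (hi ψ₂))
    (fun a ψ => by
      simp only [smul_apply, smul_assoc]
      exact integral_smul a _)
    ⟨Finset.Iic (1, 0), (2 * (∫⁻ ξ, weight ξ * ‖g ξ‖ₑ)).toReal, by positivity, fun ψ => by
      have h1 := (enorm_integral_le_lintegral_enorm (fun ξ => ψ ξ • g ξ)).trans
        (lintegral_schwartz_smul_le ψ g)
      have h2 := ENNReal.toReal_mono (ENNReal.mul_ne_top ENNReal.ofReal_ne_top h) h1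
      rw [toReal_enorm, ENNReal.toReal_mul, ENNReal.toReal_ofReal (by positivity)] at h2
      refine h2.trans_eq ?_
      rw [ENNReal.toReal_mul]
      simp
      ring⟩
  let f₀ : VDist := ContinuousLinearMap.toPointwiseConvergenceCLM _ _ _ _ T
  refine ⟨𝓕⁻ f₀, locallyIntegrable_of_weight hg h, fun ψ => ⟨hi ψ, ?_⟩⟩
  rw [FourierTransform.fourier_fourierInv_eq]
  rfl

theorem apply_eq_fourier (f : VDist) (ψ : 𝓢(E3, ℂ)) : f ψ = 𝓕 f (𝓕⁻ ψ) := by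
  rw [TemperedDistribution.fourier_apply, FourierTransform.fourier_fourierInv_eq]

/-- Continuity of the pairing with a test function for the weighted `L¹` norm of the Fourier transform. -/
theorem enorm_apply_le {f : VDist} {g : E3 → V3} (h : IsGivenBy (𝓕 f) g) (ψ : 𝓢(E3, ℂ)) :
    ‖f ψ‖ₑ ≤ ENNReal.ofReal
      (2 * (Finset.Iic (1, 0)).sup (schwartzSeminormFamily ℂ E3 ℂ) (𝓕⁻ ψ)) *
        ∫⁻ ξ, weight ξ * ‖g ξ‖ₑ := by
  rw [apply_eq_fourier, (h.2 _).2]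
  exact (enorm_integral_le_lintegral_enorm _).trans (lintegral_schwartz_smul_le _ g)

/-- A function integrable against the weight is the sum of its dyadic blocks. -/
theorem IsLittlewoodPaley.hasSum_block (hφ : IsLittlewoodPaley φ) {f : VDist} {g : E3 → V3}
    (h : IsGivenBy (𝓕 f) g) (ψ : 𝓢(E3, ℂ)) : HasSum (fun j : ℤ => block φ j f ψ) (f ψ) := by
  simp_rw [fun f => apply_eq_fourier f ψ]
  rw [(h.2 _).2]
  simp_rw [((hφ.isGivenBy_block h _).2 _).2]
  have hn : ∀ j ξ, ‖blockSymbol φ j ξ‖ = φ ((2 : ℝ) ^ (-j) • ξ) := fun j ξ => by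
    rw [blockSymbol, Complex.norm_real, Real.norm_of_nonneg (hφ.nonneg _)]
  refine hasSum_integral_of_dominated_convergence
    (fun j ξ => φ ((2 : ℝ) ^ (-j) • ξ) * ‖(𝓕⁻ ψ) ξ • g ξ‖) (fun j => ?_) (fun j => ?_) ?_ ?_ ?_
  · exact ((hφ.isGivenBy_block h j).2 _).1.1
  · refine ae_of_all _ fun ξ => ?_
    rw [smul_comm, norm_smul, hn]
  · filter_upwards [ae_ne_zero_E3] with ξ hξ
    exact (hφ.partition ξ hξ).summable.mul_right _
  · refine (h.2 (𝓕⁻ ψ)).1.norm.congr ?_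
    filter_upwards [ae_ne_zero_E3] with ξ hξ
    rw [tsum_mul_right, (hφ.partition ξ hξ).tsum_eq, one_mul]
  · filter_upwards [ae_ne_zero_E3] with ξ hξ
    have h2 : HasSum (fun j => blockSymbol φ j ξ) 1 := by
      have := (Complex.hasSum_ofReal (f := fun j : ℤ => φ ((2 : ℝ) ^ (-j) • ξ))).2
        (hφ.partition ξ hξ)
      simpa [blockSymbol] using this
    have h3 := h2.smul_const ((𝓕⁻ ψ) ξ • g ξ)
    rw [one_smul] at h3
    have h4 : (fun j => (𝓕⁻ ψ) ξ • blockSymbol φ j ξ • g ξ) =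
        fun j => blockSymbol φ j ξ • (𝓕⁻ ψ) ξ • g ξ := funext fun j => smul_comm _ _ _
    rw [h4]
    exact h3

/-! ### The Fourier transform of an element of a Fourier-Herz space -/

/-- The Fourier transform of a dyadic block is carried by the annulus of the block. -/
theorem IsLittlewoodPaley.ae_eq_zero_of_block (hφ : IsLittlewoodPaley φ) {f : VDist} {j : ℤ}
    {g : E3 → V3} (h : IsGivenBy (𝓕 (block φ j f)) g) :
    ∀ᵐ ξ, ¬ (3 / 4 * (2 : ℝ) ^ j ≤ ‖ξ‖ ∧ ‖ξ‖ ≤ 8 / 3 * (2 : ℝ) ^ j) → g ξ = 0 := by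
  set A : Set E3 := {ξ | 3 / 4 * (2 : ℝ) ^ j ≤ ‖ξ‖ ∧ ‖ξ‖ ≤ 8 / 3 * (2 : ℝ) ^ j} with hA
  have hAc : IsClosed A :=
    (isClosed_le continuous_const continuous_norm).inter
      (isClosed_le continuous_norm continuous_const)
  refine hAc.isOpen_compl.ae_eq_zero_of_integral_contDiff_smul_eq_zero
    (h.1.locallyIntegrableOn _) fun χ hχ hc hs => ?_
  rw [← integral_ofReal_smul]
  refine (h.2 (ofRealSchwartz χ hχ hc)).2.symm.trans ?_
  rw [fourier_block, TemperedDistribution.smulLeftCLM_apply_apply]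
  have h0 : SchwartzMap.smulLeftCLM ℂ (blockSymbol φ j) (ofRealSchwartz χ hχ hc) = 0 := by
    ext ξ
    rw [SchwartzMap.smulLeftCLM_apply_apply (hφ.hasTemperateGrowth_blockSymbol j),
      ofRealSchwartz_apply]
    by_cases hξ : χ ξ = 0
    · simp [hξ]
    · have h1 : ξ ∉ A := hs (subset_tsupport χ hξ)
      have h2 : φ ((2 : ℝ) ^ (-j) • ξ) = 0 := by
        by_contra h3
        exact h1 (hφ.norm_bounds h3)
      rw [blockSymbol, h2]
      simp
  rw [h0, map_zero]

/-- Only the annuli of index `k - 1`, `k` and `k + 1` meet the support of the `k`-th symbol. -/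
theorem not_annulus_of_lp (hφ : IsLittlewoodPaley φ) {j k : ℤ} {ξ : E3} (h : lp φ k ξ ≠ 0)
    (h1 : j ≠ k - 1) (h2 : j ≠ k) (h3 : j ≠ k + 1) :
    ¬ (3 / 4 * (2 : ℝ) ^ j ≤ ‖ξ‖ ∧ ‖ξ‖ ≤ 8 / 3 * (2 : ℝ) ^ j) := by
  rintro ⟨h4, h5⟩
  obtain ⟨h6, h7⟩ := hφ.norm_bounds_of_lp h
  have hk : (0 : ℝ) < 2 ^ k := by positivity
  rcases lt_or_gt_of_ne h2 with h8 | h8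
  · have h9 : (2 : ℝ) ^ j ≤ 2 ^ (k - 2) := zpow_le_zpow_right₀ (by norm_num) (by omega)
    rw [zpow_sub₀ (by norm_num)] at h9
    norm_num at h9
    linarith
  · have h9 : (2 : ℝ) ^ (k + 2) ≤ 2 ^ j := zpow_le_zpow_right₀ (by norm_num) (by omega)
    rw [zpow_add₀ (by norm_num)] at h9
    norm_num at h9
    linarith

theorem weight_pos (ξ : E3) : 0 < weight ξ := ENNReal.ofReal_pos.2 (by positivity)

/-- The Fourier transform of a distribution in a Fourier-Herz space with `s < 3 (1 - 1/p)` is a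
function: the sum of the functions that give the Fourier transforms of the blocks. -/
theorem MemFH.exists_isGivenBy (hφ : IsLittlewoodPaley φ) {s : ℝ} {p q : ℝ≥0∞} (hp1 : 1 ≤ p)
    (hq : 1 ≤ q) (hα : 0 < 3 * (1 - 1 / p.toReal) - s) (hα1 : 3 * (1 - 1 / p.toReal) - s < 1)
    {f : VDist} (hf : MemFH φ s p q f) : ∃ g : E3 → V3, Measurable g ∧ IsGivenBy (𝓕 f) g := by
  set M := fhNorm φ s p q f with hM
  have hfl : ∀ j : ℤ, 2 ^ ((j : ℝ) * s) * flNorm p (block φ j f) ≤ M := le_seqNorm hq _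
  have hfl' : ∀ j : ℤ, flNorm p (block φ j f) ≤ 2 ^ (-((j : ℝ) * s)) * M := by
    intro j
    calc flNorm p (block φ j f)
        = 2 ^ (-((j : ℝ) * s)) * (2 ^ ((j : ℝ) * s) * flNorm p (block φ j f)) := by
          rw [← mul_assoc, ← two_rpow_add]; simp
      _ ≤ _ := by gcongr; exact hfl j
  have hex : ∀ j : ℤ, ∃ g : E3 → V3, Measurable g ∧ IsGivenBy (𝓕 (block φ j f)) g := by
    intro j
    have h1 : flNorm p (block φ j f) < ∞ :=
      (hfl' j).trans_lt (ENNReal.mul_lt_top (two_rpow_ne_top _).lt_top hf.2)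
    obtain ⟨g, hg⟩ := iInf_lt_iff.1 h1
    obtain ⟨hg', -⟩ := iInf_lt_iff.1 hg
    have hm := hg'.1.aestronglyMeasurable
    exact ⟨hm.mk g, hm.stronglyMeasurable_mk.measurable, hg'.congr hm.ae_eq_mk⟩
  choose g hgm hg using hex
  have hgn : ∀ j, eLpNorm (g j) p volume ≤ 2 ^ (-((j : ℝ) * s)) * M := fun j =>
    (flNorm_eq (hg j) p).symm.trans_le (hfl' j)
  -- The sum of the moduli of the blocks has Fourier-Herz norm `≲ M`, as each of its blocks involves
  -- only three of the `g j`; it dominates the sum of the `g j`.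
  set G : E3 → ℝ≥0∞ := fun ξ => ∑' j, ‖g j ξ‖ₑ with hG
  have hGm : Measurable G := Measurable.tsum fun j => (hgm j).enorm
  have hsupp : ∀ᵐ ξ, ∀ j,
      ¬ (3 / 4 * (2 : ℝ) ^ j ≤ ‖ξ‖ ∧ ‖ξ‖ ≤ 8 / 3 * (2 : ℝ) ^ j) → g j ξ = 0 :=
    ae_all_iff.2 fun j => hφ.ae_eq_zero_of_block (hg j)
  have hb1 : ∀ k j, blockNorm φ p k (fun ξ => ‖g j ξ‖ₑ) ≤ 2 ^ (-((j : ℝ) * s)) * M := by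
    intro k j
    refine le_trans ?_ (hgn j)
    rw [blockNorm, ← eLpNorm_enorm]
    refine eLpNorm_mono_ennreal (ae_of_all _ fun ξ => ?_)
    exact mul_le_of_le_one_left zero_le (hφ.lp_le_one _ _)
  have hGk : ∀ k : ℤ, 2 ^ ((k : ℝ) * s) * blockNorm φ p k G ≤ (2 ^ s + 1 + 2 ^ (-s)) * M := by
    intro k
    have h1 : blockNorm φ p k G ≤
        blockNorm φ p k (fun ξ => ‖g (k - 1) ξ‖ₑ + ‖g k ξ‖ₑ + ‖g (k + 1) ξ‖ₑ) := by
      refine eLpNorm_mono_ennreal ?_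
      filter_upwards [hsupp] with ξ hξ
      rcases eq_or_ne (lp φ k ξ) 0 with h0 | h0
      · simp [h0]
      · refine mul_le_mul_right (le_of_eq ?_) _
        simp only [hG]
        rw [tsum_eq_sum (s := {k - 1, k, k + 1})]
        · rw [Finset.sum_insert (by simp; omega), Finset.sum_insert (by simp), Finset.sum_singleton,
            add_assoc]
        · intro j hj
          simp only [Finset.mem_insert, Finset.mem_singleton, not_or] at hj
          rw [hξ j (not_annulus_of_lp hφ h0 hj.1 hj.2.1 hj.2.2), enorm_zero]
    have h2 : ∀ j : ℤ, 2 ^ ((k : ℝ) * s) * (2 ^ (-((j : ℝ) * s)) * M) =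
        2 ^ (((k : ℝ) - j) * s) * M := fun j => by
      rw [← mul_assoc, ← two_rpow_add]; ring_nf
    calc 2 ^ ((k : ℝ) * s) * blockNorm φ p k G
        ≤ 2 ^ ((k : ℝ) * s) * (blockNorm φ p k (fun ξ => ‖g (k - 1) ξ‖ₑ) +
            blockNorm φ p k (fun ξ => ‖g k ξ‖ₑ) + blockNorm φ p k (fun ξ => ‖g (k + 1) ξ‖ₑ)) := by
          refine mul_le_mul_right (h1.trans ?_) _
          refine (blockNorm_add_le hφ hp1 k ((hgm _).enorm.add (hgm _).enorm)
            (hgm _).enorm).trans (add_le_add ?_ le_rfl)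
          exact blockNorm_add_le hφ hp1 k (hgm _).enorm (hgm _).enorm
      _ ≤ 2 ^ ((k : ℝ) * s) * (2 ^ (-(((k - 1 : ℤ) : ℝ) * s)) * M + 2 ^ (-((k : ℝ) * s)) * M +
            2 ^ (-(((k + 1 : ℤ) : ℝ) * s)) * M) := by
          gcongr <;> exact hb1 _ _
      _ = (2 ^ s + 1 + 2 ^ (-s)) * M := by
          rw [mul_add, mul_add, h2, h2, h2, add_mul, add_mul]
          push_cast
          simp
  obtain ⟨C, hC, hw⟩ := exists_weighted_le (s := s) hφ hp1 hα hα1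
  have hwG : ∫⁻ ξ, weight ξ * G ξ ≠ ∞ := by
    refine ne_top_of_le_ne_top ?_ (hw G _ hGm hGk)
    refine ENNReal.mul_ne_top hC (ENNReal.mul_ne_top ?_ hf.2.ne)
    simp
  have hGt : ∀ᵐ ξ, G ξ ≠ ∞ := by
    filter_upwards [ae_lt_top (measurable_weight.mul hGm) hwG] with ξ hξ h1
    rw [Pi.mul_apply, h1, ENNReal.mul_top (weight_pos ξ).ne'] at hξ
    exact lt_irrefl _ hξ
  have hsum : ∀ᵐ ξ, HasSum (fun j => g j ξ) (∑' j, g j ξ) := by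
    filter_upwards [hGt] with ξ hξ
    refine Summable.hasSum (Summable.of_norm ?_)
    have := ENNReal.summable_toReal hξ
    simpa [toReal_enorm] using this
  have hm0 : AEStronglyMeasurable (fun ξ => ∑' j, g j ξ) volume :=
    aestronglyMeasurable_of_tendsto_ae (u := atTop)
      (f := fun (S : Finset ℤ) ξ => ∑ j ∈ S, g j ξ)
      (fun S => (Finset.measurable_fun_sum S fun j _ => hgm j).aestronglyMeasurable) hsum
  have hle : ∀ᵐ ξ, ‖hm0.mk _ ξ‖ₑ ≤ G ξ := by
    filter_upwards [hm0.ae_eq_mk] with ξ hξ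
    rw [← hξ]
    exact enorm_tsum_le_tsum_enorm
  have hgw : ∫⁻ ξ, weight ξ * ‖hm0.mk _ ξ‖ₑ ≠ ∞ := by
    refine ne_top_of_le_ne_top hwG (lintegral_mono_ae ?_)
    filter_upwards [hle] with ξ hξ
    gcongr
  have hgM : Measurable (hm0.mk _) := hm0.stronglyMeasurable_mk.measurable
  refine ⟨hm0.mk _, hgM, locallyIntegrable_of_weight hgM hgw, fun ψ =>
    ⟨integrable_schwartz_smul hgM hgw ψ, ?_⟩⟩
  -- By definition of the space `f` is the sum of its blocks as a distribution; on the other hand the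
  -- blocks can be summed under the integral sign.
  have h1 : HasSum (fun j => ∫ ξ, ψ ξ • g j ξ) (𝓕 f ψ) := by
    have := hf.1 (𝓕 ψ)
    have h4 : (fun j => ∫ ξ, ψ ξ • g j ξ) = fun j => block φ j f (𝓕 ψ) :=
      funext fun j => ((hg j).2 ψ).2.symm
    rw [h4]
    exact this
  have h2 : HasSum (fun j => ∫ ξ, ψ ξ • g j ξ) (∫ ξ, ∑' j, ψ ξ • g j ξ) := by
    refine hasSum_integral_of_summable_integral_norm (fun j => ((hg j).2 ψ).1) ?_
    simp_rw [fun j => integral_norm_eq_lintegral_enorm ((hg j).2 ψ).1.1]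
    refine ENNReal.summable_toReal ?_
    rw [← lintegral_tsum (f := fun j ξ => ‖ψ ξ • g j ξ‖ₑ) fun j =>
      (ψ.continuous.measurable.smul (hgm j)).enorm.aemeasurable]
    simp_rw [enorm_smul, ENNReal.tsum_mul_left]
    refine ne_top_of_le_ne_top (b := ENNReal.ofReal
      (2 * (Finset.Iic (1, 0)).sup (schwartzSeminormFamily ℂ E3 ℂ) ψ) * ∫⁻ ξ, weight ξ * G ξ)
      (ENNReal.mul_ne_top ENNReal.ofReal_ne_top hwG) ?_
    rw [← lintegral_const_mul' _ _ ENNReal.ofReal_ne_top]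
    refine lintegral_mono fun ξ => ?_
    rw [← mul_assoc]
    exact mul_le_mul_left (schwartz_enorm_le ψ ξ) _
  rw [h1.unique h2]
  refine integral_congr_ae ?_
  filter_upwards [hm0.ae_eq_mk, hsum] with ξ hξ hξ'
  rw [← hξ]
  exact (hξ'.const_smul (ψ ξ)).tsum_eq

/-! ### Real and divergence-free distributions -/

theorem fourierInv_neg_of_real {ψ : 𝓢(E3, ℂ)} (hψ : ∀ x, (ψ x).im = 0) (ξ : E3) :
    (𝓕⁻ ψ) (-ξ) = (starRingEnd ℂ) ((𝓕⁻ ψ) ξ) := by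
  rw [SchwartzMap.fourierInv_coe, Real.fourierInv_eq', Real.fourierInv_eq', ← integral_conj]
  refine integral_congr_ae (ae_of_all _ fun x => ?_)
  have h1 : (starRingEnd ℂ) (ψ x) = ψ x := Complex.conj_eq_iff_im.2 (hψ x)
  simp [h1, ← Complex.exp_conj, Complex.conj_ofReal, Complex.conj_ofNat]

theorem fourier_im_eq_zero {χ : 𝓢(E3, ℂ)} (hχ : ∀ ξ, χ (-ξ) = (starRingEnd ℂ) (χ ξ)) (x : E3) :
    ((𝓕 χ) x).im = 0 := by
  rw [← Complex.conj_eq_iff_im, SchwartzMap.fourier_coe, Real.fourier_eq', ← integral_conj,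
    ← integral_neg_eq_self (μ := volume)]
  refine integral_congr_ae (ae_of_all _ fun ξ => ?_)
  simp [hχ, ← Complex.exp_conj, Complex.conj_ofReal, Complex.conj_ofNat]

theorem IsGivenBy.isReal {f : VDist} {g : E3 → V3} (h : IsGivenBy (𝓕 f) g)
    (hg : ∀ᵐ ξ, g (-ξ) = conjV (g ξ)) : IsReal f := by
  intro ψ hψ i
  have h1 : conjV (f ψ) = f ψ := by
    rw [apply_eq_fourier, (h.2 _).2, ← conjV_integral]
    refine Eq.trans ?_ (integral_neg_eq_self (μ := volume) fun ξ => (𝓕⁻ ψ) ξ • g ξ)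
    refine integral_congr_ae ?_
    filter_upwards [hg] with ξ hξ
    rw [conjV_smul, ← hξ, fourierInv_neg_of_real hψ]
  rw [← Complex.conj_eq_iff_im, ← conjV_apply, h1]

theorem lintegral_weight_neg (g : E3 → ℝ≥0∞) :
    ∫⁻ ξ, weight ξ * g (-ξ) = ∫⁻ ξ, weight ξ * g ξ := by
  rw [← lintegral_neg_eq_self (μ := volume) fun ξ => weight ξ * g ξ]
  simp [weight]

/-- The Fourier transform of a real field is Hermitian. It suffices to test with the Fourier
transforms of `χ(ξ) + χ(-ξ)` and `i (χ(ξ) - χ(-ξ))` for real `χ`, which are real. -/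
theorem IsReal.ae_neg_eq {f : VDist} {g : E3 → V3} (hf : IsReal f) (h : IsGivenBy (𝓕 f) g)
    (hg : Measurable g) (hw : ∫⁻ ξ, weight ξ * ‖g ξ‖ₑ ≠ ∞) : ∀ᵐ ξ, g (-ξ) = conjV (g ξ) := by
  have hw1 : ∫⁻ ξ, weight ξ * ‖g (-ξ)‖ₑ ≠ ∞ := by
    rwa [lintegral_weight_neg fun ξ => ‖g ξ‖ₑ]
  have hw2 : ∫⁻ ξ, weight ξ * ‖conjV (g ξ)‖ₑ ≠ ∞ := by
    have : ∀ ξ, ‖conjV (g ξ)‖ₑ = ‖g ξ‖ₑ := fun ξ => by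
      rw [← ofReal_norm, conjV.norm_map, ofReal_norm]
    simpa only [this] using hw
  refine ae_eq_of_integral_contDiff_smul_eq (locallyIntegrable_of_weight (hg.comp measurable_neg) hw1)
    (locallyIntegrable_of_weight (conjV.continuous.measurable.comp hg) hw2) fun χ hχ hc => ?_
  set X := ofRealSchwartz χ hχ hc with hX
  have hc' : HasCompactSupport fun ξ => χ (-ξ) := hc.comp_homeomorph (Homeomorph.neg E3)
  set Y := ofRealSchwartz (fun ξ => χ (-ξ)) (hχ.comp contDiff_neg) hc' with hY
  have hXY : ∀ ξ, X (-ξ) = Y ξ := fun ξ => rfl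
  have hYX : ∀ ξ, Y (-ξ) = X ξ := fun ξ => by
    rw [hX, hY, ofRealSchwartz_apply, ofRealSchwartz_apply, neg_neg]
  have hXr : ∀ ξ, (starRingEnd ℂ) (X ξ) = X ξ := fun ξ => Complex.conj_ofReal _
  have hYr : ∀ ξ, (starRingEnd ℂ) (Y ξ) = Y ξ := fun ξ => Complex.conj_ofReal _
  have e1 : ∫ ξ, χ ξ • g (-ξ) = 𝓕 f Y := by
    rw [(h.2 Y).2, ← integral_ofReal_smul, ← integral_neg_eq_self (μ := volume)
      (fun ξ => Y ξ • g ξ)]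
    simp only [hYX]
    rfl
  have e2 : ∫ ξ, χ ξ • conjV (g ξ) = conjV (𝓕 f X) := by
    rw [(h.2 X).2, ← conjV_integral, ← integral_ofReal_smul]
    simp only [conjV_smul, hXr]
    rfl
  rw [e1, e2]
  have h1 := hf (𝓕 (X + Y)) (fourier_im_eq_zero fun ξ => by
    simp [hXY, hYX, hXr, hYr, add_comm])
  have h2 := hf (𝓕 (Complex.I • (X - Y))) (fourier_im_eq_zero fun ξ => by
    simp [hXY, hYX, hXr, hYr]; ring)
  have h3 : f (𝓕 (X + Y)) = 𝓕 f X + 𝓕 f Y := map_add (𝓕 f) X Y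
  have h4 : f (𝓕 (Complex.I • (X - Y))) = Complex.I • (𝓕 f X - 𝓕 f Y) := by
    rw [← map_sub, ← map_smul]; rfl
  ext i
  have h1 := h1 i
  have h2 := h2 i
  rw [h3] at h1
  rw [h4] at h2
  simp only [PiLp.add_apply, PiLp.sub_apply, PiLp.smul_apply, Complex.add_im, smul_eq_mul,
    Complex.I_mul_im, Complex.sub_re] at h1 h2
  rw [conjV_apply]
  apply Complex.ext
  · rw [Complex.conj_re]; linarith
  · rw [Complex.conj_im]; linarith

/-- The divergence has the symbol `2πi ξ ·`. -/
theorem sum_lineDeriv_eq {f : VDist} {g : E3 → V3} (h : IsGivenBy (𝓕 f) g) (χ : 𝓢(E3, ℂ)) :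
    ∑ i : Fin 3, (∂_{(EuclideanSpace.single i (1 : ℝ) : E3)} f) (𝓕 χ) i =
      (2 * Real.pi * Complex.I) * ∫ ξ, χ ξ • ∑ i, (ξ i : ℂ) * g ξ i := by
  have hint : ∀ i : Fin 3, Integrable (fun ξ : E3 => χ ξ • ((ξ i : ℂ) * g ξ i)) ∧
      (∂_{(EuclideanSpace.single i (1 : ℝ) : E3)} f) (𝓕 χ) i =
        (2 * Real.pi * Complex.I) * ∫ ξ : E3, χ ξ • ((ξ i : ℂ) * g ξ i) := by
    intro i
    have hm : (fun ξ : E3 => ((inner ℝ ξ (EuclideanSpace.single i (1 : ℝ) : E3) : ℝ) :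
        ℂ)).HasTemperateGrowth := by fun_prop
    have h1 := (h.smulLeft hm).2 χ
    have h2 : 𝓕 (∂_{(EuclideanSpace.single i (1 : ℝ) : E3)} f) χ =
        (2 * Real.pi * Complex.I) • ∫ ξ : E3, χ ξ •
          ((inner ℝ ξ (EuclideanSpace.single i (1 : ℝ) : E3) : ℝ) : ℂ) • g ξ := by
      rw [TemperedDistribution.fourier_lineDerivOp_eq, ← h1.2]
      rfl
    have h3 : ∀ ξ : E3, (EuclideanSpace.proj i : V3 →L[ℂ] ℂ) (χ ξ •
        ((inner ℝ ξ (EuclideanSpace.single i (1 : ℝ) : E3) : ℝ) : ℂ) • g ξ) =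
          χ ξ • ((ξ i : ℂ) * g ξ i) := fun ξ => by simp [EuclideanSpace.inner_single_right]
    have h4 := (EuclideanSpace.proj i : V3 →L[ℂ] ℂ).integrable_comp h1.1
    have h5 := (EuclideanSpace.proj i : V3 →L[ℂ] ℂ).integral_comp_comm h1.1
    simp only [h3] at h4 h5
    refine ⟨h4, ?_⟩
    rw [h5]
    exact congrArg (fun v : V3 => v i) h2
  simp_rw [fun i => (hint i).2, Finset.smul_sum]
  rw [integral_finsetSum _ fun i _ => (hint i).1, Finset.mul_sum]

theorem IsGivenBy.isDivFree {f : VDist} {g : E3 → V3} (h : IsGivenBy (𝓕 f) g)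
    (hg : ∀ᵐ ξ, ∑ k, (ξ k : ℂ) * g ξ k = 0) : IsDivFree f := by
  intro ψ
  have h1 := sum_lineDeriv_eq h (𝓕⁻ ψ)
  have h2 : ∫ ξ, (𝓕⁻ ψ) ξ • ∑ i, (ξ i : ℂ) * g ξ i = 0 := by
    refine integral_eq_zero_of_ae ?_
    filter_upwards [hg] with ξ hξ
    simp [hξ]
  rw [h2, mul_zero, FourierTransform.fourier_fourierInv_eq] at h1
  exact h1

theorem IsDivFree.ae_sum_eq_zero {f : VDist} {g : E3 → V3} (hf : IsDivFree f)
    (h : IsGivenBy (𝓕 f) g) : ∀ᵐ ξ, ∑ k, (ξ k : ℂ) * g ξ k = 0 := by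
  refine ae_eq_zero_of_integral_contDiff_smul_eq_zero ?_ fun χ hχ hc => ?_
  · refine locallyIntegrable_finsetSum _ fun i _ x => ?_
    obtain ⟨S, hS, hi⟩ := h.1.continuous_smul (g := fun ξ : E3 => (ξ i : ℂ)) (by fun_prop) x
    exact ⟨S, hS, (EuclideanSpace.proj i : V3 →L[ℂ] ℂ).integrable_comp hi⟩
  · have h1 := sum_lineDeriv_eq h (ofRealSchwartz χ hχ hc)
    rw [hf] at h1
    have h2 : (2 * Real.pi * Complex.I : ℂ) ≠ 0 := by simp [Real.pi_ne_zero]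
    have h3 := (mul_eq_zero.1 h1.symm).resolve_left h2
    simpa only [ofRealSchwartz_apply, Complex.coe_smul] using h3

/-- A real divergence-free distribution with measurable Fourier transform: the Fourier transform can
be chosen exactly Hermitian and orthogonal to `ξ`. -/
theorem exists_hermitian {f : VDist} {g : E3 → V3} (hr : IsReal f) (hd : IsDivFree f)
    (h : IsGivenBy (𝓕 f) g) (hg : Measurable g) (hw : ∫⁻ ξ, weight ξ * ‖g ξ‖ₑ ≠ ∞) :
    ∃ U : E3 → V3, Measurable U ∧ IsGivenBy (𝓕 f) U ∧ (∀ ξ, U (-ξ) = conjV (U ξ)) ∧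
      ∀ ξ, ∑ k, (ξ k : ℂ) * U ξ k = 0 := by
  -- Both properties hold off a null set; since that set is symmetric, `g` may be set to `0` on it.
  set S : Set E3 := {ξ | g (-ξ) = conjV (g ξ) ∧ ∑ k, (ξ k : ℂ) * g ξ k = 0} with hS
  have hSm : MeasurableSet S := by
    refine (measurableSet_eq_fun (hg.comp measurable_neg)
      (conjV.continuous.measurable.comp hg)).inter (measurableSet_eq_fun ?_ measurable_const)
    fun_prop
  have hSn : ∀ ξ ∈ S, -ξ ∈ S := by
    rintro ξ ⟨h1, h2⟩
    refine ⟨?_, ?_⟩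
    · rw [neg_neg, h1]
      ext i
      simp [conjV_apply]
    · rw [h1]
      have := congrArg (starRingEnd ℂ) h2
      simpa [conjV_apply] using this
  have hSn' : ∀ ξ, -ξ ∈ S ↔ ξ ∈ S := fun ξ => ⟨fun h => by simpa using hSn _ h, hSn ξ⟩
  refine ⟨S.indicator g, hg.indicator hSm, h.congr ?_, fun ξ => ?_, fun ξ => ?_⟩
  · filter_upwards [hr.ae_neg_eq h hg hw, hd.ae_sum_eq_zero h] with ξ h1 h2
    rw [Set.indicator_of_mem (show ξ ∈ S from ⟨h1, h2⟩)]
  · by_cases hξ : ξ ∈ S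
    · rw [Set.indicator_of_mem hξ, Set.indicator_of_mem (hSn ξ hξ), hξ.1]
    · rw [Set.indicator_of_notMem hξ, Set.indicator_of_notMem (mt (hSn' ξ).1 hξ), map_zero]
  · by_cases hξ : ξ ∈ S
    · rw [Set.indicator_of_mem hξ]; exact hξ.2
    · rw [Set.indicator_of_notMem hξ]; simp

/-! ### Time intervals and Chemin-Lerner norms -/

theorem timeIoo_ofReal (b : ℝ) : timeIoo (ENNReal.ofReal b) = Set.Ioo 0 b := by
  ext t
  refine ⟨fun h => ⟨h.1, ?_⟩, fun h => ⟨h.1, (ENNReal.ofReal_lt_ofReal_iff (h.1.trans h.2)).2 h.2⟩⟩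
  have h2 : ENNReal.ofReal t < ENNReal.ofReal b := h.2
  rw [ENNReal.ofReal_lt_ofReal_iff'] at h2
  exact h2.1

theorem timeIoo_mono {T T' : ℝ≥0∞} (h : T ≤ T') : timeIoo T ⊆ timeIoo T' :=
  fun _ ht => ⟨ht.1, lt_of_lt_of_le ht.2 h⟩

theorem timeIco_mono {T T' : ℝ≥0∞} (h : T ≤ T') : timeIco T ⊆ timeIco T' :=
  fun _ ht => ⟨ht.1, lt_of_lt_of_le ht.2 h⟩

theorem Ioo_subset_timeIoo {t : ℝ} {T : ℝ≥0∞} (ht : t ∈ timeIco T) :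
    Set.Ioo 0 t ⊆ timeIoo T := by
  rw [← timeIoo_ofReal]
  exact timeIoo_mono ht.2.le

/-- The Chemin-Lerner norms for all exponents `r ∈ [1, ∞]` are bounded by that of
`L̃^∞(FḂ^s) ∩ L̃¹(FḂ^{s+2})`. -/
theorem clNorm_le_slabNorm {s : ℝ} {p q r : ℝ≥0∞} (hq : 1 ≤ q) (hr : 1 ≤ r) {b : ℝ}
    {u : ℝ → VDist} {F : ℝ → E3 → ℝ≥0∞}
    (hm : ∀ j, AEMeasurable (fun t => flNorm p (block φ j (u t))) (volume.restrict (Set.Ioo 0 b)))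
    (h : ∀ t ∈ Set.Ioo 0 b, ∀ j, flNorm p (block φ j (u t)) ≤ blockNorm φ p j (F t)) :
    clNorm φ (s + (2 / r).toReal) p q r (ENNReal.ofReal b) u ≤ slabNorm φ s p q 0 b F := by
  unfold clNorm slabNorm
  rw [timeIoo_ofReal]
  refine seqNorm_mono hq fun j => ?_
  have h1 := eLpNorm_le_max_one_top hr (hm j) (2 ^ ((j : ℝ) * 2))
  have h2 : ∀ᵐ t ∂(volume.restrict (Set.Ioo 0 b)),
      flNorm p (block φ j (u t)) ≤ blockNorm φ p j (F t) := by
    filter_upwards [ae_restrict_mem measurableSet_Ioo] with t ht using h t ht j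
  have h3 : (2 : ℝ≥0∞) ^ ((j : ℝ) * (s + (2 / r).toReal)) =
      2 ^ ((j : ℝ) * s) * ((2 : ℝ≥0∞) ^ ((j : ℝ) * 2)) ^ (1 / r).toReal := by
    rw [← ENNReal.rpow_mul, ← two_rpow_add, ENNReal.toReal_div, ENNReal.toReal_div]
    simp only [ENNReal.toReal_ofNat, ENNReal.toReal_one]
    ring_nf
  rw [h3, mul_assoc]
  refine mul_le_mul_right (h1.trans (add_le_add (eLpNorm_mono_ennreal h2) ?_)) _
  refine mul_le_mul_right ?_ _
  rw [eLpNorm_one_eq_lintegral_enorm]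
  exact lintegral_mono_ae h2

/-- The end points `r = ∞` and `r = 1` of the Chemin-Lerner norms control the working norm. -/
theorem slabNorm_le_clNorm_add {s : ℝ} {p q : ℝ≥0∞} (hq : 1 ≤ q) {b : ℝ}
    {u : ℝ → VDist} {F : ℝ → E3 → ℝ≥0∞}
    (h : ∀ᵐ t ∂(volume.restrict (Set.Ioo 0 b)), ∀ j,
      blockNorm φ p j (F t) = flNorm p (block φ j (u t))) :
    slabNorm φ s p q 0 b F ≤ clNorm φ (s + (2 / (∞ : ℝ≥0∞)).toReal) p q ∞ (ENNReal.ofReal b) u +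
      clNorm φ (s + (2 / (1 : ℝ≥0∞)).toReal) p q 1 (ENNReal.ofReal b) u := by
  unfold clNorm slabNorm
  rw [timeIoo_ofReal]
  refine le_trans (seqNorm_mono hq fun j => ?_) (seqNorm_add_le hq _ _)
  have h1 : ∀ᵐ t ∂(volume.restrict (Set.Ioo 0 b)),
      blockNorm φ p j (F t) = flNorm p (block φ j (u t)) := by
    filter_upwards [h] with t ht using ht j
  rw [slab, eLpNorm_congr_ae h1, lintegral_congr_ae h1, eLpNorm_one_eq_lintegral_enorm, mul_add]
  simp only [ENNReal.div_top, ENNReal.toReal_zero, add_zero, div_one, ENNReal.toReal_ofNat,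
    enorm_eq_self]
  refine add_le_add le_rfl (le_of_eq ?_)
  rw [mul_add, two_rpow_add, mul_assoc]

/-! ### Uniqueness of mild solutions -/

theorem convectionSymbol_congr {f g : E3 → V3} (h : ∀ᵐ η, f η = g η) (ξ : E3) :
    convectionSymbol f ξ = convectionSymbol g ξ := by
  have h1 : ∀ᵐ η, f (ξ - η) = g (ξ - η) :=
    (Measure.measurePreserving_sub_left volume ξ).quasiMeasurePreserving.ae h
  unfold convectionSymbol
  refine Finset.sum_congr rfl fun k _ => ?_
  congr 1
  refine integral_congr_ae ?_
  filter_upwards [h, h1] with η h2 h3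
  rw [h2, h3]

theorem duhamel_congr (ν : ℝ) {f g : ℝ → E3 → V3} {t : ℝ}
    (h : ∀ᵐ τ ∂(volume.restrict (Set.Ioo 0 t)), ∀ᵐ η, f τ η = g τ η) (ξ : E3) :
    duhamel ν f t ξ = duhamel ν g t ξ := by
  refine integral_congr_ae ?_
  filter_upwards [h] with τ hτ
  rw [convectionSymbol_congr hτ]

/-- The function of time and frequency in the definition of a mild solution can be replaced by a
jointly measurable one in the Duhamel term. -/
theorem IsMildSolution.exists_measurable {ν : ℝ} {T : ℝ≥0∞} {u₀ : VDist} {u : ℝ → VDist}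
    (hu : IsMildSolution ν T u₀ u) : ∃ U W : ℝ → E3 → V3, Measurable (Function.uncurry W) ∧
      (∀ t ∈ timeIco T, IsGivenBy (𝓕 (u t)) (U t)) ∧
      (∀ᵐ t ∂(volume.restrict (timeIoo T)), ∀ᵐ ξ, U t ξ = W t ξ) ∧
      ∀ t ∈ timeIco T, ∀ᵐ ξ, ConvIntegrable W t ξ ∧
        U t ξ = heatSymbol ν t ξ • U 0 ξ - FourierHerz.duhamel ν W t ξ := by
  obtain ⟨U, hUm, hU, hd⟩ := hu.duhamel
  have hae := hUm.ae_eq_mk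
  set W : ℝ → E3 → V3 := fun t ξ => hUm.mk _ (t, ξ) with hW
  have hWm : Measurable (Function.uncurry W) := hUm.stronglyMeasurable_mk.measurable
  have hUW : ∀ᵐ t ∂(volume.restrict (timeIoo T)), ∀ᵐ ξ, U t ξ = W t ξ :=
    Measure.ae_ae_of_ae_prod hae
  refine ⟨U, W, hWm, hU, hUW, fun t ht => ?_⟩
  have hle : volume.restrict (Set.Ioo 0 t) ≤ volume.restrict (timeIoo T) :=
    Measure.restrict_mono (Ioo_subset_timeIoo ht) le_rfl
  have hae' : ∀ᵐ z ∂((volume.restrict (Set.Ioo 0 t)).prod (volume : Measure E3)),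
      U z.1 z.2 = W z.1 z.2 := ae_mono (Measure.prod_mono hle le_rfl) hae
  filter_upwards [hd t ht] with ξ hξ
  refine ⟨fun k => (hξ.1 k).congr ?_, ?_⟩
  · have h1 := ((MeasurePreserving.id (volume.restrict (Set.Ioo 0 t))).prod
      (Measure.measurePreserving_sub_left (volume : Measure E3) ξ)).quasiMeasurePreserving.ae hae'
    filter_upwards [h1, hae'] with z h2 h3
    simp only [Prod.map_fst, Prod.map_snd, id_eq] at h2
    rw [h2, h3]
  · rw [hξ.2, ← duhamel_congr ν (ae_mono hle hUW) ξ]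
    rfl

theorem IsMildSolution.mono {ν : ℝ} {T T' : ℝ≥0∞} {u₀ : VDist} {u : ℝ → VDist}
    (hu : IsMildSolution ν T' u₀ u) (h : T ≤ T') : IsMildSolution ν T u₀ u := by
  obtain ⟨U, hUm, hU, hd⟩ := hu.duhamel
  exact ⟨fun t ht => hu.real t (timeIco_mono h ht), fun t ht => hu.divFree t (timeIco_mono h ht),
    hu.initial, U, hUm.mono_measure (Measure.prod_mono
      (Measure.restrict_mono (timeIoo_mono h) le_rfl) le_rfl),
    fun t ht => hU t (timeIco_mono h ht), fun t ht => hd t (timeIco_mono h ht)⟩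

/-- Once the Fourier transforms agree at almost all times, the Duhamel formula gives equality at
every time. -/
theorem IsMildSolution.unique (hφ : IsLittlewoodPaley φ) {ν : ℝ} (hν : 0 < ν) {p q : ℝ≥0∞}
    {s e : ℝ} (hp1 : 1 ≤ p) (hp : p ≠ ∞) (hq : 1 ≤ q) (he : 0 < e) {C : ℝ≥0∞} (hC : C ≠ ∞)
    (hbil : ∀ (a b : ℝ), a ≤ b → ∀ f g : ℝ → E3 → ℝ≥0∞, Measurable (Function.uncurry f) →
      Measurable (Function.uncurry g) → slabNorm φ s p q a b (duhamelMaj ν f g a) ≤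
        C * ENNReal.ofReal (b - a) ^ e * slabNorm φ s p q a b f * slabNorm φ s p q a b g)
    {T : ℝ≥0∞} {u₀ : VDist} {u v : ℝ → VDist} (hu : IsMildSolution ν T u₀ u)
    (hv : IsMildSolution ν T u₀ v)
    (hun : ∀ r : ℝ≥0∞, 1 ≤ r → ∀ T' < T, clNorm φ (s + (2 / r).toReal) p q r T' u < ∞)
    (hvn : ∀ r : ℝ≥0∞, 1 ≤ r → ∀ T' < T, clNorm φ (s + (2 / r).toReal) p q r T' v < ∞) :
    ∀ t ∈ timeIco T, u t = v t := by
  obtain ⟨U, W, hWm, hU, hUW, hUd⟩ := hu.exists_measurable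
  obtain ⟨U', W', hWm', hU', hUW', hUd'⟩ := hv.exists_measurable
  intro t ht
  have h0 : (0 : ℝ) ∈ timeIco T :=
    ⟨le_rfl, lt_of_le_of_lt (ENNReal.ofReal_le_ofReal ht.1) ht.2⟩
  have hinit : ∀ᵐ ξ, U 0 ξ = U' 0 ξ := by
    have h1 := hU 0 h0
    have h2 := hU' 0 h0
    rw [hu.initial] at h1
    rw [hv.initial] at h2
    exact h1.ae_eq h2
  have hle : volume.restrict (Set.Ioo 0 t) ≤ volume.restrict (timeIoo T) :=
    Measure.restrict_mono (Ioo_subset_timeIoo ht) le_rfl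
  have hUW1 := ae_mono hle hUW
  have hUW1' := ae_mono hle hUW'
  have hmem : ∀ᵐ τ ∂(volume.restrict (Set.Ioo 0 t)), τ ∈ timeIco T := by
    filter_upwards [ae_restrict_mem measurableSet_Ioo] with τ hτ
    exact ⟨hτ.1.le, (Ioo_subset_timeIoo ht hτ).2⟩
  have hfin : ∀ {w : ℝ → VDist} {U W : ℝ → E3 → V3},
      (∀ t ∈ timeIco T, IsGivenBy (𝓕 (w t)) (U t)) →
      (∀ᵐ τ ∂(volume.restrict (Set.Ioo 0 t)), ∀ᵐ ξ, U τ ξ = W τ ξ) →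
      (∀ r : ℝ≥0∞, 1 ≤ r → ∀ T' < T, clNorm φ (s + (2 / r).toReal) p q r T' w < ∞) →
      slabNorm φ s p q 0 t (fun t ξ => ‖W t ξ‖ₑ) ≠ ∞ := by
    intro w U W hU hUW hn
    refine ne_top_of_le_ne_top ?_ (slabNorm_le_clNorm_add (u := w) hq ?_)
    · exact ENNReal.add_ne_top.2 ⟨(hn ∞ le_top _ ht.2).ne, (hn 1 le_rfl _ ht.2).ne⟩
    · filter_upwards [hUW, hmem] with τ h1 h2 j
      exact (hφ.flNorm_block ((hU τ h2).congr h1) p j).symm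
  have hkey := ae_eq_of_duhamel (φ := φ) (b := t) hφ hν hp1 hp hq he hC hbil hWm hWm'
    (hfin hU hUW1 hun) (hfin hU' hUW1' hvn) (by
      rw [← ae_restrict_iff' measurableSet_Ioo]
      filter_upwards [hUW1, hUW1', hmem] with τ h1 h2 h3
      filter_upwards [h1, h2, hUd τ h3, hUd' τ h3, hinit] with ξ h4 h5 h6 h7 h8
      refine ⟨h6.1, h7.1, ?_⟩
      rw [← h4, ← h5, h6.2, h7.2, h8]
      abel)
  rw [← ae_restrict_iff' measurableSet_Ioo] at hkey
  refine (hU t ht).dist_eq (hU' t ht) ?_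
  filter_upwards [hUd t ht, hUd' t ht, hinit] with ξ h1 h2 h3
  rw [h1.2, h2.2, h3, duhamel_congr ν hkey ξ]

/-! ### Estimates at fixed times -/

/-- The Fourier-Herz norm as a function of the modulus of the Fourier transform. -/
def freqNorm (φ : E3 → ℝ) (s : ℝ) (p q : ℝ≥0∞) (f : E3 → ℝ≥0∞) : ℝ≥0∞ :=
  seqNorm q fun j => 2 ^ ((j : ℝ) * s) * blockNorm φ p j f

section

variable {s : ℝ} {p q : ℝ≥0∞}

theorem freqNorm_mono (hq : 1 ≤ q) {f g : E3 → ℝ≥0∞} (h : ∀ᵐ ξ, f ξ ≤ g ξ) :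
    freqNorm φ s p q f ≤ freqNorm φ s p q g :=
  seqNorm_mono hq fun _ => mul_le_mul_right (blockNorm_mono h) _

theorem freqNorm_add_le (hφ : IsLittlewoodPaley φ) (hp1 : 1 ≤ p) (hq : 1 ≤ q) {f g : E3 → ℝ≥0∞}
    (hf : Measurable f) (hg : Measurable g) :
    freqNorm φ s p q (fun ξ => f ξ + g ξ) ≤ freqNorm φ s p q f + freqNorm φ s p q g := by
  refine le_trans (seqNorm_mono hq fun j => ?_) (seqNorm_add_le hq _ _)
  rw [← mul_add]
  exact mul_le_mul_right (blockNorm_add_le hφ hp1 j hf hg) _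

theorem freqNorm_const_mul (hq : 1 ≤ q) {c : ℝ≥0∞} (hc : c ≠ ∞) (f : E3 → ℝ≥0∞) :
    freqNorm φ s p q (fun ξ => c * f ξ) = c * freqNorm φ s p q f := by
  simp only [freqNorm, blockNorm_const_mul c hc]
  rw [← seqNorm_const_mul hq]
  congr 1
  funext j
  ring

theorem IsLittlewoodPaley.fhNorm_eq_freqNorm (hφ : IsLittlewoodPaley φ) {f : VDist} {g : E3 → V3}
    (h : IsGivenBy (𝓕 f) g) : fhNorm φ s p q f = freqNorm φ s p q fun ξ => ‖g ξ‖ₑ :=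
  hφ.fhNorm_eq h s p q

/-- The embedding of `FḂ^s_{p,q}` in the weighted `FL¹` space. -/
theorem exists_weight_le_freqNorm (hφ : IsLittlewoodPaley φ) (hp1 : 1 ≤ p) (hq : 1 ≤ q)
    (hα : 0 < 3 * (1 - 1 / p.toReal) - s) (hα1 : 3 * (1 - 1 / p.toReal) - s < 1) :
    ∃ C : ℝ≥0∞, C ≠ ∞ ∧ ∀ f : E3 → ℝ≥0∞, Measurable f →
      ∫⁻ ξ, weight ξ * f ξ ≤ C * freqNorm φ s p q f := by
  obtain ⟨C, hC, h⟩ := exists_weighted_le (s := s) hφ hp1 hα hα1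
  exact ⟨C, hC, fun f hf => h f _ hf fun k => le_seqNorm hq _ k⟩

theorem ae_ne_top_of_weight {f : E3 → ℝ≥0∞} (hf : Measurable f)
    (h : ∫⁻ ξ, weight ξ * f ξ ≠ ∞) : ∀ᵐ ξ, f ξ ≠ ∞ := by
  filter_upwards [ae_lt_top (measurable_weight.mul hf) h] with ξ hξ h1
  rw [Pi.mul_apply, h1, ENNReal.mul_top (weight_pos ξ).ne'] at hξ
  exact lt_irrefl _ hξ

theorem abs_heatSymbol_sub_one_le {ν t : ℝ} (hν : 0 ≤ ν) (ht : 0 ≤ t) (ξ : E3) :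
    |heatSymbol ν t ξ - 1| ≤ 4 * Real.pi ^ 2 * ν * t * ‖ξ‖ ^ 2 := by
  rw [abs_sub_comm, abs_of_nonneg (by linarith [heatSymbol_le_one hν ht ξ])]
  have := Real.add_one_le_exp (-(4 * Real.pi ^ 2 * ν * t * ‖ξ‖ ^ 2))
  unfold heatSymbol
  linarith

theorem enorm_heatSymbol_sub_one_le_one {ν t : ℝ} (hν : 0 ≤ ν) (ht : 0 ≤ t) (ξ : E3) :
    ‖heatSymbol ν t ξ - 1‖ₑ ≤ 1 := by
  rw [← ofReal_norm, Real.norm_eq_abs, ENNReal.ofReal_le_one, abs_le]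
  constructor <;> linarith [heatSymbol_le_one hν ht ξ, heatSymbol_pos ν t ξ]

theorem measurable_heatSymbol_sub_one (ν t : ℝ) :
    Measurable fun ξ : E3 => ‖heatSymbol ν t ξ - 1‖ₑ := by
  unfold heatSymbol; fun_prop

/-- Strong continuity of the heat semigroup at `t = 0` for `q < ∞`. -/
theorem tendsto_freqNorm_heat_sub_one (hφ : IsLittlewoodPaley φ) (hq : 1 ≤ q) (hq' : q ≠ ∞) {ν : ℝ}
    (hν : 0 ≤ ν) {f : E3 → ℝ≥0∞} (hf : freqNorm φ s p q f ≠ ∞) :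
    Tendsto (fun t : ℝ => freqNorm φ s p q fun ξ => ‖heatSymbol ν t ξ - 1‖ₑ * f ξ)
      (𝓝[≥] 0) (𝓝 0) := by
  refine tendsto_seqNorm_of_dominated hq hq' hf ?_ fun j => ?_
  · filter_upwards [self_mem_nhdsWithin] with t ht j
    refine mul_le_mul_right (blockNorm_mono (ae_of_all _ fun ξ => ?_)) _
    exact mul_le_of_le_one_left zero_le (enorm_heatSymbol_sub_one_le_one hν ht ξ)
  · have hfin : 2 ^ ((j : ℝ) * s) * blockNorm φ p j f ≠ ∞ :=
      ne_top_of_le_ne_top hf (le_seqNorm hq _ j)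
    set K : ℝ := 4 * Real.pi ^ 2 * ν * (8 / 3 * (2 : ℝ) ^ j) ^ 2 with hK
    have hle : ∀ᶠ t : ℝ in 𝓝[≥] 0,
        2 ^ ((j : ℝ) * s) * blockNorm φ p j (fun ξ => ‖heatSymbol ν t ξ - 1‖ₑ * f ξ) ≤
          ENNReal.ofReal (K * t) * (2 ^ ((j : ℝ) * s) * blockNorm φ p j f) := by
      filter_upwards [self_mem_nhdsWithin] with t ht
      have ht : 0 ≤ t := ht
      rw [mul_left_comm]
      refine mul_le_mul_right (blockNorm_mul_le hφ ENNReal.ofReal_ne_top fun ξ _ h2 => ?_) _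
      rw [← ofReal_norm, Real.norm_eq_abs]
      refine ENNReal.ofReal_le_ofReal ((abs_heatSymbol_sub_one_le hν ht ξ).trans ?_)
      calc 4 * Real.pi ^ 2 * ν * t * ‖ξ‖ ^ 2
          ≤ 4 * Real.pi ^ 2 * ν * t * (8 / 3 * (2 : ℝ) ^ j) ^ 2 := by gcongr
        _ = K * t := by rw [hK]; ring
    refine tendsto_of_tendsto_of_tendsto_of_le_of_le' tendsto_const_nhds ?_
      (Eventually.of_forall fun _ => zero_le) hle
    have h1 : Tendsto (fun t : ℝ => ENNReal.ofReal (K * t)) (𝓝[≥] 0) (𝓝 0) := by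
      have h2 : Continuous fun t : ℝ => ENNReal.ofReal (K * t) :=
        ENNReal.continuous_ofReal.comp (by fun_prop)
      have h3 := h2.tendsto 0
      simp only [mul_zero, ENNReal.ofReal_zero] at h3
      exact h3.mono_left nhdsWithin_le_nhds
    simpa using ENNReal.Tendsto.mul_const h1 (Or.inr hfin)

/-- Weak continuity of the heat semigroup at `t = 0`. -/
theorem tendsto_lintegral_heat_sub_one {ν : ℝ} (hν : 0 ≤ ν) {f : E3 → ℝ≥0∞} (hfm : Measurable f)
    (hf : ∫⁻ ξ, weight ξ * f ξ ≠ ∞) :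
    Tendsto (fun t : ℝ => ∫⁻ ξ, weight ξ * (‖heatSymbol ν t ξ - 1‖ₑ * f ξ)) (𝓝[≥] 0) (𝓝 0) := by
  have h0 : ∫⁻ _ : E3, (0 : ℝ≥0∞) = 0 := lintegral_zero
  rw [← h0]
  refine tendsto_lintegral_filter_of_dominated_convergence (fun ξ => weight ξ * f ξ)
    (Eventually.of_forall fun t =>
      measurable_weight.mul ((measurable_heatSymbol_sub_one ν t).mul hfm)) ?_ hf ?_
  · filter_upwards [self_mem_nhdsWithin] with t ht
    refine ae_of_all _ fun ξ => mul_le_mul_right ?_ _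
    exact mul_le_of_le_one_left zero_le (enorm_heatSymbol_sub_one_le_one hν ht ξ)
  · filter_upwards [ae_ne_top_of_weight hfm hf] with ξ hξ
    have h1 : Continuous fun t : ℝ => ‖heatSymbol ν t ξ - 1‖ₑ := by
      unfold heatSymbol; fun_prop
    have h2 := (h1.tendsto 0).mono_left (nhdsWithin_le_nhds (s := Set.Ici 0))
    have h3 : ‖heatSymbol ν 0 ξ - 1‖ₑ = 0 := by simp [heatSymbol]
    rw [h3] at h2
    have h4 := ENNReal.Tendsto.const_mul (ENNReal.Tendsto.mul_const h2 (Or.inr hξ))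
      (Or.inr (show weight ξ ≠ ∞ from ENNReal.ofReal_ne_top))
    simpa using h4

/-! ### Continuity in time of the solution -/

/-- The quantities that control the solution on `(0, b)`: the initial value has finite norm, and `D h`
bounds the flux over intervals of length `h` in the Fourier-Herz norm, where `D h → 0` as `h → 0`. -/
structure MajBound (φ : E3 → ℝ) (s : ℝ) (p q : ℝ≥0∞) (ν b : ℝ) (u₀ : E3 → V3) (D : ℝ → ℝ≥0∞) :
    Prop where
  measurable : Measurable u₀
  initial_ne_top : freqNorm φ s p q (fun ξ => ‖u₀ ξ‖ₑ) ≠ ∞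
  flux_le : ∀ a t, 0 ≤ a → a ≤ t → t ≤ b →
    freqNorm φ s p q (fluxMaj (maj ν u₀) (maj ν u₀) a t) ≤ D (t - a)
  ne_top : ∀ h, D h ≠ ∞
  continuous : Continuous D
  zero : D 0 = 0

variable {ν b : ℝ} {u₀ : E3 → V3} {D : ℝ → ℝ≥0∞}

theorem MajBound.freqNorm_maj_le (H : MajBound φ s p q ν b u₀ D) (hφ : IsLittlewoodPaley φ)
    (hν : 0 ≤ ν) (hp1 : 1 ≤ p) (hq : 1 ≤ q) {t : ℝ} (ht : 0 ≤ t) (htb : t ≤ b) :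
    freqNorm φ s p q (maj ν u₀ t) ≤ freqNorm φ s p q (fun ξ => ‖u₀ ξ‖ₑ) + D t := by
  have hu := H.measurable
  have h1 := H.flux_le 0 t le_rfl ht htb
  rw [sub_zero] at h1
  refine le_trans ?_ (add_le_add le_rfl h1)
  refine le_trans (freqNorm_mono hq (ae_of_all _ fun ξ => ?_)) (freqNorm_add_le hφ hp1 hq hu.enorm
    (measurable_fluxMaj (measurable_maj hu) (measurable_maj hu) 0 t))
  rw [maj_eq hu]
  refine add_le_add (mul_le_of_le_one_left zero_le ?_) (duhamelMaj_le_fluxMaj hν _ _ 0 t ξ)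
  rw [ENNReal.ofReal_le_one]
  exact heatSymbol_le_one hν ht ξ

theorem MajBound.lintegral_maj_ne_top (H : MajBound φ s p q ν b u₀ D) (hφ : IsLittlewoodPaley φ)
    (hν : 0 ≤ ν) (hp1 : 1 ≤ p) (hq : 1 ≤ q) (hα : 0 < 3 * (1 - 1 / p.toReal) - s)
    (hα1 : 3 * (1 - 1 / p.toReal) - s < 1) {t : ℝ} (ht : 0 ≤ t) (htb : t ≤ b) :
    ∫⁻ ξ, weight ξ * maj ν u₀ t ξ ≠ ∞ := by
  obtain ⟨C, hC, h⟩ := exists_weight_le_freqNorm (s := s) (q := q) hφ hp1 hq hα hα1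
  refine ne_top_of_le_ne_top ?_ (h _ (measurable_maj H.measurable).of_uncurry_left)
  exact ENNReal.mul_ne_top hC (ne_top_of_le_ne_top
    (ENNReal.add_ne_top.2 ⟨H.initial_ne_top, H.ne_top t⟩)
    (H.freqNorm_maj_le hφ hν hp1 hq ht htb))

theorem MajBound.ae_maj_ne_top (H : MajBound φ s p q ν b u₀ D) (hφ : IsLittlewoodPaley φ)
    (hν : 0 ≤ ν) (hp1 : 1 ≤ p) (hq : 1 ≤ q) (hα : 0 < 3 * (1 - 1 / p.toReal) - s)
    (hα1 : 3 * (1 - 1 / p.toReal) - s < 1) {t : ℝ} (ht : 0 ≤ t) (htb : t ≤ b) :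
    ∀ᵐ ξ, maj ν u₀ t ξ ≠ ∞ :=
  ae_ne_top_of_weight (measurable_maj H.measurable).of_uncurry_left
    (H.lintegral_maj_ne_top hφ hν hp1 hq hα hα1 ht htb)

/-- The Fourier-Herz norm of the increment of the solution between two times `≥ η`. For fixed `η` the
first term is small if `t' - t` is, and `η` makes the second one small. -/
theorem MajBound.freqNorm_increment_le (H : MajBound φ s p q ν b u₀ D) (hφ : IsLittlewoodPaley φ)
    (hν : 0 ≤ ν) (hp1 : 1 ≤ p) (hq : 1 ≤ q) (hα : 0 < 3 * (1 - 1 / p.toReal) - s)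
    (hα1 : 3 * (1 - 1 / p.toReal) - s < 1) {η t t' : ℝ} (hη : 0 < η) (ht : η ≤ t) (htt' : t ≤ t')
    (htb : t' ≤ b) :
    freqNorm φ s p q (fun ξ => ‖sol ν u₀ t' ξ - sol ν u₀ t ξ‖ₑ) ≤
      ENNReal.ofReal ((t' - t) / η) * (freqNorm φ s p q (fun ξ => ‖u₀ ξ‖ₑ) + D t') +
        D (t' - t + η) := by
  have hu := H.measurable
  have hm := measurable_maj (ν := ν) hu
  have h1 := H.flux_le 0 t' le_rfl (by linarith) htb
  have h2 := H.flux_le (t - η) t' (by linarith) (by linarith) htb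
  rw [sub_zero] at h1
  rw [show t' - (t - η) = t' - t + η by ring] at h2
  have hf0 := measurable_fluxMaj hm hm 0 t'
  have hf1 := measurable_fluxMaj hm hm (t - η) t'
  calc freqNorm φ s p q (fun ξ => ‖sol ν u₀ t' ξ - sol ν u₀ t ξ‖ₑ)
      ≤ freqNorm φ s p q (fun ξ => ENNReal.ofReal ((t' - t) / η) *
          (‖u₀ ξ‖ₑ + fluxMaj (maj ν u₀) (maj ν u₀) 0 t' ξ) +
            fluxMaj (maj ν u₀) (maj ν u₀) (t - η) t' ξ) := by
        refine freqNorm_mono hq ?_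
        filter_upwards [ae_ne_zero_E3,
          H.ae_maj_ne_top hφ hν hp1 hq hα hα1 (show 0 ≤ t by linarith) (by linarith),
          H.ae_maj_ne_top hφ hν hp1 hq hα hα1 (show 0 ≤ t' by linarith) htb] with ξ h3 h4 h5
        exact enorm_sol_increment_le hν hu hη ht htt' h3 h4 h5
    _ ≤ ENNReal.ofReal ((t' - t) / η) * (freqNorm φ s p q (fun ξ => ‖u₀ ξ‖ₑ) +
          freqNorm φ s p q (fluxMaj (maj ν u₀) (maj ν u₀) 0 t')) +
          freqNorm φ s p q (fluxMaj (maj ν u₀) (maj ν u₀) (t - η) t') := by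
        refine (freqNorm_add_le hφ hp1 hq ((hu.enorm.add hf0).const_mul _) hf1).trans
          (add_le_add ?_ le_rfl)
        refine (freqNorm_const_mul hq ENNReal.ofReal_ne_top _).trans_le ?_
        exact mul_le_mul_right (freqNorm_add_le hφ hp1 hq hu.enorm hf0) _
    _ ≤ _ := add_le_add (mul_le_mul_right (add_le_add le_rfl h1) _) h2

/-- Continuity in time, with values in the Fourier-Herz space, at positive times. -/
theorem MajBound.tendsto_freqNorm (H : MajBound φ s p q ν b u₀ D) (hφ : IsLittlewoodPaley φ)
    (hν : 0 ≤ ν) (hp1 : 1 ≤ p) (hq : 1 ≤ q) (hα : 0 < 3 * (1 - 1 / p.toReal) - s)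
    (hα1 : 3 * (1 - 1 / p.toReal) - s < 1) {t₀ : ℝ} (ht₀ : 0 < t₀) (htb : t₀ ≤ b) :
    Tendsto (fun t => freqNorm φ s p q (fun ξ => ‖sol ν u₀ t ξ - sol ν u₀ t₀ ξ‖ₑ))
      (𝓝[Set.Icc 0 b] t₀) (𝓝 0) := by
  rw [ENNReal.tendsto_nhds_zero]
  intro ε hε
  -- The margin `η` is chosen first, with `D η < ε`; as `t → t₀` the bound for the increment tends to
  -- `D η`.
  have hD : ∀ᶠ h : ℝ in 𝓝[>] 0, D h < ε ∧ h < t₀ := by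
    have h1 : ∀ᶠ h : ℝ in 𝓝 0, D h < ε ∧ h < t₀ :=
      ((H.continuous.tendsto 0).eventually_lt_const (by rw [H.zero]; exact hε)).and
        (eventually_lt_nhds ht₀)
    exact h1.filter_mono nhdsWithin_le_nhds
  obtain ⟨η, ⟨hη1, hη2⟩, hη0⟩ := (hD.and self_mem_nhdsWithin).exists
  have hη0 : 0 < η := hη0
  set A := freqNorm φ s p q (fun ξ => ‖u₀ ξ‖ₑ) with hA
  have hlim : Tendsto (fun t : ℝ => ENNReal.ofReal (|t - t₀| / η) * (A + D (max t t₀)) +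
      D (|t - t₀| + η)) (𝓝 t₀) (𝓝 (D η)) := by
    have h1 : Tendsto (fun t : ℝ => ENNReal.ofReal (|t - t₀| / η)) (𝓝 t₀) (𝓝 0) := by
      have : Continuous fun t : ℝ => ENNReal.ofReal (|t - t₀| / η) :=
        ENNReal.continuous_ofReal.comp (by fun_prop)
      simpa using this.tendsto t₀
    have h2 : Tendsto (fun t : ℝ => A + D (max t t₀)) (𝓝 t₀) (𝓝 (A + D t₀)) := by
      have h3 : Continuous fun t : ℝ => D (max t t₀) :=
        H.continuous.comp (by fun_prop)
      have := h3.tendsto t₀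
      rw [max_self] at this
      exact this.const_add A
    have h4 : Tendsto (fun t : ℝ => D (|t - t₀| + η)) (𝓝 t₀) (𝓝 (D η)) := by
      have h3 : Continuous fun t : ℝ => D (|t - t₀| + η) := H.continuous.comp (by fun_prop)
      simpa using h3.tendsto t₀
    have h5 := ENNReal.Tendsto.mul h1 (Or.inr (ENNReal.add_ne_top.2 ⟨H.initial_ne_top, H.ne_top t₀⟩))
      h2 (Or.inr ENNReal.zero_ne_top)
    simpa using h5.add h4
  have hev : ∀ᶠ t in 𝓝[Set.Icc 0 b] t₀, ENNReal.ofReal (|t - t₀| / η) * (A + D (max t t₀)) +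
      D (|t - t₀| + η) < ε := (hlim.eventually_lt_const hη1).filter_mono nhdsWithin_le_nhds
  have hev2 : ∀ᶠ t in 𝓝[Set.Icc 0 b] t₀, η < t :=
    (eventually_gt_nhds hη2).filter_mono nhdsWithin_le_nhds
  filter_upwards [hev, hev2, self_mem_nhdsWithin] with t h1 h2 h3
  have h3 : t ≤ b := h3.2
  refine le_trans ?_ h1.le
  rcases le_total t t₀ with h4 | h4
  · have h5 := H.freqNorm_increment_le hφ hν hp1 hq hα hα1 hη0 h2.le h4 htb
    rw [abs_sub_comm, abs_of_nonneg (sub_nonneg.2 h4), max_eq_right h4]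
    simpa only [enorm_sub_rev] using h5
  · have h5 := H.freqNorm_increment_le hφ hν hp1 hq hα hα1 hη0 hη2.le h4 h3
    rwa [abs_of_nonneg (sub_nonneg.2 h4), max_eq_left h4]

theorem MajBound.enorm_sub_initial_le (H : MajBound φ s p q ν b u₀ D) (hφ : IsLittlewoodPaley φ)
    (hν : 0 ≤ ν) (hp1 : 1 ≤ p) (hq : 1 ≤ q) (hα : 0 < 3 * (1 - 1 / p.toReal) - s)
    (hα1 : 3 * (1 - 1 / p.toReal) - s < 1) {t : ℝ} (ht : 0 ≤ t) (htb : t ≤ b) :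
    ∀ᵐ ξ, ‖sol ν u₀ t ξ - u₀ ξ‖ₑ ≤ ‖heatSymbol ν t ξ - 1‖ₑ * ‖u₀ ξ‖ₑ +
      fluxMaj (maj ν u₀) (maj ν u₀) 0 t ξ := by
  filter_upwards [ae_ne_zero_E3, H.ae_maj_ne_top hφ hν hp1 hq hα hα1 ht htb] with ξ h1 h2
  exact enorm_sol_sub_initial_le hν H.measurable h1 h2

theorem MajBound.tendsto_flux (H : MajBound φ s p q ν b u₀ D) :
    Tendsto (fun t => freqNorm φ s p q (fluxMaj (maj ν u₀) (maj ν u₀) 0 t))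
      (𝓝[Set.Icc 0 b] 0) (𝓝 0) := by
  have h1 := H.continuous.tendsto 0
  rw [H.zero] at h1
  refine tendsto_of_tendsto_of_tendsto_of_le_of_le' tendsto_const_nhds
    (h1.mono_left (nhdsWithin_le_nhds (s := Set.Icc 0 b))) (Eventually.of_forall fun _ => zero_le) ?_
  filter_upwards [self_mem_nhdsWithin] with t ht
  simpa using H.flux_le 0 t le_rfl ht.1 ht.2

/-- Norm continuity at the initial time, for `q < ∞`. -/
theorem MajBound.tendsto_freqNorm_zero (H : MajBound φ s p q ν b u₀ D) (hφ : IsLittlewoodPaley φ)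
    (hν : 0 ≤ ν) (hp1 : 1 ≤ p) (hq : 1 ≤ q) (hq' : q ≠ ∞) (hα : 0 < 3 * (1 - 1 / p.toReal) - s)
    (hα1 : 3 * (1 - 1 / p.toReal) - s < 1) :
    Tendsto (fun t => freqNorm φ s p q (fun ξ => ‖sol ν u₀ t ξ - u₀ ξ‖ₑ))
      (𝓝[Set.Icc 0 b] 0) (𝓝 0) := by
  have h1 := (tendsto_freqNorm_heat_sub_one hφ hq hq' hν H.initial_ne_top).mono_left
    (nhdsWithin_mono 0 (fun _ ht => ht.1 : Set.Icc (0 : ℝ) b ⊆ Set.Ici 0))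
  have h2 := h1.add H.tendsto_flux
  rw [add_zero] at h2
  refine tendsto_of_tendsto_of_tendsto_of_le_of_le' tendsto_const_nhds h2
    (Eventually.of_forall fun _ => zero_le) ?_
  filter_upwards [self_mem_nhdsWithin] with t ht
  have hm := measurable_maj (ν := ν) H.measurable
  exact (freqNorm_mono hq (H.enorm_sub_initial_le hφ hν hp1 hq hα hα1 ht.1 ht.2)).trans
    (freqNorm_add_le hφ hp1 hq ((measurable_heatSymbol_sub_one ν t).mul H.measurable.enorm)
      (measurable_fluxMaj hm hm 0 t))

/-- Continuity at the initial time in the weighted `L¹` norm, for all `q`; it implies convergence as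
tempered distributions. -/
theorem MajBound.tendsto_lintegral_zero (H : MajBound φ s p q ν b u₀ D) (hφ : IsLittlewoodPaley φ)
    (hν : 0 ≤ ν) (hp1 : 1 ≤ p) (hq : 1 ≤ q) (hα : 0 < 3 * (1 - 1 / p.toReal) - s)
    (hα1 : 3 * (1 - 1 / p.toReal) - s < 1) :
    Tendsto (fun t => ∫⁻ ξ, weight ξ * ‖sol ν u₀ t ξ - u₀ ξ‖ₑ) (𝓝[Set.Icc 0 b] 0) (𝓝 0) := by
  obtain ⟨C, hC, h⟩ := exists_weight_le_freqNorm (s := s) (q := q) hφ hp1 hq hα hα1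
  have hu := H.measurable
  have hm := measurable_maj (ν := ν) hu
  have h1 := (tendsto_lintegral_heat_sub_one hν hu.enorm
    (ne_top_of_le_ne_top (ENNReal.mul_ne_top hC H.initial_ne_top) (h _ hu.enorm))).mono_left
    (nhdsWithin_mono 0 (fun _ ht => ht.1 : Set.Icc (0 : ℝ) b ⊆ Set.Ici 0))
  have h2 := h1.add (ENNReal.Tendsto.const_mul H.tendsto_flux (Or.inr hC))
  rw [mul_zero, add_zero] at h2
  refine tendsto_of_tendsto_of_tendsto_of_le_of_le' tendsto_const_nhds h2
    (Eventually.of_forall fun _ => zero_le) ?_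
  filter_upwards [self_mem_nhdsWithin] with t ht
  calc ∫⁻ ξ, weight ξ * ‖sol ν u₀ t ξ - u₀ ξ‖ₑ
      ≤ ∫⁻ ξ, (weight ξ * (‖heatSymbol ν t ξ - 1‖ₑ * ‖u₀ ξ‖ₑ) +
          weight ξ * fluxMaj (maj ν u₀) (maj ν u₀) 0 t ξ) := by
        refine lintegral_mono_ae ?_
        filter_upwards [H.enorm_sub_initial_le hφ hν hp1 hq hα hα1 ht.1 ht.2] with ξ hξ
        rw [← mul_add]
        exact mul_le_mul_right hξ _
    _ ≤ _ := by
        have h3 : Measurable fun ξ => weight ξ * (‖heatSymbol ν t ξ - 1‖ₑ * ‖u₀ ξ‖ₑ) :=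
          measurable_weight.mul ((measurable_heatSymbol_sub_one ν t).mul hu.enorm)
        rw [lintegral_add_left h3]
        exact add_le_add le_rfl (h _ (measurable_fluxMaj hm hm 0 t))

end

/-! ### Existence of mild solutions -/

theorem clNorm_mono {s : ℝ} {p q r T T' : ℝ≥0∞} (hq : 1 ≤ q) (h : T ≤ T') (u : ℝ → VDist) :
    clNorm φ s p q r T u ≤ clNorm φ s p q r T' u :=
  seqNorm_mono hq fun _ => mul_le_mul_right
    (eLpNorm_mono_measure _ (Measure.restrict_mono (timeIoo_mono h) le_rfl)) _

/-- The field with Fourier transform `sol` is a mild solution in the required class. At each time in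
`[0, b]` the majorant is finite at almost all frequencies, so all the pointwise statements apply. -/
theorem MajBound.exists_isMildSolution {s : ℝ} {p q : ℝ≥0∞} {ν b : ℝ} {U₀ : E3 → V3}
    {D : ℝ → ℝ≥0∞} (H : MajBound φ s p q ν b U₀ D) (hφ : IsLittlewoodPaley φ) (hν : 0 ≤ ν)
    (hp1 : 1 ≤ p) (hp : p ≠ ∞) (hq : 1 ≤ q) (hα : 0 < 3 * (1 - 1 / p.toReal) - s)
    (hα1 : 3 * (1 - 1 / p.toReal) - s < 1) (hb : 0 < b) {N : ℝ≥0∞} (hN : N ≠ ∞)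
    (hNb : slabNorm φ s p q 0 b (maj ν U₀) ≤ N) {u₀ : VDist} (hu₀ : IsGivenBy (𝓕 u₀) U₀)
    (hherm : ∀ ξ, U₀ (-ξ) = conjV (U₀ ξ)) (hdiv : ∀ ξ, ∑ k, (ξ k : ℂ) * U₀ ξ k = 0) :
    ∃ u : ℝ → VDist, MemX φ s p q (ENNReal.ofReal b) u ∧
      IsMildSolution ν (ENNReal.ofReal b) u₀ u ∧
      (∀ t ∈ timeIco (ENNReal.ofReal b), fhNorm φ s p q (u t) ≤ fhNorm φ s p q u₀ + D t) ∧
      ∀ r : ℝ≥0∞, 1 ≤ r →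
        clNorm φ (s + (2 / r).toReal) p q r (ENNReal.ofReal b) u ≤ N := by
  have hum := H.measurable
  have hsm := measurable_sol hν hum
  have hmm := measurable_maj (ν := ν) hum
  have hmt : ∀ t, 0 ≤ t → t ≤ b → ∀ᵐ ξ, maj ν U₀ t ξ ≠ ∞ := fun t h1 h2 =>
    H.ae_maj_ne_top hφ hν hp1 hq hα hα1 h1 h2
  have hw : ∀ t, 0 ≤ t → t ≤ b → ∫⁻ ξ, weight ξ * ‖sol ν U₀ t ξ‖ₑ ≠ ∞ := fun t h1 h2 =>
    ne_top_of_le_ne_top (H.lintegral_maj_ne_top hφ hν hp1 hq hα hα1 h1 h2)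
      (lintegral_mono fun ξ => mul_le_mul_right (enorm_sol_le hν hum t ξ) _)
  -- Outside `[0, b]` the value of the field is irrelevant and is set to `0`.
  have hex : ∀ t, ∃ f : VDist, 0 ≤ t → t ≤ b → IsGivenBy (𝓕 f) (sol ν U₀ t) := by
    intro t
    by_cases h : 0 ≤ t ∧ t ≤ b
    · obtain ⟨f, hf⟩ := exists_isGivenBy hsm.of_uncurry_left (hw t h.1 h.2)
      exact ⟨f, fun _ _ => hf⟩
    · exact ⟨0, fun h1 h2 => absurd ⟨h1, h2⟩ h⟩
  choose u hu using hex
  have hIco : ∀ t ∈ timeIco (ENNReal.ofReal b), 0 ≤ t ∧ t ≤ b := fun t ht =>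
    ⟨ht.1, ((ENNReal.ofReal_lt_ofReal_iff hb).1 ht.2).le⟩
  have hU : ∀ t ∈ timeIco (ENNReal.ofReal b), IsGivenBy (𝓕 (u t)) (sol ν U₀ t) := fun t ht =>
    hu t (hIco t ht).1 (hIco t ht).2
  have hsub : timeIco (ENNReal.ofReal b) ⊆ Set.Icc 0 b := fun t ht => hIco t ht
  have h0 : ∀ᵐ ξ, sol ν U₀ 0 ξ = U₀ ξ := by
    filter_upwards [hmt 0 le_rfl hb.le] with ξ hξ
    rw [sol_eq hν hum hξ]
    simp [duhamel, heatSymbol]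
  have hu0 : IsGivenBy (𝓕 (u 0)) U₀ := (hu 0 le_rfl hb.le).congr h0
  have hfh : ∀ t ∈ timeIco (ENNReal.ofReal b),
      fhNorm φ s p q (u t) ≤ fhNorm φ s p q u₀ + D t := by
    intro t ht
    rw [hφ.fhNorm_eq_freqNorm (hU t ht), hφ.fhNorm_eq_freqNorm hu₀]
    refine le_trans (freqNorm_mono hq (ae_of_all _ fun ξ => enorm_sol_le hν hum t ξ)) ?_
    exact H.freqNorm_maj_le hφ hν hp1 hq (hIco t ht).1 (hIco t ht).2
  have hcl : ∀ r : ℝ≥0∞, 1 ≤ r →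
      clNorm φ (s + (2 / r).toReal) p q r (ENNReal.ofReal b) u ≤ N := by
    intro r hr
    have hfl : ∀ t ∈ Set.Ioo 0 b, ∀ j,
        flNorm p (block φ j (u t)) = blockNorm φ p j (fun ξ => ‖sol ν U₀ t ξ‖ₑ) :=
      fun t ht j => hφ.flNorm_block (hu t ht.1.le ht.2.le) p j
    refine (clNorm_le_slabNorm hq hr (fun j => ?_) fun t ht j => ?_).trans hNb
    · refine AEMeasurable.congr
        (measurable_blockNorm hφ hp1 hp j
        (f := fun t ξ => ‖sol ν U₀ t ξ‖ₑ) hsm.enorm).aemeasurable ?_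
      filter_upwards [ae_restrict_mem measurableSet_Ioo] with t ht
      exact (hfl t ht j).symm
    · rw [hfl t ht j]
      exact blockNorm_mono (ae_of_all _ fun ξ => enorm_sol_le hν hum t ξ)
  have hfs : ∀ t₀ ∈ timeIco (ENNReal.ofReal b), ∀ t ∈ timeIco (ENNReal.ofReal b),
      fhNorm φ s p q (u t - u t₀) =
        freqNorm φ s p q fun ξ => ‖sol ν U₀ t ξ - sol ν U₀ t₀ ξ‖ₑ := by
    intro t₀ ht₀ t ht
    have h1 := (hU t ht).sub (hU t₀ ht₀)
    rw [← fourier_sub] at h1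
    exact hφ.fhNorm_eq_freqNorm h1
  refine ⟨u, ⟨⟨fun t ht => ⟨fun ψ => hφ.hasSum_block (hU t ht) ψ, ?_⟩, fun t₀ ht₀ hq₀ => ?_,
    fun _ ψ => ?_⟩, fun r hr T' hT' => ?_⟩, ⟨fun t ht => ?_, fun t ht => ?_, ?_,
      sol ν U₀, hsm.aestronglyMeasurable, hU, fun t ht => ?_⟩, hfh, hcl⟩
  · refine (hfh t ht).trans_lt (ENNReal.add_lt_top.2 ⟨?_, (H.ne_top t).lt_top⟩)
    rw [hφ.fhNorm_eq_freqNorm hu₀]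
    exact H.initial_ne_top.lt_top
  · have hev : (fun t => freqNorm φ s p q fun ξ => ‖sol ν U₀ t ξ - sol ν U₀ t₀ ξ‖ₑ)
        =ᶠ[𝓝[timeIco (ENNReal.ofReal b)] t₀] fun t => fhNorm φ s p q (u t - u t₀) := by
      filter_upwards [self_mem_nhdsWithin] with t ht using (hfs t₀ ht₀ t ht).symm
    refine Tendsto.congr' hev ?_
    rcases ht₀.1.eq_or_lt with h1 | h1
    · have hq' : q ≠ ∞ := hq₀.resolve_right (by rw [← h1]; exact lt_irrefl _)
      rw [← h1]
      have h2 := (H.tendsto_freqNorm_zero hφ hν hp1 hq hq' hα hα1).mono_left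
        (nhdsWithin_mono 0 hsub)
      refine h2.congr fun t => ?_
      refine le_antisymm (freqNorm_mono hq ?_) (freqNorm_mono hq ?_) <;>
        filter_upwards [h0] with ξ hξ <;> rw [hξ]
    · exact (H.tendsto_freqNorm hφ hν hp1 hq hα hα1 h1 (hIco t₀ ht₀).2).mono_left
        (nhdsWithin_mono t₀ hsub)
  · rw [tendsto_iff_edist_tendsto_0]
    set Cψ := ENNReal.ofReal
      (2 * (Finset.Iic (1, 0)).sup (schwartzSeminormFamily ℂ E3 ℂ) (𝓕⁻ ψ)) with hCψ
    have h1 := ENNReal.Tendsto.const_mul ((H.tendsto_lintegral_zero hφ hν hp1 hq hα hα1).mono_left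
      (nhdsWithin_mono 0 hsub)) (Or.inr (show Cψ ≠ ∞ from ENNReal.ofReal_ne_top))
    rw [mul_zero] at h1
    refine tendsto_of_tendsto_of_tendsto_of_le_of_le' tendsto_const_nhds h1
      (Eventually.of_forall fun _ => zero_le) ?_
    filter_upwards [self_mem_nhdsWithin] with t ht
    have h2 := (hU t ht).sub hu0
    rw [← fourier_sub] at h2
    rw [edist_eq_enorm_sub]
    exact enorm_apply_le h2 ψ
  · exact (clNorm_mono hq hT'.le u).trans_lt ((hcl r hr).trans_lt hN.lt_top)
  · have h1 := hmt t (hIco t ht).1 (hIco t ht).2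
    refine (hU t ht).isReal ?_
    filter_upwards [h1, (Measure.measurePreserving_neg
      (volume : Measure E3)).quasiMeasurePreserving.ae h1] with ξ h2 h3
    exact sol_neg hν hum hherm h2 h3
  · refine (hU t ht).isDivFree ?_
    filter_upwards [hmt t (hIco t ht).1 (hIco t ht).2, ae_ne_zero_E3] with ξ h1 h2
    exact sum_coord_mul_sol hν hum hdiv h2 h1
  · exact hu0.dist_eq hu₀ (ae_of_all _ fun _ => rfl)
  · filter_upwards [hmt t (hIco t ht).1 (hIco t ht).2, ae_ne_zero_E3, h0] with ξ h1 h2 h3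
    refine ⟨convIntegrable_sol hν hum h2 h1, ?_⟩
    rw [h3]
    exact sol_eq hν hum h1

/-! ### The solution with vanishing initial value -/

theorem isGivenBy_zero : IsGivenBy (𝓕 (0 : VDist)) (fun _ => 0) := by
  refine ⟨locallyIntegrable_const 0, fun ψ => ?_⟩
  simp only [smul_zero]
  refine ⟨integrable_zero _ _ _, ?_⟩
  rw [integral_zero]
  rfl

theorem flNorm_block_zero (p : ℝ≥0∞) (j : ℤ) : flNorm p (block φ j (0 : VDist)) = 0 := by
  have h : block φ j (0 : VDist) = 0 := map_zero _
  rw [h, flNorm_eq isGivenBy_zero, eLpNorm_zero']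

theorem fhNorm_zero {s : ℝ} {p q : ℝ≥0∞} (hq : 1 ≤ q) : fhNorm φ s p q (0 : VDist) = 0 := by
  simp only [fhNorm, flNorm_block_zero, mul_zero, seqNorm_zero hq]

theorem clNorm_zero {s : ℝ} {p q r T : ℝ≥0∞} (hq : 1 ≤ q) :
    clNorm φ s p q r T (fun _ => (0 : VDist)) = 0 := by
  simp only [clNorm, flNorm_block_zero]
  simp [seqNorm_zero hq]

theorem memX_zero (hφ : IsLittlewoodPaley φ) {s : ℝ} {p q T : ℝ≥0∞} (hq : 1 ≤ q) :
    MemX φ s p q T fun _ => 0 := by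
  refine ⟨⟨fun _ _ => ⟨hφ.hasSum_block isGivenBy_zero, ?_⟩, fun _ _ _ => ?_, fun _ _ => ?_⟩,
    fun r _ T' _ => ?_⟩
  · rw [fhNorm_zero hq]; exact ENNReal.zero_lt_top
  · simp only [sub_zero, fhNorm_zero hq]; exact tendsto_const_nhds
  · exact tendsto_const_nhds
  · rw [clNorm_zero hq]; exact ENNReal.zero_lt_top

theorem isMildSolution_zero (ν : ℝ) (T : ℝ≥0∞) : IsMildSolution ν T 0 fun _ => 0 := by
  have h0 : ∀ ξ, leraySymbol ξ 0 = 0 := fun ξ => map_zero (lerayCLM ξ)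
  refine ⟨fun _ _ => isGivenBy_zero.isReal (by simp), fun _ _ => isGivenBy_zero.isDivFree (by simp),
    rfl, fun _ _ => 0, aestronglyMeasurable_const, fun _ _ => isGivenBy_zero,
    fun t _ => ae_of_all _ fun ξ => ⟨by simp, ?_⟩⟩
  simp [convectionSymbol, h0]

theorem IsLittlewoodPaley.eq_zero_of_fhNorm (hφ : IsLittlewoodPaley φ) {s : ℝ} {p q : ℝ≥0∞}
    (hp1 : 1 ≤ p) (hq : 1 ≤ q) {f : VDist} {g : E3 → V3} (hg : Measurable g)
    (h : IsGivenBy (𝓕 f) g) (h0 : fhNorm φ s p q f = 0) : f = 0 := by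
  refine h.dist_eq isGivenBy_zero ?_
  have h1 : ∀ᵐ ξ, ‖g ξ‖ₑ = 0 := by
    refine hφ.ae_eq_zero_of_blockNorm hp1 hg.enorm fun j => ?_
    have h2 := le_seqNorm hq (fun j : ℤ => 2 ^ ((j : ℝ) * s) * flNorm p (block φ j f)) j
    rw [show seqNorm q (fun j : ℤ => 2 ^ ((j : ℝ) * s) * flNorm p (block φ j f)) = 0 from h0,
      nonpos_iff_eq_zero, mul_eq_zero, hφ.flNorm_block h] at h2
    exact h2.resolve_left (two_rpow_ne_zero _)
  filter_upwards [h1] with ξ hξ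
  exact enorm_eq_zero.1 hξ

/-! ### Existence for small times -/

/-- The conditions on the indices: `p` is finite, and the exponent `α = 3 (1 - 1/p) - s` of the low
frequencies satisfies `0 < α < 1`, where `1 - α = s - s_p`. -/
theorem index_conditions {s : ℝ} {p : ℝ≥0∞} (hp1 : 1 ≤ p) (hs : criticalIndex p < s) (hs0 : s ≤ 0)
    (hsp : ¬ (s = 0 ∧ p = 1)) :
    p ≠ ∞ ∧ 0 < 3 * (1 - 1 / p.toReal) - s ∧ 3 * (1 - 1 / p.toReal) - s < 1 ∧ -1 < s ∧
      1 - (3 * (1 - 1 / p.toReal) - s) = s - criticalIndex p := by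
  have hp : p ≠ ∞ := by
    rintro rfl
    simp only [criticalIndex, ENNReal.div_top, ENNReal.toReal_zero] at hs
    linarith
  have hP1 : 1 ≤ p.toReal := by
    rw [← ENNReal.toReal_one]
    exact ENNReal.toReal_mono hp hp1
  have hcrit : criticalIndex p = 2 - 3 * (1 / p.toReal) := by
    rw [criticalIndex, ENNReal.toReal_div, ENNReal.toReal_ofNat]
    ring
  have hinv : 1 / p.toReal ≤ 1 := by
    rw [div_le_one (by linarith)]; exact hP1
  refine ⟨hp, ?_, by linarith, by linarith, by rw [hcrit]; ring⟩
  rcases hinv.lt_or_eq with h | h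
  · linarith
  · have h1 : p.toReal = 1 := by
      rw [div_eq_iff (by linarith)] at h
      linarith
    have h2 : p = 1 := by rw [← ENNReal.ofReal_toReal hp, h1, ENNReal.ofReal_one]
    have h3 : s ≠ 0 := fun h0 => hsp ⟨h0, h2⟩
    have h4 : s < 0 := lt_of_le_of_ne hs0 h3
    rw [h]
    linarith

/-- Existence for a given initial value on `(0, b)`, if `b` is small in terms of its norm. The constants
of the linear and bilinear estimates enter as hypotheses, so that they are seen not to depend on the
initial value. -/
theorem exists_isMildSolution_of_small (hφ : IsLittlewoodPaley φ) {ν : ℝ} (hν : 0 < ν) {s e : ℝ}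
    {p q : ℝ≥0∞} (hp1 : 1 ≤ p) (hp : p ≠ ∞) (hq : 1 ≤ q) (hα : 0 < 3 * (1 - 1 / p.toReal) - s)
    (hα1 : 3 * (1 - 1 / p.toReal) - s < 1) (he : 0 < e) {C₁ C₂ : ℝ≥0∞} (hC₁ : C₁ ≠ ∞)
    (hC₂ : C₂ ≠ ∞)
    (hheat : ∀ (b : ℝ) (f : E3 → ℝ≥0∞) (j : ℤ),
      slab φ s p 0 b (fun t ξ => ENNReal.ofReal (heatSymbol ν t ξ) * f ξ) j ≤
        C₁ * (2 ^ ((j : ℝ) * s) * blockNorm φ p j f))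
    (hbil : ∀ (a b : ℝ), a ≤ b → ∀ f g : ℝ → E3 → ℝ≥0∞,
      Measurable (Function.uncurry f) → Measurable (Function.uncurry g) →
      slabNorm φ s p q a b (duhamelMaj ν f g a) ≤
        C₂ * ENNReal.ofReal (b - a) ^ e * slabNorm φ s p q a b f * slabNorm φ s p q a b g ∧
      seqNorm q (fun j => 2 ^ ((j : ℝ) * s) * blockNorm φ p j (fluxMaj f g a b)) ≤
        C₂ * ENNReal.ofReal (b - a) ^ e * slabNorm φ s p q a b f * slabNorm φ s p q a b g)
    {u₀ : VDist} (hu₀ : MemFH φ s p q u₀) (hr : IsReal u₀) (hd : IsDivFree u₀) {b : ℝ} (hb : 0 < b)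
    (hsmall : C₂ * ENNReal.ofReal b ^ e * (2 * (C₁ * fhNorm φ s p q u₀)) * 2 ≤ 1) :
    ∃ u : ℝ → VDist, MemX φ s p q (ENNReal.ofReal b) u ∧
      IsMildSolution ν (ENNReal.ofReal b) u₀ u ∧
      (∀ t ∈ timeIco (ENNReal.ofReal b),
        fhNorm φ s p q (u t) ≤ (1 + 2 * C₁) * fhNorm φ s p q u₀) ∧
      ∀ r : ℝ≥0∞, 1 ≤ r → clNorm φ (s + (2 / r).toReal) p q r (ENNReal.ofReal b) u ≤
        (1 + 2 * C₁) * fhNorm φ s p q u₀ := by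
  obtain ⟨g, hgm, hg⟩ := hu₀.exists_isGivenBy hφ hp1 hq hα hα1
  obtain ⟨C, hC, hweight⟩ := exists_weight_le_freqNorm (s := s) (q := q) hφ hp1 hq hα hα1
  have hρ := hu₀.2.ne
  have hgw : ∫⁻ ξ, weight ξ * ‖g ξ‖ₑ ≠ ∞ := by
    refine ne_top_of_le_ne_top (ENNReal.mul_ne_top hC ?_) (hweight _ hgm.enorm)
    rwa [← hφ.fhNorm_eq_freqNorm hg]
  obtain ⟨U₀, hU₀m, hU₀, hherm, hdiv⟩ := exists_hermitian hr hd hg hgm hgw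
  set ρ := fhNorm φ s p q u₀ with hρd
  have hρe : freqNorm φ s p q (fun ξ => ‖U₀ ξ‖ₑ) = ρ := (hφ.fhNorm_eq_freqNorm hU₀).symm
  set R := C₁ * ρ with hR
  have hRt : R ≠ ∞ := ENNReal.mul_ne_top hC₁ hρ
  set N := 2 * R with hN
  have hNt : N ≠ ∞ := ENNReal.mul_ne_top (by norm_num) hRt
  have hmm := measurable_maj (ν := ν) hU₀m
  have hNb : slabNorm φ s p q 0 b (maj ν U₀) ≤ N := by
    refine slabNorm_maj_le hφ hp1 hp hq hU₀m (K := C₂ * ENNReal.ofReal b ^ e) ?_ ?_ hsmall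
    · refine (seqNorm_mono hq fun j => hheat b (fun ξ => ‖U₀ ξ‖ₑ) j).trans_eq ?_
      rw [seqNorm_const_mul hq, hR, ← hρe]
      rfl
    · intro f hf
      simpa using (hbil 0 b hb.le f f hf hf).1
  -- The bilinear estimate on an interval of length `h` inside `(0, b)`, applied to the majorant.
  set D : ℝ → ℝ≥0∞ := fun h => C₂ * ENNReal.ofReal h ^ e * N * N with hD
  have H : MajBound φ s p q ν b U₀ D := by
    refine ⟨hU₀m, by rwa [hρe], fun a t ha hat htb => ?_, fun h => ?_, ?_, ?_⟩
    · have h1 : slabNorm φ s p q a t (maj ν U₀) ≤ N :=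
        (slabNorm_mono_interval hq (Set.Ioo_subset_Ioo ha htb) _).trans hNb
      exact ((hbil a t hat _ _ hmm hmm).2).trans (by simp only [hD]; gcongr)
    · exact ENNReal.mul_ne_top (ENNReal.mul_ne_top (ENNReal.mul_ne_top hC₂
        (ENNReal.rpow_ne_top_of_nonneg he.le ENNReal.ofReal_ne_top)) hNt) hNt
    · have h1 : Continuous fun h : ℝ => ENNReal.ofReal h ^ e :=
        (ENNReal.continuous_rpow_const (y := e)).comp ENNReal.continuous_ofReal
      exact (ENNReal.continuous_mul_const hNt).comp ((ENNReal.continuous_mul_const hNt).comp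
        ((ENNReal.continuous_const_mul hC₂).comp h1))
    · simp [hD, ENNReal.zero_rpow_of_pos he]
  obtain ⟨u, hX, hu, hfh, hcl⟩ := H.exists_isMildSolution hφ hν.le hp1 hp hq hα hα1 hb hNt hNb hU₀
    hherm hdiv
  refine ⟨u, hX, hu, fun t ht => (hfh t ht).trans ?_, fun r hr => (hcl r hr).trans ?_⟩
  · have htb : t ≤ b := ((ENNReal.ofReal_lt_ofReal_iff hb).1 ht.2).le
    have h1 : D t ≤ R := by
      calc D t ≤ C₂ * ENNReal.ofReal b ^ e * N * N := by simp only [hD]; gcongr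
        _ = (C₂ * ENNReal.ofReal b ^ e * N * 2) * R := by rw [hN]; ring
        _ ≤ 1 * R := by gcongr
        _ = R := one_mul _
    calc ρ + D t ≤ ρ + 2 * R := by
          gcongr
          exact h1.trans (le_mul_of_one_le_left zero_le (by norm_num))
      _ = (1 + 2 * C₁) * ρ := by rw [hR]; ring
  · calc N ≤ ρ + N := le_add_self
      _ = (1 + 2 * C₁) * ρ := by rw [hN, hR]; ring

end FourierHerz

end

theorem mainTheorem7
    (φ : FourierHerz.E3 → ℝ) (hφ : FourierHerz.IsLittlewoodPaley φ)
    (ν : ℝ) (hν : 0 < ν) (s : ℝ) (p q : ℝ≥0∞) (hp : 1 ≤ p) (hq : 1 ≤ q)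
    (hs : FourierHerz.criticalIndex p < s) (hs0 : s ≤ 0) (hsp : ¬ (s = 0 ∧ p = 1)) :
    ∃ (c C : ℝ≥0) (Tstar : ℝ≥0∞ → ℝ≥0∞), 0 < c ∧
      (∀ ρ : ℝ≥0∞, ρ ≠ ∞ → 0 < Tstar ρ ∧
        (c : ℝ≥0∞) * ρ ^ (-2 / (s - FourierHerz.criticalIndex p)) ≤ Tstar ρ) ∧
      ∀ u₀ : FourierHerz.VDist, FourierHerz.MemFH φ s p q u₀ → FourierHerz.IsReal u₀ →
        FourierHerz.IsDivFree u₀ →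
        ∃ u : ℝ → FourierHerz.VDist,
          FourierHerz.MemX φ s p q (Tstar (FourierHerz.fhNorm φ s p q u₀)) u ∧
          FourierHerz.IsMildSolution ν (Tstar (FourierHerz.fhNorm φ s p q u₀)) u₀ u ∧
          (∀ t ∈ FourierHerz.timeIco (Tstar (FourierHerz.fhNorm φ s p q u₀)),
            FourierHerz.fhNorm φ s p q (u t) ≤ C * FourierHerz.fhNorm φ s p q u₀) ∧
          (∀ r : ℝ≥0∞, 1 ≤ r →
            FourierHerz.clNorm φ (s + (2 / r).toReal) p q r
              (Tstar (FourierHerz.fhNorm φ s p q u₀)) u ≤ C * FourierHerz.fhNorm φ s p q u₀) ∧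
          (∀ T : ℝ≥0∞, 0 < T → T ≤ Tstar (FourierHerz.fhNorm φ s p q u₀) →
            ∀ v : ℝ → FourierHerz.VDist, FourierHerz.MemX φ s p q T v →
              FourierHerz.IsMildSolution ν T u₀ v →
              ∀ t ∈ FourierHerz.timeIco T, v t = u t) := by
  obtain ⟨hp', hα, hα1, hs1, hδ⟩ := FourierHerz.index_conditions hp hs hs0 hsp
  set δ := s - FourierHerz.criticalIndex p with hδd
  have hδ0 : 0 < δ := sub_pos.2 hs
  obtain ⟨C₁, hC₁, hheat⟩ := FourierHerz.exists_heat_slab_le (φ := φ) (s := s) (p := p) hφ hν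
  obtain ⟨C₂, hC₂, hbil⟩ := FourierHerz.exists_bilinear_le (φ := φ) (s := s) (p := p) (q := q) hφ
    hν hp hp' hq hα hα1 hs1
  rw [hδ] at hbil
  lift C₁ to ℝ≥0 using hC₁
  lift C₂ to ℝ≥0 using hC₂
  -- With this `c` the smallness condition `4 C₁ C₂ T ^ (δ / 2) ρ ≤ 1` holds for
  -- `T = c ρ ^ (-2 / δ)`.
  set c : ℝ≥0 := ((4 * C₁ * C₂ + 1)⁻¹) ^ (2 / δ) with hc
  have hc0 : 0 < c := NNReal.rpow_pos (by positivity)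
  have hc0' : (c : ℝ≥0∞) ≠ 0 := by exact_mod_cast hc0.ne'
  have hcδ : (c : ℝ≥0∞) ^ (δ / 2) = ((4 * C₁ * C₂ + 1)⁻¹ : ℝ≥0) := by
    rw [← ENNReal.coe_rpow_of_nonneg _ (by positivity), hc, ← NNReal.rpow_mul]
    congr 1
    rw [show 2 / δ * (δ / 2) = 1 by field_simp, NNReal.rpow_one]
  refine ⟨c, 1 + 2 * C₁, fun ρ => c * ρ ^ (-2 / δ), hc0, fun ρ hρ => ⟨?_, le_rfl⟩, ?_⟩
  · refine ENNReal.mul_pos hc0' ?_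
    rw [Ne, ENNReal.rpow_eq_zero_iff, not_or]
    exact ⟨fun h => absurd h.2 (not_lt.2 (div_nonpos_of_nonpos_of_nonneg (by norm_num) hδ0.le)),
      fun h => hρ h.1⟩
  intro u₀ hu₀ hreal hdiv
  set ρ := FourierHerz.fhNorm φ s p q u₀ with hρ
  have hρt : ρ ≠ ∞ := hu₀.2.ne
  dsimp only
  set T : ℝ≥0∞ := c * ρ ^ (-2 / δ) with hT
  have hex : ∃ u : ℝ → FourierHerz.VDist, FourierHerz.MemX φ s p q T u ∧
      FourierHerz.IsMildSolution ν T u₀ u ∧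
      (∀ t ∈ FourierHerz.timeIco T, FourierHerz.fhNorm φ s p q (u t) ≤ (1 + 2 * C₁ : ℝ≥0) * ρ) ∧
      ∀ r : ℝ≥0∞, 1 ≤ r → FourierHerz.clNorm φ (s + (2 / r).toReal) p q r T u ≤
        (1 + 2 * C₁ : ℝ≥0) * ρ := by
    -- If `ρ = 0` then `T = ∞` and the solution is identically zero.
    rcases eq_or_ne ρ 0 with h0 | h0
    · obtain ⟨g, hgm, hg⟩ := hu₀.exists_isGivenBy hφ hp hq hα hα1
      have hz : u₀ = 0 := hφ.eq_zero_of_fhNorm hp hq hgm hg h0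
      refine ⟨fun _ => 0, FourierHerz.memX_zero hφ hq, ?_, fun t _ => ?_, fun r _ => ?_⟩
      · rw [hz]; exact FourierHerz.isMildSolution_zero ν T
      · rw [FourierHerz.fhNorm_zero hq]; exact zero_le
      · rw [FourierHerz.clNorm_zero hq]; exact zero_le
    · have hTt : T ≠ ∞ :=
        ENNReal.mul_ne_top ENNReal.coe_ne_top (ENNReal.rpow_ne_top_of_ne_zero h0 hρt)
      have hT0 : T ≠ 0 := by
        refine mul_ne_zero hc0' ?_
        exact (ENNReal.rpow_pos (pos_iff_ne_zero.2 h0) hρt).ne'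
      have hTb : ENNReal.ofReal T.toReal = T := ENNReal.ofReal_toReal hTt
      have hTδ : T ^ (δ / 2) = (c : ℝ≥0∞) ^ (δ / 2) * ρ⁻¹ := by
        rw [hT, ENNReal.mul_rpow_of_nonneg _ _ (by positivity), ← ENNReal.rpow_mul,
          show -2 / δ * (δ / 2) = -1 by field_simp, ENNReal.rpow_neg_one]
      have hsmall : C₂ * ENNReal.ofReal T.toReal ^ (δ / 2) * (2 * (C₁ * ρ)) * 2 ≤ 1 := by
        rw [hTb, hTδ, hcδ]
        calc (C₂ : ℝ≥0∞) * (((4 * C₁ * C₂ + 1)⁻¹ : ℝ≥0) * ρ⁻¹) * (2 * (C₁ * ρ)) * 2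
            = ((4 * C₁ * C₂ * (4 * C₁ * C₂ + 1)⁻¹ : ℝ≥0) : ℝ≥0∞) * (ρ * ρ⁻¹) := by
              push_cast; ring
          _ = ((4 * C₁ * C₂ * (4 * C₁ * C₂ + 1)⁻¹ : ℝ≥0) : ℝ≥0∞) := by
              rw [ENNReal.mul_inv_cancel h0 hρt, mul_one]
          _ ≤ 1 := by
              rw [ENNReal.coe_le_one_iff, ← div_eq_mul_inv]
              exact div_le_one_of_le₀ (by simp) (by positivity)
      have := FourierHerz.exists_isMildSolution_of_small hφ hν hp hp' hq hα hα1 (half_pos hδ0)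
        ENNReal.coe_ne_top ENNReal.coe_ne_top hheat hbil hu₀ hreal hdiv
        (ENNReal.toReal_pos hT0 hTt) hsmall
      rw [hTb] at this
      push_cast
      exact this
  obtain ⟨u, hX, hu, hfh, hcl⟩ := hex
  refine ⟨u, hX, hu, hfh, hcl, fun T' _ hT' v hvX hv t ht => ?_⟩
  refine FourierHerz.IsMildSolution.unique hφ hν hp hp' hq (half_pos hδ0) ENNReal.coe_ne_top
    (fun a b hab f g hf hg => (hbil a b hab f g hf hg).1) hv (hu.mono hT') hvX.cl_lt_top
    (fun r hr T'' hT'' => hX.cl_lt_top r hr T'' (hT''.trans_le hT')) t ht
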